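/- Let $k$ be an algebraically closed field of characteristic $p>0$, and let $X$, $Y$ be normal projective varieties over $k$. Let $f:X\to Y$ be a separable fibration over $k$, that is, a (projective) morphism with $f_*\mathcal{O}_X=\mathcal{O}_Y$ such that the field extension $K(X)/K(Y)$ is separable. Denote by $\eta$ the generic point of $Y$, by $X_\eta$ the generic fibre (a projective variety over $k(\eta)$), and by $F_Y^e:Y\to Y$ the $e$-th iterate of the absolute Frobenius. A $\mathbb{Q}$-Cartier divisor is an element of $\mathrm{CDiv}\otimes\mathbb{Q}$. For a $\mathbb{Q}$-Cartier divisor $B$ on a normal projective variety $V$ over a field, $\kappa(V,B)$ is the maximum of $\dim\Phi_{|mB|}(V)$ over the integers $m>0$ such that $mB$ is Cartier and $|mB|\neq\emptyset$, and $\kappa(V,B)=-\infty$ if there is no such $m$; $B$ is big if $\kappa(V,B)=\dim V$. A coherent sheaf $\mathcal{G}$ on $Y$ is generically globally generated if $H^0(Y,\mathcal{G})\to\mathcal{G}\otimes k(y)$ is surjective for all closed points $y$ of some non-empty open subset of $Y$. A torsion free coherent sheaf $\mathcal{F}$ on $Y$ is Frobenius weakly positive (FWP) if, for an ample $\mathbb{Q}$-Cartier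 divisor $A$ on $Y$, there are positive integers $n_e$ ($e=1,2,\dots$) such that $n_eA$ is Cartier, $F_Y^{e*}\mathcal{F}\otimes\mathcal{O}_Y(n_eA)$ is generically globally generated, and $n_e/p^e\to 0$ as $e\to\infty$. Let $D$ be a Cartier divisor on $X$, and assume that for some positive integer $e$ the sheaf $F_Y^{e*}f_*\mathcal{O}_X(D)$ contains a non-zero FWP subsheaf. Then for every big $\mathbb{Q}$-Cartier divisor $H$ on $Y$, $$\kappa(X,D+f^*H)\ \geq\ \kappa(X_\eta,D|_{X_\eta})+\dim Y .$$ -/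

import Mathlib

open CategoryTheory AlgebraicGeometry TopologicalSpace Opposite TensorProduct

universe u

namespace FWPKod
noncomputable section

section Cartier
variable (X : Scheme.{u}) [IsIntegral X]

/-- The image of the units of `𝒪_{X,x}` in `K(X)ˣ`. -/
def stalkUnits (x : X) : Subgroup (X.functionField)ˣ :=
  (Units.map (algebraMap (X.presheaf.stalk x) X.functionField).toMonoidHom).range

/-- The group of Cartier divisors of an integral scheme, i.e. of global sections of the sheaf
`𝒦ˣ/𝒪ˣ`, written multiplicatively through local equations: the families of classes in the stalks
`K(X)ˣ/𝒪_{X,x}ˣ` that are locally given by one rational function. -/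
def cartierSubgroup : Subgroup (∀ x : X, (X.functionField)ˣ ⧸ stalkUnits X x) where
  carrier := {D | ∀ x : X, ∃ U : X.Opens, x ∈ U ∧ ∃ g : (X.functionField)ˣ,
    ∀ y ∈ U, D y = QuotientGroup.mk g}
  one_mem' x := ⟨⊤, trivial, 1, fun _ _ => rfl⟩
  mul_mem' {D E} hD hE x := by
    obtain ⟨U, hU, g, hg⟩ := hD x
    obtain ⟨V, hV, h, hh⟩ := hE x
    exact ⟨U ⊓ V, ⟨hU, hV⟩, g * h, fun y hy => by
      rw [Pi.mul_apply, hg y hy.1, hh y hy.2]; rfl⟩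
  inv_mem' {D} hD x := by
    obtain ⟨U, hU, g, hg⟩ := hD x
    exact ⟨U, hU, g⁻¹, fun y hy => by rw [Pi.inv_apply, hg y hy]; rfl⟩

instance : CommGroup (cartierSubgroup X) where
  mul_comm D E := Subtype.ext (funext fun x => by
    obtain ⟨g, hg⟩ := QuotientGroup.mk_surjective (D.1 x)
    obtain ⟨h, hh⟩ := QuotientGroup.mk_surjective (E.1 x)
    change D.1 x * E.1 x = E.1 x * D.1 x
    rw [← hg, ← hh, ← QuotientGroup.mk_mul, ← QuotientGroup.mk_mul, mul_comm])

/-- The additive group `CDiv(X)` of Cartier divisors. -/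
abbrev CDiv : Type u := Additive (cartierSubgroup X)

/-- The `ℚ`-vector space `CDiv(X) ⊗ ℚ` of `ℚ`-Cartier divisors. -/
abbrev QCDiv : Type u := ℚ ⊗[ℤ] CDiv X

variable {X}

/-- The class of the local equations of `D` at `x`. -/
def CDiv.germ (D : CDiv X) (x : X) : (X.functionField)ˣ ⧸ stalkUnits X x := (D.toMul).1 x

lemma mem_of_mk_eq {x : X} {g h : (X.functionField)ˣ}
    (e : (QuotientGroup.mk g : (X.functionField)ˣ ⧸ stalkUnits X x) = QuotientGroup.mk h)
    {φ : X.functionField}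
    (hφ : φ * g ∈ (algebraMap (X.presheaf.stalk x) X.functionField).range) :
    φ * h ∈ (algebraMap (X.presheaf.stalk x) X.functionField).range := by
  obtain ⟨u, hu⟩ := QuotientGroup.eq.mp e
  have : (h : X.functionField) = g * algebraMap (X.presheaf.stalk x) X.functionField u := by
    have h2 : h = g * Units.map (algebraMap (X.presheaf.stalk x) X.functionField).toMonoidHom u := by
      rw [hu]; simp
    rw [h2]; rfl
  rw [this, ← mul_assoc]
  exact mul_mem hφ ⟨_, rfl⟩

/-- The stalk `𝒪_X(D)_x ⊆ K(X)`: the rational functions `φ` with `φ g ∈ 𝒪_{X,x}` for a local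
equation `g` of `D` at `x`. -/
def CDiv.stalk (D : CDiv X) (x : X) : Submodule (X.presheaf.stalk x) X.functionField where
  carrier := {φ | ∃ g : (X.functionField)ˣ, D.germ x = QuotientGroup.mk g ∧
    φ * g ∈ (algebraMap (X.presheaf.stalk x) X.functionField).range}
  zero_mem' := by
    obtain ⟨g, hg⟩ := QuotientGroup.mk_surjective (D.germ x)
    exact ⟨g, hg.symm, by rw [zero_mul]; exact zero_mem _⟩
  add_mem' {φ ψ} := by
    rintro ⟨g, hg, h1⟩ ⟨h, hh, h2⟩
    have := mem_of_mk_eq (hh.symm.trans hg) h2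
    exact ⟨g, hg, by rw [add_mul]; exact add_mem h1 this⟩
  smul_mem' r φ := by
    rintro ⟨g, hg, h1⟩
    refine ⟨g, hg, ?_⟩
    rw [Algebra.smul_def, mul_assoc]
    exact mul_mem ⟨_, rfl⟩ h1

/-- `φ` generates `𝒪_X(D)` at `x`: `φ g ∈ 𝒪_{X,x}ˣ` for a local equation `g` of `D`. -/
def CDiv.Generates (D : CDiv X) (φ : X.functionField) (x : X) : Prop :=
  ∃ v : (X.functionField)ˣ, (v : X.functionField) = φ ∧ D.germ x = QuotientGroup.mk v⁻¹

end Cartier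

section Sheaf
variable {X : Scheme.{u}} [IsIntegral X]

/-- The value in `K(X)` at `x ∈ U` of a regular function on `U`. -/
def toFunctionField (U : X.Opens) : Γ(X, U) →+* (U → X.functionField) :=
  RingHom.pi fun x => (algebraMap (X.presheaf.stalk x.1) X.functionField).comp
    (X.presheaf.germ U x.1 x.2).hom

/-- Being a section of `𝒪_X(D)`: locally constant with values in the stalks of `𝒪_X(D)`. -/
def CDiv.localPredicate (D : CDiv X) :
    TopCat.LocalPredicate (X := (X : TopCat.{u})) (fun _ => (X.functionField : Type u)) where
  pred {U} s := ∀ x : U, s x ∈ D.stalk x.1 ∧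
    ∃ V : Opens X, x.1 ∈ V ∧ ∀ y : U, y.1 ∈ V → s y = s x
  res {U V} i s hs x := by
    obtain ⟨h1, W, hW, h2⟩ := hs (i x)
    exact ⟨h1, W, hW, fun y hy => h2 (i y) hy⟩
  locality {U} s hs x := by
    obtain ⟨V, hV, i, h⟩ := hs x
    obtain ⟨h1, W, hW, h2⟩ := h ⟨x.1, hV⟩
    exact ⟨h1, V ⊓ W, ⟨hV, hW⟩, fun y hy => h2 ⟨y.1, hy.1⟩ hy.2⟩

/-- The sections over `U` of `𝒪_X(D)`. -/
def CDiv.sections (D : CDiv X) (U : X.Opens) : AddSubgroup (U → X.functionField) where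
  carrier := {s | D.localPredicate.pred s}
  zero_mem' x := ⟨zero_mem _, ⊤, trivial, fun _ _ => rfl⟩
  add_mem' {s t} hs ht x := by
    obtain ⟨h1, V, hV, h2⟩ := hs x
    obtain ⟨k1, W, hW, k2⟩ := ht x
    exact ⟨add_mem h1 k1, V ⊓ W, ⟨hV, hW⟩, fun y hy => by
      rw [Pi.add_apply, Pi.add_apply, h2 y hy.1, k2 y hy.2]⟩
  neg_mem' {s} hs x := by
    obtain ⟨h1, V, hV, h2⟩ := hs x
    exact ⟨neg_mem h1, V, hV, fun y hy => by rw [Pi.neg_apply, Pi.neg_apply, h2 y hy]⟩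

lemma toFunctionField_const (U : X.Opens) (r : Γ(X, U)) (x y : U) :
    toFunctionField U r x = toFunctionField U r y := by
  have : Nonempty U := ⟨x⟩
  have key : ∀ z : U, toFunctionField U r z = X.germToFunctionField U r := fun z =>
    Scheme.algebraMap_germ_eq_germToFunctionField X z.2 r
  rw [key, key]

instance (D : CDiv X) (U : X.Opens) : Module Γ(X, U) (D.sections U) where
  smul r s := ⟨toFunctionField U r * s.1, fun x => by
    obtain ⟨h1, V, hV, h2⟩ := s.2 x
    refine ⟨?_, V, hV, fun y hy => ?_⟩
    · have := (D.stalk x.1).smul_mem (X.presheaf.germ U x.1 x.2 r) h1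
      rwa [Algebra.smul_def] at this
    · rw [Pi.mul_apply, Pi.mul_apply, h2 y hy, toFunctionField_const U r y x]⟩
  one_smul s := Subtype.ext (by change toFunctionField U 1 * s.1 = s.1; simp)
  mul_smul r t s := Subtype.ext (by
    change toFunctionField U (r * t) * s.1 = toFunctionField U r * (toFunctionField U t * s.1)
    rw [map_mul, mul_assoc])
  smul_zero r := Subtype.ext (mul_zero _)
  smul_add r s t := Subtype.ext (mul_add _ _ _)
  add_smul r t s := Subtype.ext (by
    change toFunctionField U (r + t) * s.1 = toFunctionField U r * s.1 + toFunctionField U t * s.1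
    rw [map_add, add_mul])
  zero_smul s := Subtype.ext (by change toFunctionField U 0 * s.1 = 0; simp)

/-- The underlying presheaf of abelian groups of `𝒪_X(D)`. -/
def CDiv.presheaf (D : CDiv X) : TopCat.Presheaf Ab.{u} X where
  obj U := AddCommGrpCat.of (D.sections U.unop)
  map {U V} i := AddCommGrpCat.ofHom
    { toFun := fun s => ⟨fun x => s.1 (i.unop x), D.localPredicate.res i.unop s.1 s.2⟩
      map_zero' := rfl
      map_add' := fun _ _ => rfl }

lemma CDiv.presheaf_isSheaf (D : CDiv X) : D.presheaf.IsSheaf := by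
  rw [TopCat.Presheaf.isSheaf_iff_isSheaf_comp (forget Ab.{u})]
  exact TopCat.subpresheafToTypes.isSheaf D.localPredicate

instance (D : CDiv X) (U : (Opens X)ᵒᵖ) :
    Module (X.ringCatSheaf.obj.obj U) (D.presheaf.obj U) :=
  inferInstanceAs (Module Γ(X, U.unop) (D.sections U.unop))

/-- The invertible sheaf `𝒪_X(D)`. -/
def CDiv.sheaf (D : CDiv X) : X.Modules where
  val := PresheafOfModules.ofPresheaf D.presheaf (fun U V i r s => by
    apply Subtype.ext
    funext x
    change toFunctionField U.unop r (i.unop x) * s.1 (i.unop x) =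
      toFunctionField V.unop (X.presheaf.map i r) x * s.1 (i.unop x)
    congr 1
    exact congrArg (algebraMap (X.presheaf.stalk x.1) X.functionField)
      (X.presheaf.germ_res_apply i.unop x.1 x.2 r).symm)
  isSheaf := D.presheaf_isSheaf

end Sheaf

section Pullback
variable {X Y : Scheme.{u}} [IsIntegral X] [IsIntegral Y] (f : X ⟶ Y) [IsDominant f]

lemma map_genericPoint : f (genericPoint X) = genericPoint Y := by
  have h := (genericPoint_spec X).image f.continuous
  rw [Set.image_univ, f.denseRange.closure_range] at h
  exact h.eq (genericPoint_spec Y)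

/-- The inclusion of function fields `K(Y) → K(X)` of a dominant morphism `f : X ⟶ Y`. -/
def functionFieldMap : Y.functionField →+* X.functionField :=
  (Y.presheaf.stalkSpecializes (specializes_of_eq (map_genericPoint f)) ≫
    f.stalkMap (genericPoint X)).hom

lemma functionFieldMap_algebraMap (x : X) (r : Y.presheaf.stalk (f x)) :
    functionFieldMap f (algebraMap (Y.presheaf.stalk (f x)) Y.functionField r) =
      algebraMap (X.presheaf.stalk x) X.functionField (f.stalkMap x r) := by
  have h : genericPoint X ⤳ x := genericPoint_specializes x
  have h1 := Scheme.Hom.stalkSpecializes_stalkMap f (genericPoint X) x h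
  have h2 : Y.presheaf.stalkSpecializes (genericPoint_specializes (f x)) ≫
      Y.presheaf.stalkSpecializes (specializes_of_eq (map_genericPoint f)) =
      Y.presheaf.stalkSpecializes (h.map f.continuous) := by
    rw [TopCat.Presheaf.stalkSpecializes_comp]
  have h3 := h1
  rw [← h2, Category.assoc] at h3
  exact congr($h3 r)

/-- The pull-back map on local equations, `K(Y)ˣ/𝒪_{Y,f(x)}ˣ → K(X)ˣ/𝒪_{X,x}ˣ`. -/
def pullbackGerm (x : X) : ((Y.functionField)ˣ ⧸ stalkUnits Y (f x)) →*
    ((X.functionField)ˣ ⧸ stalkUnits X x) :=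
  QuotientGroup.map _ _ (Units.map (functionFieldMap f).toMonoidHom) (by
    rintro _ ⟨u, rfl⟩
    refine ⟨Units.map (f.stalkMap x).hom.toMonoidHom u, Units.ext ?_⟩
    exact (functionFieldMap_algebraMap f x u).symm)

/-- The pull-back `f^* : CDiv(Y) → CDiv(X)` along a dominant morphism of integral schemes. -/
def CDiv.pullback : CDiv Y →+ CDiv X :=
  MonoidHom.toAdditive
    { toFun := fun D => ⟨fun x => pullbackGerm f x (D.1 (f x)), fun x => by
        obtain ⟨U, hU, g, hg⟩ := D.2 (f x)
        exact ⟨f ⁻¹ᵁ U, hU, Units.map (functionFieldMap f).toMonoidHom g, fun y hy => by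
          exact congrArg (pullbackGerm f y) (hg (f y) hy)⟩⟩
      map_one' := Subtype.ext (funext fun x => map_one (pullbackGerm f x))
      map_mul' := fun D E => Subtype.ext (funext fun x =>
        map_mul (pullbackGerm f x) (D.1 (f x)) (E.1 (f x))) }

/-- The pull-back `f^* : CDiv(Y) ⊗ ℚ → CDiv(X) ⊗ ℚ`. -/
def QCDiv.pullback : QCDiv Y →ₗ[ℤ] QCDiv X :=
  (CDiv.pullback f).toIntLinearMap.lTensor ℚ

/-- The dominant morphism `f` is separable: the extension `K(X)/K(Y)` is separable (not
necessarily algebraic), i.e. `K(X) ⊗ L` is reduced for an algebraic closure `L` of `K(Y)`. -/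
def IsSeparableMorphism : Prop :=
  letI : Algebra Y.functionField X.functionField := (functionFieldMap f).toAlgebra
  Algebra.IsGeometricallyReduced Y.functionField X.functionField

end Pullback

section Fiber
variable {X Y : Scheme.{u}} [IsIntegral X] [IsIntegral Y] (f : X ⟶ Y) [IsDominant f]

lemma flat_fromSpecResidueField_genericPoint (Y : Scheme.{u}) [IsIntegral Y] :
    Flat (Y.fromSpecResidueField (genericPoint Y)) := by
  refine Flat.of_stalkMap _ fun z => ?_
  have hz : Y.fromSpecResidueField (genericPoint Y) z = genericPoint Y := by
    have : Y.fromSpecResidueField (genericPoint Y) z ∈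
        Set.range (Y.fromSpecResidueField (genericPoint Y)) := ⟨z, rfl⟩
    rwa [Scheme.range_fromSpecResidueField] at this
  have hF : IsField (Y.presheaf.stalk (Y.fromSpecResidueField (genericPoint Y) z)) := by
    rw [hz]
    exact Field.toIsField Y.functionField
  let _ := hF.toField
  let _ := ((Y.fromSpecResidueField (genericPoint Y)).stalkMap z).hom.toAlgebra
  exact (inferInstance : Module.Flat
    (Y.presheaf.stalk (Y.fromSpecResidueField (genericPoint Y) z))
    ((Spec (Y.residueField (genericPoint Y))).presheaf.stalk z))

lemma bijective_stalkMap_fiberι {X Y : Scheme.{u}} [IsIntegral Y] (f : X ⟶ Y)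
    (z : f.fiber (genericPoint Y)) :
    Function.Bijective ((f.fiberι (genericPoint Y)).stalkMap z) := by
  have := flat_fromSpecResidueField_genericPoint Y
  have : Flat (f.fiberι (genericPoint Y)) :=
    inferInstanceAs (Flat (Limits.pullback.fst f (Y.fromSpecResidueField (genericPoint Y))))
  refine ⟨?_, (f.fiberι (genericPoint Y)).stalkMap_surjective z⟩
  let _ := ((f.fiberι (genericPoint Y)).stalkMap z).hom.toAlgebra
  have : Module.FaithfullyFlat (X.presheaf.stalk (f.fiberι (genericPoint Y) z))
      ((f.fiber (genericPoint Y)).presheaf.stalk z) :=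
    @Module.FaithfullyFlat.of_flat_of_isLocalHom _ _ _ _ _ _ _
      (Flat.stalkMap (f.fiberι (genericPoint Y)) z) ((f.fiberι (genericPoint Y)).toLRSHom.prop z)
  exact FaithfulSMul.algebraMap_injective (X.presheaf.stalk (f.fiberι (genericPoint Y) z))
      ((f.fiber (genericPoint Y)).presheaf.stalk z)

lemma genericPoint_mem_range_fiberι :
    genericPoint X ∈ Set.range (f.fiberι (genericPoint Y)) := by
  rw [Scheme.Hom.range_fiberι]
  exact map_genericPoint f

instance isDominant_fiberι : IsDominant (f.fiberι (genericPoint Y)) := by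
  refine ⟨dense_iff_closure_eq.mpr (Set.univ_subset_iff.mp ?_)⟩
  rw [← (genericPoint_spec X)]
  exact closure_mono (Set.singleton_subset_iff.mpr (genericPoint_mem_range_fiberι f))

/-- The generic fibre of a dominant morphism of integral schemes is integral. -/
instance isIntegral_fiber : IsIntegral (f.fiber (genericPoint Y)) := by
  obtain ⟨ξ, hξ⟩ := genericPoint_mem_range_fiberι f
  have hgen : IsGenericPoint ξ (Set.univ : Set (f.fiber (genericPoint Y))) := by
    rw [isGenericPoint_iff_specializes]
    intro y
    refine ⟨fun _ => trivial, fun _ => ?_⟩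
    rw [← (f.fiberι (genericPoint Y)).isEmbedding.isInducing.specializes_iff, hξ]
    exact genericPoint_specializes _
  have : IrreducibleSpace (f.fiber (genericPoint Y)) :=
    (irreducibleSpace_def _).mpr hgen.isIrreducible
  have : ∀ z : f.fiber (genericPoint Y),
      _root_.IsReduced ((f.fiber (genericPoint Y)).presheaf.stalk z) := fun z =>
    isReduced_of_injective
      (RingEquiv.ofBijective ((f.fiberι (genericPoint Y)).stalkMap z).hom
        (bijective_stalkMap_fiberι f z)).symm.toRingHom (RingEquiv.injective _)
  have := isReduced_of_isReduced_stalk (f.fiber (genericPoint Y))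
  exact isIntegral_of_irreducibleSpace_of_isReduced _

end Fiber

section Kodaira
attribute [local instance] MvPolynomial.gradedAlgebra

variable {X : Scheme.{u}} [IsIntegral X] {F : Type u} [Field F] (π : X ⟶ Spec (.of F))

/-- The inclusion of the base field into the function field of an `F`-scheme. -/
def baseFieldMap : F →+* X.functionField :=
  ((Scheme.ΓSpecIso (.of F)).inv ≫ π.appTop ≫
    X.presheaf.germ ⊤ (genericPoint X) trivial).hom

lemma baseFieldMap_eq (x : X) (c : F) : baseFieldMap π c =
    algebraMap (X.presheaf.stalk x) X.functionField
      (X.presheaf.germ ⊤ x trivial (π.appTop ((Scheme.ΓSpecIso (.of F)).inv c))) :=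
  have : Nonempty (⊤ : X.Opens) := ⟨⟨x, trivial⟩⟩
  (Scheme.algebraMap_germ_eq_germToFunctionField X (U := ⊤) (x := x) trivial _).symm

/-- The `F`-algebra structure of the function field. -/
abbrev functionFieldAlgebra : Algebra F X.functionField := (baseFieldMap π).toAlgebra

/-- `H⁰(X, 𝒪_X(D))`, as an `F`-subspace of `K(X)`. -/
def H0 (D : CDiv X) : letI := functionFieldAlgebra π; Submodule F X.functionField :=
  letI := functionFieldAlgebra π
  { carrier := {φ | ∀ x : X, φ ∈ D.stalk x}
    zero_mem' := fun _ => zero_mem _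
    add_mem' := fun h h' x => add_mem (h x) (h' x)
    smul_mem' := fun c φ h x => by
      rw [Algebra.smul_def]
      change baseFieldMap π c * φ ∈ _
      rw [baseFieldMap_eq π x, ← Algebra.smul_def]
      exact (D.stalk x).smul_mem _ (h x) }

/-- The index set of a basis of `H⁰(X, 𝒪_X(D))`. -/
abbrev H0Index (D : CDiv X) : Type u :=
  letI := functionFieldAlgebra π
  Module.Basis.ofVectorSpaceIndex F (H0 π D)

/-- A basis `(s_i)` of `H⁰(X, 𝒪_X(D))`, as a family of rational functions. -/
def H0Basis (D : CDiv X) (i : H0Index π D) : X.functionField :=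
  letI := functionFieldAlgebra π
  (Module.Basis.ofVectorSpace F (H0 π D) i : H0 π D)

/-- `T_i ↦ s_i`. -/
def linearSystemRingHom (D : CDiv X) :
    MvPolynomial (H0Index π D) F →+* Γ(Spec X.functionField, ⊤) :=
  (Scheme.ΓSpecIso X.functionField).inv.hom.comp
    (MvPolynomial.eval₂Hom (baseFieldMap π) (H0Basis π D))

lemma map_irrelevant_linearSystemRingHom (D : CDiv X) (h : H0 π D ≠ ⊥) :
    (HomogeneousIdeal.irrelevant
      (MvPolynomial.homogeneousSubmodule (H0Index π D) F)).toIdeal.map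
      (linearSystemRingHom π D) = ⊤ := by
  let _ := functionFieldAlgebra π
  have : Nontrivial (H0 π D) := (Submodule.nontrivial_iff_ne_bot).mpr h
  obtain ⟨i⟩ := (Module.Basis.ofVectorSpace F (H0 π D)).index_nonempty
  have hi : H0Basis π D i ≠ 0 := fun h0 =>
    (Module.Basis.ofVectorSpace F (H0 π D)).ne_zero i (Subtype.ext h0)
  have hX : (MvPolynomial.X i : MvPolynomial (H0Index π D) F) ∈
      (HomogeneousIdeal.irrelevant
        (MvPolynomial.homogeneousSubmodule (H0Index π D) F)).toIdeal := by
    change _ ∈ HomogeneousIdeal.irrelevant _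
    rw [HomogeneousIdeal.mem_irrelevant_iff]
    exact DirectSum.decompose_of_mem_ne (MvPolynomial.homogeneousSubmodule (H0Index π D) F)
      (show MvPolynomial.X i ∈ MvPolynomial.homogeneousSubmodule (H0Index π D) F 1 from
        MvPolynomial.isHomogeneous_X F i) one_ne_zero
  refine Ideal.eq_top_of_isUnit_mem _ (Ideal.mem_map_of_mem _ hX) ?_
  have : linearSystemRingHom π D (MvPolynomial.X i) =
      (Scheme.ΓSpecIso X.functionField).inv (H0Basis π D i) := by
    simp [linearSystemRingHom]
  rw [this]
  exact (IsUnit.mk0 _ hi).map (Scheme.ΓSpecIso X.functionField).inv.hom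

/-- The rational map `Φ_{|D|} = (s_0 : s_1 : …) : X ⇢ ℙ(H⁰(X, 𝒪_X(D)))` of the complete linear
system `|D|`, at the generic point `Spec K(X)` of `X`. -/
def linearSystemMap (D : CDiv X) (h : H0 π D ≠ ⊥) :
    Spec X.functionField ⟶ Proj (MvPolynomial.homogeneousSubmodule (H0Index π D) F) :=
  Proj.fromOfGlobalSections _ (linearSystemRingHom π D) (map_irrelevant_linearSystemRingHom π D h)

/-- `dim Φ_{|D|}(X)`: the dimension of the closure of the image of `Φ_{|D|}`, which is the closure
of the image of the generic point of `X`. -/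
def dimLinearSystemImage (D : CDiv X) (h : H0 π D ≠ ⊥) : WithBot ℕ∞ :=
  topologicalKrullDim (closure (Set.range (linearSystemMap π D h)))

/-- The `D`-dimension `κ(X, D)` of a `ℚ`-Cartier divisor: the maximum of `dim Φ_{|mD|}(X)` over the
integers `m > 0` with `mD = E` Cartier and `|E| ≠ ∅`; it is `⊥` (that is, `-∞`) if there are none. -/
def kappa (D : QCDiv X) : WithBot ℕ∞ :=
  ⨆ (m : ℕ) (E : CDiv X) (_ : 0 < m ∧ m • D = (1 : ℚ) ⊗ₜ[ℤ] E) (h : H0 π E ≠ ⊥),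
    dimLinearSystemImage π E h

/-- `D` is big: `κ(X, D) = dim X`. -/
def IsBig (D : QCDiv X) : Prop := kappa π D = topologicalKrullDim X

/-- `D` is ample: every point has an affine neighbourhood of the form `X_s`, for a global section
`s` of `𝒪_X(nD)` with `n > 0`. -/
def CDiv.IsAmple (D : CDiv X) : Prop :=
  CompactSpace X ∧ ∀ x : X, ∃ n : ℕ, 0 < n ∧ ∃ s : X.functionField, (∀ y, s ∈ (n • D).stalk y) ∧
    ∃ U : X.Opens, x ∈ U ∧ IsAffineOpen U ∧ ∀ y, y ∈ U ↔ (n • D).Generates s y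

/-- A `ℚ`-Cartier divisor is ample if a positive multiple is an ample Cartier divisor. -/
def QCDiv.IsAmple (D : QCDiv X) : Prop :=
  ∃ m : ℕ, 0 < m ∧ ∃ E : CDiv X, m • D = (1 : ℚ) ⊗ₜ[ℤ] E ∧ E.IsAmple

end Kodaira

section Frobenius

lemma add_pow_of_natCast_eq_zero {R : Type*} [CommRing R] {p : ℕ} (hp : p.Prime)
    (h : (p : R) = 0) (e : ℕ) (a b : R) : (a + b) ^ p ^ e = a ^ p ^ e + b ^ p ^ e := by
  rcases subsingleton_or_nontrivial R with _ | _
  · exact Subsingleton.elim _ _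
  · have : Fact p.Prime := ⟨hp⟩
    have : CharP R p := by
      have h1 : ringChar R ∣ p := ringChar.dvd h
      rcases (Nat.dvd_prime hp).mp h1 with h2 | h2
      · exact absurd h2 (CharP.ringChar_ne_one)
      · exact ringChar.of_eq h2
    exact add_pow_char_pow a b p e

/-- `a ↦ a ^ (p ^ e)` on a ring in which the prime `p` vanishes. -/
def powRingHom {R : Type*} [CommRing R] {p : ℕ} (hp : p.Prime)
    (h : (p : R) = 0) (e : ℕ) : R →+* R where
  toFun a := a ^ p ^ e
  map_one' := one_pow _
  map_mul' a b := mul_pow a b _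
  map_zero' := zero_pow (pow_ne_zero _ hp.ne_zero)
  map_add' a b := add_pow_of_natCast_eq_zero hp h e a b

lemma natCast_section_eq_zero {Y : Scheme.{u}} {p : ℕ} (h : (p : Γ(Y, ⊤)) = 0) (U : Y.Opens) :
    (p : Γ(Y, U)) = 0 := by
  have := congrArg (Y.presheaf.map (homOfLE le_top : U ⟶ ⊤).op) h
  rwa [map_natCast, map_zero] at this

/-- The morphism of structure sheaves of the Frobenius. -/
def absFrobeniusComorphism {Y : Scheme.{u}} {p : ℕ} (hp : p.Prime) (h : (p : Γ(Y, ⊤)) = 0) (e : ℕ) :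
    Y.presheaf ⟶ (TopCat.Presheaf.pushforward CommRingCat (𝟙 _)).obj Y.presheaf where
  app U := CommRingCat.ofHom (powRingHom hp (natCast_section_eq_zero h U.unop) e)
  naturality U V i := by
    ext a
    exact (map_pow (Y.presheaf.map i).hom a (p ^ e)).symm

/-- The `e`-th iterate `F_Y^e : Y ⟶ Y` of the absolute Frobenius of a scheme of characteristic `p`:
the identity on points and `a ↦ a ^ (p ^ e)` on functions. -/
def absFrobenius {Y : Scheme.{u}} {p : ℕ} (hp : p.Prime) (h : (p : Γ(Y, ⊤)) = 0) (e : ℕ) : Y ⟶ Y where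
  base := 𝟙 _
  c := absFrobeniusComorphism hp h e
  prop x := by
    constructor
    intro a ha
    obtain ⟨U, hx, s, rfl⟩ := Y.presheaf.exists_germ_eq a
    have h1 := PresheafedSpace.stalkMap_germ
      (X := Y.toPresheafedSpace) (Y := Y.toPresheafedSpace)
      ⟨𝟙 _, absFrobeniusComorphism hp h e⟩ U x hx
    have h2 : Y.presheaf.germ U x hx (s ^ p ^ e) = _ := congr($h1.symm s)
    rw [map_pow] at h2
    refine (isUnit_pow_iff (pow_ne_zero e hp.ne_zero)).mp ?_
    exact h2.symm ▸ ha

/-- A scheme over a field of characteristic `p` has characteristic `p`. -/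
lemma natCast_eq_zero_of_charP {Y : Scheme.{u}} {k : Type u} [Field k] (p : ℕ) [CharP k p]
    (π : Y ⟶ Spec (.of k)) : (p : Γ(Y, ⊤)) = 0 := by
  have := congrArg ((Scheme.ΓSpecIso (.of k)).inv ≫ π.appTop).hom (CharP.cast_eq_zero k p)
  rwa [map_natCast, map_zero] at this

end Frobenius

section Positivity
variable {Y : Scheme.{u}}

/-- The tensor product of two sheaves of `𝒪_Y`-modules. -/
def tensor (M N : Y.Modules) : Y.Modules :=
  (PresheafOfModules.sheafification (𝟙 Y.ringCatSheaf.obj)).obj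
    (MonoidalCategory.tensorObj (C := PresheafOfModules.{u} (Y.presheaf ⋙ forget₂ _ RingCat))
      M.val N.val)

/-- `M` is generically globally generated: for all closed points `y` of a non-empty open subset the
natural map `H⁰(Y, M) → M ⊗ k(y)` is surjective, where `M ⊗ k(y)` is the pull-back of `M` to
`Spec k(y)`. -/
def IsGenericallyGloballyGenerated (M : Y.Modules) : Prop :=
  ∃ U : Y.Opens, (U : Set Y).Nonempty ∧ ∀ y ∈ U, IsClosed {y} →
    Function.Surjective
      (((Scheme.Modules.pullbackPushforwardAdjunction
        (Y.fromSpecResidueField y)).unit.app M).app ⊤)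

/-- Torsion free sheaves on an integral scheme. -/
def IsTorsionFree (M : Y.Modules) : Prop :=
  ∀ (U : Y.Opens) (r : Γ(Y, U)) (s : Γ(M, U)), r • s = 0 → r = 0 ∨ s = 0

/-- Coherent sheaves on a locally noetherian scheme: locally the cokernel of a morphism between
finite free sheaves. -/
def IsCoherent (M : Y.Modules) : Prop :=
  SheafOfModules.IsFinitePresentation (R := Y.ringCatSheaf) M

variable [IsIntegral Y]

/-- Frobenius weakly positive (FWP) sheaves: `M` is coherent and torsion free and, for an ample
`ℚ`-Cartier divisor `H`, there are positive integers `n_e` (`e = 1, 2, …`) such that `n_e H` is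
Cartier, `F_Y^{e*} M ⊗ 𝒪_Y(n_e H)` is generically globally generated and `n_e / p^e → 0`. -/
def IsFWP {p : ℕ} (hp : p.Prime) (h : (p : Γ(Y, ⊤)) = 0) (M : Y.Modules) : Prop :=
  IsCoherent M ∧ IsTorsionFree M ∧
  ∃ H : QCDiv Y, H.IsAmple ∧ ∃ n : ℕ → ℕ,
    (∀ e, 0 < e → 0 < n e ∧ ∃ E : CDiv Y, n e • H = (1 : ℚ) ⊗ₜ[ℤ] E ∧
      IsGenericallyGloballyGenerated
        (tensor ((Scheme.Modules.pullback (absFrobenius hp h e)).obj M) E.sheaf)) ∧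
    Filter.Tendsto (fun e => (n e : ℝ) / (p : ℝ) ^ e) Filter.atTop (nhds 0)

end Positivity

section Varieties
attribute [local instance] MvPolynomial.gradedAlgebra
variable {k : Type u} [Field k]

variable (k) in
/-- The projective space `ℙⁿ` over `k`. -/
def projectiveSpace (n : ℕ) : Scheme.{u} :=
  Proj (MvPolynomial.homogeneousSubmodule (Fin (n + 1)) k)

variable (k) in
/-- The structure morphism `ℙⁿ ⟶ Spec k`. -/
def projectiveSpaceStructure (n : ℕ) : projectiveSpace k n ⟶ Spec (.of k) :=
  Proj.toSpecZero (MvPolynomial.homogeneousSubmodule (Fin (n + 1)) k) ≫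
    Spec.map (CommRingCat.ofHom
      (algebraMap k (MvPolynomial.homogeneousSubmodule (Fin (n + 1)) k 0)))

/-- `X` is projective over `k`: it is a closed subscheme of some `ℙⁿ`. -/
def IsProjectiveOver {X : Scheme.{u}} (π : X ⟶ Spec (.of k)) : Prop :=
  ∃ (n : ℕ) (i : X ⟶ projectiveSpace k n), IsClosedImmersion i ∧
    i ≫ projectiveSpaceStructure k n = π

/-- `X` is normal: its local rings are integrally closed domains. -/
def IsNormalScheme (X : Scheme.{u}) : Prop :=
  ∀ x : X, IsDomain (X.presheaf.stalk x) ∧ IsIntegrallyClosed (X.presheaf.stalk x)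

/-- The condition `f_* 𝒪_X = 𝒪_Y` on a fibration: the natural map `𝒪_Y → f_* 𝒪_X` is an isomorphism.
(A morphism between projective `k`-schemes is automatically projective.) -/
class IsFibration {X Y : Scheme.{u}} (f : X ⟶ Y) : Prop where
  bijective_app (U : Y.Opens) : Function.Bijective (f.app U)

instance {X Y : Scheme.{u}} [IsIntegral Y] (f : X ⟶ Y) [hf : IsFibration f] :
    IsDominant f := by
  constructor
  rw [DenseRange, dense_iff_inter_open]
  intro U hU hne
  by_contra hc
  have hpre : f ⁻¹ᵁ ⟨U, hU⟩ = ⊥ := by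
    ext x
    refine ⟨fun hx => hc ⟨f x, hx, x, rfl⟩, fun hx => hx.elim⟩
  have : Nonempty (⟨U, hU⟩ : Y.Opens) := ⟨⟨hne.some, hne.some_mem⟩⟩
  have hs : Subsingleton Γ(X, f ⁻¹ᵁ ⟨U, hU⟩) := by
    rw [hpre]; infer_instance
  have := (hf.bijective_app ⟨U, hU⟩).1.subsingleton
  exact not_subsingleton Γ(Y, ⟨U, hU⟩) this

end Varieties
end

end FWPKod

open FWPKod

/-! Let `M` be the given FWP subsheaf of `F^{e*} f_* 𝒪_X(D)` and `A` the ample divisor of its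
positivity. The proof decomposes `D + f^*H` into `ℚ`-divisors whose sections together contain enough
algebraically independent ratios.

Positivity produces sections. Sections of `f_* 𝒪_X(D)` are rational functions on `X`; taking
`p^e`-th powers and extending linearly maps `F^{e*} f_* 𝒪_X(D)` to rational functions that are
sections of `p^e D` along the fibres. Separability of `K(X)/K(Y)` makes the kernel of this map
torsion (`exists_coeff_of_sum_mul_pow_eq_zero`), so the torsion free `M` is embedded
(`comp_frobLift_app_injective`). A further `p^{e'}`-th power and multiplication by sections of `E =
n_{e'} A` map `F^{e'*} M ⊗ 𝒪_Y(E)` to sections of `p^{e+e'} D + f^*E`. This map is non-zero in the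
fibre at a general closed point, so generic global generation supplies a non-zero global section
(`exists_mem_stalk_of_isGenericallyGloballyGenerated`). Hence `D + δ f^*A` has a multiple with a
non-zero section for arbitrarily small `δ > 0` (`IsFWP.exists_hasRatios`).

Sections on the generic fibre become, after clearing denominators on `Y`, sections of multiples of
`D + c f^*A` for some possibly large `c` (`HasRatios.of_fiber`). Kodaira's lemma makes a multiple of
`H - ε A` effective for some `ε > 0` (`exists_hasRatios_sub_smul`). Now `D + f^*H = α (D + c f^*A) +
(1 - α) (D + δ f^*A) + ½ f^*H + ½ f^*(H - ε A) + θ f^*A`, where `α` is chosen small and then `θ > 0`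
(`HasRatios.combine`). The first summand carries functions algebraically independent over `K(Y)`, as
many as the Iitaka dimension of the generic fibre; the summand `½ f^*H` carries a transcendence
basis of `K(Y)` over `k`. Their union is independent over `k`.

The translation between `kappa` and algebra is that `κ ≥ n` means having `n` algebraically
independent ratios, with a common denominator, of sections of one multiple (`HasRatios`). Its two
directions, `exists_algebraicIndependent_of_le_kappa` and `HasRatios.le_kappa`, compare chains of
points in `Proj` with chains of primes. -/

namespace FWPKod
noncomputable section

/-! ### Sheaves of modules made of pointwise families, the targets of the morphisms built below. -/

section LinearPredicate
variable {Y : Scheme.{u}} (B : Y → Type u) [∀ y, AddCommGroup (B y)]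
  [∀ y, Module (Y.presheaf.stalk y) (B y)]

/-- A local predicate on families of elements of modules over the local rings of `Y` which is
compatible with the module operations. -/
structure LinearPredicate extends TopCat.LocalPredicate (X := (Y : TopCat.{u})) B where
  zero {U : Opens Y} : pred (fun _ : U => 0)
  add {U : Opens Y} (s t : ∀ x : U, B x) : pred s → pred t → pred (fun x => s x + t x)
  neg {U : Opens Y} (s : ∀ x : U, B x) : pred s → pred (fun x => -s x)
  smul {U : Opens Y} (r : Γ(Y, U)) (s : ∀ x : U, B x) :
    pred s → pred (fun x => Y.presheaf.germ U x.1 x.2 r • s x)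

variable {B}
namespace LinearPredicate
variable (P : LinearPredicate B)

/-- The sections over `U` satisfying the predicate. -/
def sections (U : Y.Opens) : AddSubgroup (∀ x : U, B x) where
  carrier := {s | P.pred s}
  zero_mem' := P.zero
  add_mem' {s t} hs ht := P.add s t hs ht
  neg_mem' {s} hs := P.neg s hs

instance (U : Y.Opens) : Module Γ(Y, U) (P.sections U) where
  smul r s := ⟨fun x => Y.presheaf.germ U x.1 x.2 r • s.1 x, P.smul r s.1 s.2⟩
  one_smul s := Subtype.ext (funext fun x => by
    change Y.presheaf.germ U x.1 x.2 1 • s.1 x = s.1 x; rw [map_one, one_smul])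
  mul_smul r t s := Subtype.ext (funext fun x => by
    change Y.presheaf.germ U x.1 x.2 (r * t) • s.1 x =
      Y.presheaf.germ U x.1 x.2 r • Y.presheaf.germ U x.1 x.2 t • s.1 x
    rw [map_mul, mul_smul])
  smul_zero r := Subtype.ext (funext fun x => smul_zero _)
  smul_add r s t := Subtype.ext (funext fun x => smul_add _ _ _)
  add_smul r t s := Subtype.ext (funext fun x => by
    change Y.presheaf.germ U x.1 x.2 (r + t) • s.1 x =
      Y.presheaf.germ U x.1 x.2 r • s.1 x + Y.presheaf.germ U x.1 x.2 t • s.1 x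
    rw [map_add, add_smul])
  zero_smul s := Subtype.ext (funext fun x => by
    change Y.presheaf.germ U x.1 x.2 0 • s.1 x = 0; rw [map_zero, zero_smul])

/-- The presheaf of abelian groups of the sections satisfying the predicate. -/
def presheaf : TopCat.Presheaf Ab.{u} Y where
  obj U := AddCommGrpCat.of (P.sections U.unop)
  map {U V} i := AddCommGrpCat.ofHom
    { toFun := fun s => ⟨fun x => s.1 (i.unop x), P.res i.unop s.1 s.2⟩
      map_zero' := rfl
      map_add' := fun _ _ => rfl }

lemma presheaf_isSheaf : P.presheaf.IsSheaf := by
  rw [TopCat.Presheaf.isSheaf_iff_isSheaf_comp (forget Ab.{u})]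
  exact TopCat.subpresheafToTypes.isSheaf P.toLocalPredicate

instance (U : (Opens Y)ᵒᵖ) : Module (Y.ringCatSheaf.obj.obj U) (P.presheaf.obj U) :=
  inferInstanceAs (Module Γ(Y, U.unop) (P.sections U.unop))

/-- The sheaf of modules of the sections satisfying the predicate. -/
def sheaf : Y.Modules where
  val := PresheafOfModules.ofPresheaf P.presheaf (fun U V i r s => by
    apply Subtype.ext
    funext x
    change Y.presheaf.germ U.unop (i.unop x) _ r • s.1 (i.unop x) =
      Y.presheaf.germ V.unop x _ (Y.presheaf.map i r) • s.1 (i.unop x)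
    congr 1
    exact (Y.presheaf.germ_res_apply i.unop x.1 x.2 r).symm)
  isSheaf := P.presheaf_isSheaf

/-- The value at a point of a section. -/
def value {U : Y.Opens} (s : Γ(P.sheaf, U)) (x : U) : B x := Subtype.val (p := fun s => s ∈ P.sections U) s x

lemma value_ext {U : Y.Opens} {s t : Γ(P.sheaf, U)} (h : ∀ x, P.value s x = P.value t x) : s = t :=
  Subtype.ext (funext h)

lemma value_smul {U : Y.Opens} (r : Γ(Y, U)) (s : Γ(P.sheaf, U)) (x : U) :
    P.value (r • s) x = Y.presheaf.germ U x.1 x.2 r • P.value s x := rfl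

lemma value_pred {U : Y.Opens} (s : Γ(P.sheaf, U)) : P.pred (P.value s) := s.2

/-- A morphism into the push-forward of a sheaf of sections satisfying a predicate. -/
def homPushforward {Z : Scheme.{u}} (g : Y ⟶ Z) (M : Z.Modules)
    (φ : ∀ (U : Z.Opens) (x : (g ⁻¹ᵁ U : Y.Opens)), Γ(M, U) →+ B x)
    (hmap : ∀ (U V : Z.Opens) (i : U ⟶ V) (m : Γ(M, V)) (x : (g ⁻¹ᵁ U : Y.Opens)),
      φ U x (M.presheaf.map i.op m) = φ V ⟨x.1, i.le x.2⟩ m)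
    (hsmul : ∀ (U : Z.Opens) (r : Γ(Z, U)) (m : Γ(M, U)) (x : (g ⁻¹ᵁ U : Y.Opens)),
      φ U x (r • m) = Y.presheaf.germ (g ⁻¹ᵁ U) x.1 x.2 (g.app U r) • φ U x m)
    (hpred : ∀ (U : Z.Opens) (m : Γ(M, U)), P.pred (fun x => φ U x m)) :
    M ⟶ (Scheme.Modules.pushforward g).obj P.sheaf where
  val := PresheafOfModules.homMk
    { app := fun U => AddCommGrpCat.ofHom
        { toFun := fun m => (⟨fun x => φ U.unop x m, hpred U.unop m⟩ : P.sections (g ⁻¹ᵁ U.unop))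
          map_zero' := Subtype.ext (funext fun x => map_zero (φ U.unop x))
          map_add' := fun m n => Subtype.ext (funext fun x => map_add (φ U.unop x) m n) }
      naturality := fun U V i => by
        ext m
        exact Subtype.ext (funext fun x => hmap V.unop U.unop i.unop m x) }
    (fun U r m => Subtype.ext (funext fun x => hsmul U.unop r m x))

/-- A morphism into a sheaf of sections satisfying a predicate. -/
def hom (M : Y.Modules)
    (φ : ∀ (U : Y.Opens) (x : U), Γ(M, U) →+ B x)
    (hmap : ∀ (U V : Y.Opens) (i : U ⟶ V) (m : Γ(M, V)) (x : U),
      φ U x (M.presheaf.map i.op m) = φ V (i x) m)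
    (hsmul : ∀ (U : Y.Opens) (r : Γ(Y, U)) (m : Γ(M, U)) (x : U),
      φ U x (r • m) = Y.presheaf.germ U x.1 x.2 r • φ U x m)
    (hpred : ∀ (U : Y.Opens) (m : Γ(M, U)), P.pred (fun x => φ U x m)) :
    M ⟶ P.sheaf where
  val := PresheafOfModules.homMk
    { app := fun U => AddCommGrpCat.ofHom
        { toFun := fun m => (⟨fun x => φ U.unop x m, hpred U.unop m⟩ : P.sections U.unop)
          map_zero' := Subtype.ext (funext fun x => map_zero (φ U.unop x))
          map_add' := fun m n => Subtype.ext (funext fun x => map_add (φ U.unop x) m n) }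
      naturality := fun U V i => by
        ext m
        exact Subtype.ext (funext fun x => hmap V.unop U.unop i.unop m x) }
    (fun U r m => Subtype.ext (funext fun x => hsmul U.unop r m x))

end LinearPredicate
end LinearPredicate

/-! ### Morphisms out of tensor products and pull-backs. -/

section Tensor
variable {Y : Scheme.{u}} (M N K : Y.Modules)

/-- The presheaf tensor product of two sheaves of modules. -/
abbrev preTensor : PresheafOfModules.{u} (Y.presheaf ⋙ forget₂ CommRingCat RingCat) :=
  MonoidalCategory.tensorObj (C := PresheafOfModules.{u} (Y.presheaf ⋙ forget₂ _ RingCat))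
    M.val N.val

/-- The presheaf of modules underlying a sheaf of modules. -/
abbrev preMod : PresheafOfModules.{u} (Y.presheaf ⋙ forget₂ CommRingCat RingCat) := M.val

/-- The pure tensor `m ⊗ n` as a section of the presheaf tensor product. -/
def preTensorSection {U : Y.Opens} (m : Γ(M, U)) (n : Γ(N, U)) : (preTensor M N).obj (op U) :=
  TensorProduct.tmul (Y.presheaf.obj (op U)) (M := (preMod M).obj (op U))
    (N := (preMod N).obj (op U)) m n

/-- The section `m ⊗ n` of `M ⊗ N`. -/
def tensorSection {U : Y.Opens} (m : Γ(M, U)) (n : Γ(N, U)) : Γ(tensor M N, U) :=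
  ((PresheafOfModules.sheafificationAdjunction (𝟙 Y.ringCatSheaf.obj)).unit.app
    (preTensor M N)).app (op U) (preTensorSection M N m n)

variable {M N K}

/-- The morphism of presheaves defined by a bilinear pairing. -/
def preTensorLift (β : ∀ U : Y.Opens, Γ(M, U) → Γ(N, U) → Γ(K, U))
    (hadd₁ : ∀ U m m' n, β U (m + m') n = β U m n + β U m' n)
    (hadd₂ : ∀ U m n n', β U m (n + n') = β U m n + β U m n')
    (hsmul₁ : ∀ U (r : Γ(Y, U)) m n, β U (r • m) n = r • β U m n)
    (hsmul₂ : ∀ U (r : Γ(Y, U)) m n, β U m (r • n) = r • β U m n)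
    (hmap : ∀ (U V : Y.Opens) (i : U ⟶ V) m n,
      β U (M.presheaf.map i.op m) (N.presheaf.map i.op n) = K.presheaf.map i.op (β V m n)) :
    preTensor M N ⟶ preMod K where
  app U := ModuleCat.MonoidalCategory.tensorLift (R := Y.presheaf.obj U)
    (M₁ := (preMod M).obj U) (M₂ := (preMod N).obj U) (M₃ := (preMod K).obj U)
    (fun m n => β U.unop m n)
    (fun m m' n => hadd₁ U.unop m m' n) (fun r m n => hsmul₁ U.unop r m n)
    (fun m n n' => hadd₂ U.unop m n n') (fun r m n => hsmul₂ U.unop r m n)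
  naturality {U V} i := ModuleCat.MonoidalCategory.tensor_ext (R := Y.presheaf.obj U)
    (M₁ := (preMod M).obj U) (M₂ := (preMod N).obj U) fun m n => hmap V.unop U.unop i.unop m n

/-- The morphism from a tensor product defined by a bilinear pairing. -/
def tensorLift (β : ∀ U : Y.Opens, Γ(M, U) → Γ(N, U) → Γ(K, U))
    (hadd₁ : ∀ U m m' n, β U (m + m') n = β U m n + β U m' n)
    (hadd₂ : ∀ U m n n', β U m (n + n') = β U m n + β U m n')
    (hsmul₁ : ∀ U (r : Γ(Y, U)) m n, β U (r • m) n = r • β U m n)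
    (hsmul₂ : ∀ U (r : Γ(Y, U)) m n, β U m (r • n) = r • β U m n)
    (hmap : ∀ (U V : Y.Opens) (i : U ⟶ V) m n,
      β U (M.presheaf.map i.op m) (N.presheaf.map i.op n) = K.presheaf.map i.op (β V m n)) :
    tensor M N ⟶ K :=
  ((PresheafOfModules.sheafificationAdjunction (𝟙 Y.ringCatSheaf.obj)).homEquiv
    (preTensor M N) K).symm (preTensorLift β hadd₁ hadd₂ hsmul₁ hsmul₂ hmap)

lemma tensorLift_app_tensorSection (β : ∀ U : Y.Opens, Γ(M, U) → Γ(N, U) → Γ(K, U))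
    (h₁ h₂ h₃ h₄ h₅) {U : Y.Opens} (m : Γ(M, U)) (n : Γ(N, U)) :
    (tensorLift β h₁ h₂ h₃ h₄ h₅).app U (tensorSection M N m n) = β U m n := by
  have h := (Adjunction.homEquiv_unit
    (PresheafOfModules.sheafificationAdjunction (𝟙 Y.ringCatSheaf.obj)) (X := preTensor M N)
    (Y := K) (f := tensorLift β h₁ h₂ h₃ h₄ h₅)).symm.trans
    (Equiv.apply_symm_apply _ (preTensorLift β h₁ h₂ h₃ h₄ h₅))
  have h' := congr(PresheafOfModules.Hom.app $h (op U) (preTensorSection M N m n))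
  exact h'

end Tensor

section PullbackSection
variable {Y Z : Scheme.{u}} (g : Y ⟶ Z) (N : Z.Modules)

/-- The pull-back of a section. -/
def pullbackSection (U : Z.Opens) : Γ(N, U) →+ Γ((Scheme.Modules.pullback g).obj N, g ⁻¹ᵁ U) :=
  (((Scheme.Modules.pullbackPushforwardAdjunction g).unit.app N).app U).hom

lemma pullbackSection_smul (U : Z.Opens) (r : Γ(Z, U)) (n : Γ(N, U)) :
    pullbackSection g N U (r • n) = g.app U r • pullbackSection g N U n :=
  (((Scheme.Modules.pullbackPushforwardAdjunction g).unit.app N)).app_smul r n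

lemma pullbackSection_map {U V : Z.Opens} (i : U ⟶ V) (n : Γ(N, V)) :
    pullbackSection g N U (N.presheaf.map i.op n) =
      ((Scheme.Modules.pullback g).obj N).presheaf.map ((Opens.map g.base).map i).op
        (pullbackSection g N V n) :=
  congr($(((Scheme.Modules.pullbackPushforwardAdjunction g).unit.app N).mapPresheaf.naturality
    i.op) n)

variable {g N}
variable {K : Y.Modules}

/-- The morphism from a pull-back corresponding to a morphism to a push-forward. -/
def pullbackLift (φ : N ⟶ (Scheme.Modules.pushforward g).obj K) :
    (Scheme.Modules.pullback g).obj N ⟶ K :=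
  ((Scheme.Modules.pullbackPushforwardAdjunction g).homEquiv N K).symm φ

lemma pullbackLift_app_pullbackSection (φ : N ⟶ (Scheme.Modules.pushforward g).obj K)
    (U : Z.Opens) (n : Γ(N, U)) :
    (pullbackLift φ).app (g ⁻¹ᵁ U) (pullbackSection g N U n) = φ.app U n := by
  have h := (Adjunction.homEquiv_unit (Scheme.Modules.pullbackPushforwardAdjunction g)
    (X := N) (Y := K) (f := pullbackLift φ)).symm.trans (Equiv.apply_symm_apply _ φ)
  exact congr(Scheme.Modules.Hom.app $h U n)

lemma pullback_hom_ext {φ ψ : (Scheme.Modules.pullback g).obj N ⟶ K}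
    (h : ∀ U n, φ.app (g ⁻¹ᵁ U) (pullbackSection g N U n) =
      ψ.app (g ⁻¹ᵁ U) (pullbackSection g N U n)) : φ = ψ := by
  apply ((Scheme.Modules.pullbackPushforwardAdjunction g).homEquiv N K).injective
  rw [Adjunction.homEquiv_unit, Adjunction.homEquiv_unit]
  refine Scheme.Modules.hom_ext _ _ fun U => ?_
  ext n
  exact h U n

end PullbackSection

/-! ### Stalks of sheaves of modules and local generation. -/

section Stalk
variable {Y : Scheme.{u}} (M : Y.Modules)

/-- The stalk of a sheaf of modules. -/
def modStalk (y : Y) : Type u := ↑(TopCat.Presheaf.stalk (preMod M).presheaf y)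

instance (y : Y) : AddCommGroup (modStalk M y) :=
  inferInstanceAs (AddCommGroup ↑(TopCat.Presheaf.stalk (preMod M).presheaf y))

instance (y : Y) : Module (Y.presheaf.stalk y) (modStalk M y) :=
  inferInstanceAs (Module (Y.presheaf.stalk y) ↑(TopCat.Presheaf.stalk (preMod M).presheaf y))

/-- The germ of a section. -/
def modGerm {U : Y.Opens} (y : U) : Γ(M, U) →+ modStalk M y :=
  (TopCat.Presheaf.germ (preMod M).presheaf U y.1 y.2).hom

lemma modGerm_smul {U : Y.Opens} (y : U) (r : Γ(Y, U)) (m : Γ(M, U)) :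
    modGerm M y (r • m) = Y.presheaf.germ U y.1 y.2 r • modGerm M y m :=
  PresheafOfModules.germ_smul (preMod M) y.1 U y.2 r m

lemma modGerm_map {U V : Y.Opens} (i : U ⟶ V) (m : Γ(M, V)) (y : U) :
    modGerm M y (M.presheaf.map i.op m) = modGerm M (i y) m :=
  TopCat.Presheaf.germ_res_apply (preMod M).presheaf i y.1 y.2 m

lemma exists_map_eq_of_modGerm_eq {U V : Y.Opens} {y : Y} (hU : y ∈ U) (hV : y ∈ V)
    (m : Γ(M, U)) (n : Γ(M, V)) (h : modGerm M ⟨y, hU⟩ m = modGerm M ⟨y, hV⟩ n) :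
    ∃ (W : Y.Opens) (_ : y ∈ W) (i : W ⟶ U) (j : W ⟶ V),
      M.presheaf.map i.op m = M.presheaf.map j.op n :=
  TopCat.Presheaf.germ_eq (preMod M).presheaf y hU hV m n h

/-- The predicate satisfied by all families. -/
def truePredicate (B : Y → Type u) [∀ y, AddCommGroup (B y)]
    [∀ y, Module (Y.presheaf.stalk y) (B y)] : LinearPredicate B where
  pred _ := True
  res _ _ _ := trivial
  locality _ _ := trivial
  zero := trivial
  add _ _ _ _ := trivial
  neg _ _ := trivial
  smul _ _ _ := trivial

end Stalk

section LocalSpan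
variable {Y Z : Scheme.{u}} (g : Y ⟶ Z) (N : Z.Modules)

/-- The stalks of a pull-back are generated by the pull-backs of sections. -/
lemma modGerm_mem_span_pullbackSection {V : Y.Opens}
    (s : Γ((Scheme.Modules.pullback g).obj N, V)) (y : V) :
    modGerm _ y s ∈ Submodule.span (Y.presheaf.stalk y.1)
      {t : modStalk ((Scheme.Modules.pullback g).obj N) y.1 | ∃ (U : Z.Opens) (hy : y.1 ∈ g ⁻¹ᵁ U)
        (n : Γ(N, U)), modGerm _ ⟨y.1, hy⟩ (pullbackSection g N U n) = t} := by
  let S (y : Y) : Submodule (Y.presheaf.stalk y) (modStalk ((Scheme.Modules.pullback g).obj N) y) :=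
    Submodule.span (Y.presheaf.stalk y)
      {t | ∃ (U : Z.Opens) (hy : y ∈ g ⁻¹ᵁ U)
        (n : Γ(N, U)), modGerm _ ⟨y, hy⟩ (pullbackSection g N U n) = t}
  -- Passing to stalks modulo `S` is a morphism out of the pull-back that kills every pulled back
  -- section. By adjunction such a morphism is zero, so all germs lie in `S`.
  let P := truePredicate (fun y => modStalk ((Scheme.Modules.pullback g).obj N) y ⧸ S y)
  let φ : (Scheme.Modules.pullback g).obj N ⟶ P.sheaf :=
    P.hom _ (fun U y => (S y.1).mkQ.toAddMonoidHom.comp (modGerm _ y))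
      (fun U V i m x => congrArg (S x.1).mkQ (modGerm_map _ i m x))
      (fun U r m x => by
        change (S x.1).mkQ (modGerm _ x (r • m)) = _ • (S x.1).mkQ (modGerm _ x m)
        rw [modGerm_smul, map_smul])
      (fun U m => trivial)
  have hφ : φ = 0 := by
    refine pullback_hom_ext fun U n => P.value_ext fun x => ?_
    change (S x.1).mkQ (modGerm _ x _) = 0
    rw [Submodule.mkQ_apply, Submodule.Quotient.mk_eq_zero]
    exact Submodule.subset_span ⟨U, x.2, n, rfl⟩
  have h1 : P.value (φ.app V s) y = 0 := by rw [hφ]; rfl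
  change (S y.1).mkQ (modGerm _ y s) = 0 at h1
  rwa [Submodule.mkQ_apply, Submodule.Quotient.mk_eq_zero] at h1

end LocalSpan

lemma generatingSections_hom_ext {C : Type*} [Category C] {J : GrothendieckTopology C}
    {R : Sheaf J RingCat.{u}} [HasWeakSheafify J AddCommGrpCat.{u}]
    [J.WEqualsLocallyBijective AddCommGrpCat.{u}] {M N : SheafOfModules.{u} R}
    (τ : M.GeneratingSections) (φ ψ : M ⟶ N)
    (h : ∀ j, SheafOfModules.sectionsMap φ (τ.s j) = SheafOfModules.sectionsMap ψ (τ.s j)) :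
    φ = ψ := by
  rw [← cancel_epi τ.π, SheafOfModules.freeHomEquiv_symm_comp,
    SheafOfModules.freeHomEquiv_symm_comp]
  congr 1
  funext j
  exact h j

section FiniteType
variable {Y : Scheme.{u}} (M : Y.Modules)

/-- A coherent sheaf on a non-empty scheme is generated by finitely many sections over some
non-empty open subset. -/
lemma IsCoherent.exists_generators [Nonempty Y] (hM : IsCoherent M) :
    ∃ W : Y.Opens, (W : Set Y).Nonempty ∧ ∃ (ι : Type u) (_ : Finite ι) (m : ι → Γ(M, W)),
      ∀ (V : Y.Opens) (i : V ⟶ W) (s : Γ(M, V)) (y : V), modGerm M y s ∈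
        Submodule.span (Y.presheaf.stalk y.1) (Set.range fun j => modGerm M (i y) (m j)) := by
  classical
  have hM' : SheafOfModules.IsFinitePresentation (R := Y.ringCatSheaf) M := hM
  obtain ⟨σ, hσ⟩ := hM'.exists_quasicoherentData
  obtain ⟨y⟩ := ‹Nonempty Y›
  obtain ⟨W, i, hi, hy⟩ := σ.coversTop ⊤ y trivial
  obtain ⟨l, ⟨hl⟩⟩ := (Sieve.mem_ofObjects_iff ..).mp hi
  let W := σ.X l
  let τ := (σ.presentation l).generators
  have hτ : τ.IsFiniteType := (hσ.isFinite_presentation l).isFiniteType_generators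
  let m : τ.I → Γ(M, W) := fun j => (τ.s j).1 (op (Over.mk (𝟙 W)))
  -- Outside `W` the submodule is everything, so the quotient family makes sense on all of `Y`. The
  -- morphism to it is zero over `W` because it kills the generators there.
  let S (y : Y) : Submodule (Y.presheaf.stalk y) (modStalk M y) :=
    if hy : y ∈ W then Submodule.span (Y.presheaf.stalk y) (Set.range fun j => modGerm M ⟨y, hy⟩ (m j))
      else ⊤
  refine ⟨W, ⟨y, hl.le hy⟩, τ.I, hτ.finite, m, fun V i s y => ?_⟩
  let P := truePredicate (fun y => modStalk M y ⧸ S y)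
  let φ : M ⟶ P.sheaf :=
    P.hom _ (fun U y => (S y.1).mkQ.toAddMonoidHom.comp (modGerm _ y))
      (fun U V i m x => congrArg (S x.1).mkQ (modGerm_map _ i m x))
      (fun U r m x => by
        change (S x.1).mkQ (modGerm _ x (r • m)) = _ • (S x.1).mkQ (modGerm _ x m)
        rw [modGerm_smul, map_smul])
      (fun U m => trivial)
  let ψ := SheafOfModules.Hom.over (R := Y.ringCatSheaf) φ W
  have hval : ∀ (j : τ.I) (V : Over W) (x : V.left),
      P.value (φ.app V.left ((τ.s j).1 (op V))) x = 0 := fun j V x => by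
    have h2 : (τ.s j).1 (op V) = M.presheaf.map V.hom.op (m j) :=
      ((τ.s j).2 (Over.homMk V.hom : V ⟶ Over.mk (𝟙 W)).op).symm
    change (S x.1).mkQ (modGerm _ x ((τ.s j).1 (op V))) = 0
    rw [Submodule.mkQ_apply, Submodule.Quotient.mk_eq_zero, h2, modGerm_map]
    simp only [S]
    rw [dif_pos (V.hom.le x.2)]
    exact Submodule.subset_span ⟨j, rfl⟩
  have hψ : ψ = 0 := by
    refine generatingSections_hom_ext τ ψ 0 fun j => ?_
    refine PresheafOfModules.sections_ext _ _ fun V => ?_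
    exact P.value_ext (U := V.unop.left) fun x => hval j V.unop x
  have h1 : P.value (φ.app V s) y = 0 := by
    have h2 := congr(($hψ).val.app (op (Over.mk i)) s)
    exact congrArg (fun t => P.value (U := V) t y) h2
  change (S y.1).mkQ (modGerm _ y s) = 0 at h1
  rw [Submodule.mkQ_apply, Submodule.Quotient.mk_eq_zero] at h1
  simp only [S] at h1
  rwa [dif_pos (i.le y.2)] at h1

end FiniteType

/-! ### Calculus of sections of Cartier divisors. -/

section CartierBasics
variable {X Y : Scheme.{u}} [IsIntegral X] [IsIntegral Y]

/-- The local ring `𝒪_{X,x}` as a subring of the function field. -/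
def localRing (x : X) : Subring X.functionField :=
  (algebraMap (X.presheaf.stalk x) X.functionField).range

lemma CDiv.mem_stalk_iff {D : CDiv X} {x : X} {g : (X.functionField)ˣ}
    (hg : D.germ x = QuotientGroup.mk g) {φ : X.functionField} :
    φ ∈ D.stalk x ↔ φ * g ∈ localRing x :=
  ⟨fun ⟨_, hh, h⟩ => mem_of_mk_eq (hh.symm.trans hg) h, fun h => ⟨g, hg, h⟩⟩

lemma CDiv.exists_germ_eq (D : CDiv X) (x : X) :
    ∃ g : (X.functionField)ˣ, D.germ x = QuotientGroup.mk g := by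
  obtain ⟨g, hg⟩ := QuotientGroup.mk_surjective (D.germ x)
  exact ⟨g, hg.symm⟩

/-- Local equations exist on open neighbourhoods. -/
lemma CDiv.exists_equation (D : CDiv X) (x : X) :
    ∃ U : X.Opens, x ∈ U ∧ ∃ g : (X.functionField)ˣ, ∀ y ∈ U, D.germ y = QuotientGroup.mk g :=
  D.toMul.2 x

lemma CDiv.germ_add (D E : CDiv X) (x : X) : (D + E).germ x = D.germ x * E.germ x := rfl

lemma CDiv.germ_zero (x : X) : (0 : CDiv X).germ x = QuotientGroup.mk 1 := rfl

lemma CDiv.germ_neg (D : CDiv X) (x : X) : (-D).germ x = (D.germ x)⁻¹ := rfl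

lemma CDiv.germ_nsmul (D : CDiv X) (n : ℕ) (x : X) : (n • D).germ x = D.germ x ^ n := by
  induction n with
  | zero => rw [zero_smul, pow_zero]; rfl
  | succ n ih => rw [succ_nsmul, germ_add, ih, pow_succ]

lemma CDiv.zero_stalk (x : X) (φ : X.functionField) :
    φ ∈ (0 : CDiv X).stalk x ↔ φ ∈ localRing x := by
  rw [mem_stalk_iff (CDiv.germ_zero x)]; simp

lemma CDiv.mul_mem_stalk {D E : CDiv X} {x : X} {φ ψ : X.functionField}
    (hφ : φ ∈ D.stalk x) (hψ : ψ ∈ E.stalk x) : φ * ψ ∈ (D + E).stalk x := by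
  obtain ⟨g, hg⟩ := D.exists_germ_eq x
  obtain ⟨h, hh⟩ := E.exists_germ_eq x
  have h1 : (D + E).germ x = QuotientGroup.mk (g * h) := by
    rw [germ_add, hg, hh]; rfl
  rw [mem_stalk_iff h1]
  rw [mem_stalk_iff hg] at hφ
  rw [mem_stalk_iff hh] at hψ
  have := mul_mem hφ hψ
  rw [Units.val_mul]
  convert this using 1
  ring

lemma CDiv.pow_mem_stalk {D : CDiv X} {x : X} {φ : X.functionField}
    (hφ : φ ∈ D.stalk x) (n : ℕ) : φ ^ n ∈ (n • D).stalk x := by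
  induction n with
  | zero =>
    rw [pow_zero, zero_smul, zero_stalk]
    exact one_mem _
  | succ n ih => rw [pow_succ, succ_nsmul]; exact mul_mem_stalk ih hφ

lemma CDiv.localRing_mul_mem_stalk {D : CDiv X} {x : X} {r φ : X.functionField}
    (hr : r ∈ localRing x) (hφ : φ ∈ D.stalk x) : r * φ ∈ D.stalk x := by
  have := mul_mem_stalk ((zero_stalk x r).mpr hr) hφ
  rwa [zero_add] at this

lemma CDiv.prod_mem_stalk {ι : Type*} (s : Finset ι) {D : ι → CDiv X} {x : X}
    {φ : ι → X.functionField} (h : ∀ i ∈ s, φ i ∈ (D i).stalk x) :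
    ∏ i ∈ s, φ i ∈ (∑ i ∈ s, D i).stalk x := by
  classical
  induction s using Finset.induction_on with
  | empty => rw [Finset.prod_empty, Finset.sum_empty, zero_stalk]; exact one_mem _
  | insert a s ha ih =>
    rw [Finset.prod_insert ha, Finset.sum_insert ha]
    exact mul_mem_stalk (h a (Finset.mem_insert_self a s))
      (ih fun i hi => h i (Finset.mem_insert_of_mem hi))

lemma CDiv.Generates.mem_stalk_iff {D : CDiv X} {x : X} {φ ψ : X.functionField}
    (h : D.Generates φ x) : ψ ∈ D.stalk x ↔ ψ * φ⁻¹ ∈ localRing x := by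
  obtain ⟨v, rfl, hv⟩ := h
  rw [CDiv.mem_stalk_iff hv, Units.val_inv_eq_inv_val]

lemma CDiv.Generates.ne_zero {D : CDiv X} {x : X} {φ : X.functionField}
    (h : D.Generates φ x) : φ ≠ 0 := by
  obtain ⟨v, rfl, -⟩ := h
  exact v.ne_zero

lemma CDiv.Generates.inv_mem_stalk {D : CDiv X} {x : X} {φ : X.functionField}
    (h : D.Generates φ x) : φ⁻¹ ∈ (-D).stalk x := by
  obtain ⟨v, rfl, hv⟩ := h
  have : (-D).germ x = QuotientGroup.mk v := by rw [germ_neg, hv, ← QuotientGroup.mk_inv, inv_inv]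
  rw [CDiv.mem_stalk_iff this, inv_mul_cancel₀ v.ne_zero]
  exact one_mem _

lemma CDiv.Generates.pow {D : CDiv X} {x : X} {φ : X.functionField}
    (h : D.Generates φ x) (n : ℕ) : (n • D).Generates (φ ^ n) x := by
  obtain ⟨v, rfl, hv⟩ := h
  exact ⟨v ^ n, by simp, by rw [germ_nsmul, hv, ← QuotientGroup.mk_pow, inv_pow]⟩

/-- A section generates exactly when it divided by a local equation is a unit. -/
lemma CDiv.generates_iff {D : CDiv X} {x : X} {g : (X.functionField)ˣ}
    (hg : D.germ x = QuotientGroup.mk g) {φ : X.functionField} :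
    D.Generates φ x ↔ ∃ u : (X.presheaf.stalk x)ˣ,
      algebraMap (X.presheaf.stalk x) X.functionField u = φ * g := by
  constructor
  · rintro ⟨v, rfl, hv⟩
    rw [hg] at hv
    obtain ⟨u, hu⟩ := QuotientGroup.eq.mp hv.symm
    refine ⟨u, ?_⟩
    have := congrArg Units.val hu
    simpa using this
  · rintro ⟨u, hu⟩
    have hφ : φ ≠ 0 := by
      rintro rfl
      rw [zero_mul, map_eq_zero_iff _ (FaithfulSMul.algebraMap_injective _ _)] at hu
      exact u.ne_zero hu
    refine ⟨Units.mk0 φ hφ, rfl, ?_⟩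
    rw [hg, QuotientGroup.eq]
    refine ⟨u⁻¹, ?_⟩
    rw [map_inv, inv_eq_iff_eq_inv]
    ext
    simp only [Units.coe_map]
    change algebraMap (X.presheaf.stalk x) X.functionField u = _
    rw [hu]
    simp [mul_comm]

variable (f : X ⟶ Y) [IsDominant f]

lemma functionFieldMap_mem_localRing {x : X} {r : Y.functionField}
    (hr : r ∈ localRing (f x)) : functionFieldMap f r ∈ localRing x := by
  obtain ⟨a, rfl⟩ := hr
  exact ⟨_, (functionFieldMap_algebraMap f x a).symm⟩

lemma CDiv.germ_pullback {D : CDiv Y} {x : X} {g : (Y.functionField)ˣ}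
    (hg : D.germ (f x) = QuotientGroup.mk g) :
    (CDiv.pullback f D).germ x =
      QuotientGroup.mk (Units.map (functionFieldMap f).toMonoidHom g) :=
  congrArg (pullbackGerm f x) hg

lemma CDiv.functionFieldMap_mem_stalk {D : CDiv Y} {x : X} {φ : Y.functionField}
    (hφ : φ ∈ D.stalk (f x)) : functionFieldMap f φ ∈ (CDiv.pullback f D).stalk x := by
  obtain ⟨g, hg⟩ := D.exists_germ_eq (f x)
  rw [mem_stalk_iff hg] at hφ
  rw [mem_stalk_iff (germ_pullback f hg)]
  have := functionFieldMap_mem_localRing f hφ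
  rwa [map_mul] at this

end CartierBasics

/-! ### Separable extensions and linear relations between `p^e`-th powers. -/

/-- A linear relation with coefficients in `K` between the `p ^ e`-th powers of elements of a
separable extension of `K` comes from linear relations between these elements. -/
lemma exists_coeff_of_sum_mul_pow_eq_zero {K L : Type*} [Field K] [Field L] [Algebra K L]
    [Algebra.IsGeometricallyReduced K L] {p : ℕ} (hp : p.Prime) (hpK : (p : K) = 0) (e : ℕ)
    {ι : Type*} [Fintype ι] (a : ι → K) (φ : ι → L)
    (h : ∑ l, algebraMap K L (a l) * φ l ^ p ^ e = 0) :
    ∃ (κ : Type) (_ : Fintype κ) (j : κ → ι) (c : ι → κ → K),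
      (∀ l, φ l = ∑ i, algebraMap K L (c l i) * φ (j i)) ∧ ∀ i, ∑ l, a l * c l i ^ p ^ e = 0 := by
  have : Fact p.Prime := ⟨hp⟩
  have : CharP K p := by
    rcases (Nat.dvd_prime hp).mp (ringChar.dvd hpK) with h2 | h2
    · exact absurd h2 CharP.ringChar_ne_one
    · exact ringChar.of_eq h2
  let Ω := AlgebraicClosure K
  have : CharP Ω p := charP_of_injective_algebraMap (algebraMap K Ω).injective p
  have : IsReduced (Ω ⊗[K] L) :=
    (Algebra.isGeometricallyReduced_field_iff K L).mp inferInstance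
  have : CharP (Ω ⊗[K] L) p :=
    charP_of_injective_algebraMap (algebraMap K (Ω ⊗[K] L)).injective p
  -- With `b_l` a `p^e`-th root of `a_l`, the relation says that the `p^e`-th power of `∑ b_l ⊗ φ_l`
  -- vanishes. Reducedness of `Ω ⊗ L` removes the power.
  have hroot : ∀ l, ∃ b : Ω, b ^ p ^ e = algebraMap K Ω (a l) := fun l =>
    IsAlgClosed.exists_pow_nat_eq _ (pow_pos hp.pos e)
  choose b hb using hroot
  let z : Ω ⊗[K] L := ∑ l, b l ⊗ₜ[K] φ l
  have hz : z = 0 := by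
    refine pow_eq_zero_iff (pow_ne_zero e hp.ne_zero) |>.mp ?_
    rw [sum_pow_char_pow]
    have : ∀ l, (b l ⊗ₜ[K] φ l) ^ p ^ e = (1 : Ω) ⊗ₜ[K] (algebraMap K L (a l) * φ l ^ p ^ e) := by
      intro l
      rw [Algebra.TensorProduct.tmul_pow, hb, ← Algebra.smul_def, Algebra.algebraMap_eq_smul_one,
        TensorProduct.smul_tmul]
    simp only [this]
    rw [← TensorProduct.tmul_sum, h, TensorProduct.tmul_zero]
  -- The `φ_l` are expanded in a maximal linearly independent subfamily. Extending its coordinate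
  -- functionals to `L` allows coefficients to be compared inside `Ω ⊗ L`.
  obtain ⟨κ', j', hj', hspan, hli⟩ := exists_linearIndependent' K φ
  have : Finite κ' := Finite.of_injective j' hj'
  have : Fintype κ' := Fintype.ofFinite κ'
  let eκ := Fintype.equivFin κ'
  let bas := Module.Basis.span hli
  have hcoord : ∀ i : κ', ∃ g : L →ₗ[K] K,
      g ∘ₗ (Submodule.span K (Set.range (φ ∘ j'))).subtype = bas.coord i := fun i =>
    LinearMap.exists_extend _
  choose g hg using hcoord
  have hmem : ∀ l, φ l ∈ Submodule.span K (Set.range (φ ∘ j')) := fun l => by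
    rw [hspan]; exact Submodule.subset_span ⟨l, rfl⟩
  have hrep : ∀ l, φ l = ∑ i, algebraMap K L (g i (φ l)) * φ (j' i) := fun l => by
    have h1 := congrArg (Submodule.subtype _) (bas.sum_repr ⟨φ l, hmem l⟩)
    rw [map_sum] at h1
    refine h1.symm.trans (Finset.sum_congr rfl fun i _ => ?_)
    rw [map_smul, Algebra.smul_def]
    congr 2
    · exact (LinearMap.congr_fun (hg i) ⟨φ l, hmem l⟩).symm
    · exact congrArg Subtype.val (Module.Basis.span_apply hli i) |>.trans rfl
  refine ⟨Fin (Fintype.card κ'), inferInstance, j' ∘ eκ.symm, fun l i => g (eκ.symm i) (φ l),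
    fun l => (hrep l).trans (Fintype.sum_equiv eκ _ _ fun i => by simp), fun i => ?_⟩
  -- The `i`-th coordinate of `z = 0` reads `∑ b_l c_{li} = 0` in `Ω`. Its `p^e`-th power has
  -- coefficients in `K`.
  have h1 := congrArg (TensorProduct.rid K Ω) (congrArg (LinearMap.lTensor Ω (g (eκ.symm i))) hz)
  rw [map_zero, map_zero, map_sum, map_sum] at h1
  simp only [LinearMap.lTensor_tmul, TensorProduct.rid_tmul] at h1
  have h2 := congrArg (fun t => t ^ p ^ e) h1
  change (∑ l, _) ^ p ^ e = 0 ^ p ^ e at h2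
  rw [sum_pow_char_pow, zero_pow (pow_ne_zero e hp.ne_zero)] at h2
  apply (algebraMap K Ω).injective
  rw [map_zero, ← h2, map_sum]
  refine Finset.sum_congr rfl fun l _ => ?_
  rw [Algebra.smul_def, mul_pow, hb, map_mul, map_pow, mul_comm]

/-! ### Sections as rational functions, and sheaves of rational functions of `X` over `Y`. -/

section SectionValue
variable {X : Scheme.{u}} [IsIntegral X] {D : CDiv X} {V : X.Opens}

lemma genericPoint_mem_of_mem {x : X} (hx : x ∈ V) : genericPoint X ∈ V :=
  (genericPoint_specializes x).mem_open V.2 hx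

/-- The rational function underlying a section of `𝒪_X(D)`. -/
def sectionValue (hV : genericPoint X ∈ V) : Γ(D.sheaf, V) →+ X.functionField where
  toFun s := Subtype.val (p := fun s => s ∈ D.sections V) s ⟨genericPoint X, hV⟩
  map_zero' := rfl
  map_add' _ _ := rfl

lemma apply_eq_sectionValue (hV : genericPoint X ∈ V) (s : Γ(D.sheaf, V)) (x : V) :
    Subtype.val (p := fun s => s ∈ D.sections V) s x = sectionValue hV s := by
  obtain ⟨-, W, hW, h⟩ := s.2 x
  exact (h ⟨genericPoint X, hV⟩ (genericPoint_mem_of_mem hW)).symm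

lemma sectionValue_mem_stalk (hV : genericPoint X ∈ V) (s : Γ(D.sheaf, V)) {x : X} (hx : x ∈ V) :
    sectionValue hV s ∈ D.stalk x := by
  rw [← apply_eq_sectionValue hV s ⟨x, hx⟩]
  exact (s.2 ⟨x, hx⟩).1

lemma sectionValue_smul (hV : genericPoint X ∈ V) (r : Γ(X, V)) (s : Γ(D.sheaf, V)) :
    sectionValue hV (r • s) =
      X.presheaf.germ V (genericPoint X) hV r * sectionValue hV s := by
  change algebraMap (X.presheaf.stalk (genericPoint X)) X.functionField _ * _ = _
  congr 1
  have : Nonempty V := ⟨⟨_, hV⟩⟩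
  exact Scheme.algebraMap_germ_eq_germToFunctionField X hV r

lemma sectionValue_injective (hV : genericPoint X ∈ V) :
    Function.Injective (sectionValue (D := D) hV) := fun s t h =>
  Subtype.ext (funext fun x =>
    (apply_eq_sectionValue hV s x).trans (h.trans (apply_eq_sectionValue hV t x).symm))

lemma exists_sectionValue_eq (hV : genericPoint X ∈ V) {c : X.functionField}
    (hc : ∀ x ∈ V, c ∈ D.stalk x) : ∃ s : Γ(D.sheaf, V), sectionValue hV s = c :=
  ⟨(⟨fun _ => c, fun x => ⟨hc x x.2, ⊤, trivial, fun _ _ => rfl⟩⟩ : D.sections V), rfl⟩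

end SectionValue

section RationalFunctions

/-- The function field of `X`, as a module over the local rings of `Y`. -/
def RationalFunctions {X Y : Scheme.{u}} [IsIntegral X] (_ : X ⟶ Y) : Type u := X.functionField

variable {X Y : Scheme.{u}} [IsIntegral X] [IsIntegral Y] (f : X ⟶ Y) [IsDominant f]

instance : Field (RationalFunctions f) := inferInstanceAs (Field X.functionField)

instance : Algebra Y.functionField (RationalFunctions f) := (functionFieldMap f).toAlgebra

instance (y : Y) : Algebra (Y.presheaf.stalk y) (RationalFunctions f) :=
  ((functionFieldMap f).comp (algebraMap (Y.presheaf.stalk y) Y.functionField)).toAlgebra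

instance (y : Y) : IsScalarTower (Y.presheaf.stalk y) Y.functionField (RationalFunctions f) :=
  .of_algebraMap_eq fun _ => rfl

variable {f}

lemma algebraMap_germ_eq (U : Y.Opens) {y : Y} (hy : y ∈ U) (hU : genericPoint Y ∈ U) (r : Γ(Y, U)) :
    algebraMap (Y.presheaf.stalk y) Y.functionField (Y.presheaf.germ U y hy r) =
      Y.presheaf.germ U (genericPoint Y) hU r := by
  have : Nonempty U := ⟨⟨_, hU⟩⟩
  exact Scheme.algebraMap_germ_eq_germToFunctionField Y hy r

lemma functionFieldMap_germ (U : Y.Opens) (hU : genericPoint Y ∈ U)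
    (hV : genericPoint X ∈ f ⁻¹ᵁ U) (r : Γ(Y, U)) :
    functionFieldMap f (Y.presheaf.germ U (genericPoint Y) hU r) =
      X.presheaf.germ (f ⁻¹ᵁ U) (genericPoint X) hV (f.app U r) := by
  have hV' : f (genericPoint X) ∈ U := hV
  have h1 := functionFieldMap_algebraMap f (genericPoint X)
    (Y.presheaf.germ U (f (genericPoint X)) hV' r)
  rw [algebraMap_germ_eq U hV' hU] at h1
  refine h1.trans ?_
  rw [← algebraMap_germ_eq _ hV hV]
  congr 1
  exact Scheme.Hom.germ_stalkMap_apply f U (genericPoint X) hV r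

lemma genericPoint_mem_preimage {U : Y.Opens} {y : Y} (hy : y ∈ U) :
    genericPoint X ∈ f ⁻¹ᵁ U := by
  change f (genericPoint X) ∈ U
  rw [map_genericPoint]
  exact genericPoint_mem_of_mem hy

variable (f) in
/-- Locally constant families of rational functions on `X` with prescribed local conditions
over `Y`. -/
def constPredicate (Q : ∀ y : Y, Submodule (Y.presheaf.stalk y) (RationalFunctions f)) :
    LinearPredicate (Y := Y) (fun _ => RationalFunctions f) where
  pred {U} s := ∀ x : U, s x ∈ Q x.1 ∧ ∃ V : Opens Y, x.1 ∈ V ∧ ∀ y : U, y.1 ∈ V → s y = s x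
  res {U V} i s hs x := by
    obtain ⟨h1, W, hW, h2⟩ := hs (i x)
    exact ⟨h1, W, hW, fun y hy => h2 (i y) hy⟩
  locality {U} s hs x := by
    obtain ⟨V, hV, i, h⟩ := hs x
    obtain ⟨h1, W, hW, h2⟩ := h ⟨x.1, hV⟩
    exact ⟨h1, V ⊓ W, ⟨hV, hW⟩, fun y hy => h2 ⟨y.1, hy.1⟩ hy.2⟩
  zero x := ⟨zero_mem _, ⊤, trivial, fun _ _ => rfl⟩
  add s t hs ht x := by
    obtain ⟨h1, V, hV, h2⟩ := hs x
    obtain ⟨k1, W, hW, k2⟩ := ht x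
    exact ⟨add_mem h1 k1, V ⊓ W, ⟨hV, hW⟩, fun y hy => by
      change s y + t y = s x + t x; rw [h2 y hy.1, k2 y hy.2]⟩
  neg s hs x := by
    obtain ⟨h1, V, hV, h2⟩ := hs x
    exact ⟨neg_mem h1, V, hV, fun y hy => by change -s y = -s x; rw [h2 y hy]⟩
  smul {U} r s hs x := by
    obtain ⟨h1, V, hV, h2⟩ := hs x
    refine ⟨Submodule.smul_mem _ _ h1, V, hV, fun y hy => ?_⟩
    change _ • s y = _ • s x
    rw [h2 y hy, Algebra.smul_def, Algebra.smul_def]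
    congr 1
    change functionFieldMap f (algebraMap _ _ _) = functionFieldMap f (algebraMap _ _ _)
    rw [algebraMap_germ_eq U y.2 (genericPoint_mem_of_mem x.2),
      algebraMap_germ_eq U x.2 (genericPoint_mem_of_mem x.2)]

/-- The rational function underlying a section. -/
lemma constPredicate_value_eq (Q : ∀ y : Y, Submodule (Y.presheaf.stalk y) (RationalFunctions f))
    {U : Y.Opens} (s : Γ((constPredicate f Q).sheaf, U)) (x y : U) :
    (constPredicate f Q).value s x = (constPredicate f Q).value s y := by
  have hη := genericPoint_mem_of_mem x.2
  have key : ∀ z : U, (constPredicate f Q).value s z =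
      (constPredicate f Q).value s ⟨genericPoint Y, hη⟩ := fun z => by
    obtain ⟨-, V, hV, h⟩ := (constPredicate f Q).value_pred s z
    exact (h ⟨genericPoint Y, hη⟩ (genericPoint_mem_of_mem hV)).symm
  rw [key x, key y]

/-- A family of constants that does not depend on the point satisfies the predicate as soon as the
local conditions hold. -/
lemma constPredicate_pred_const (Q : ∀ y : Y, Submodule (Y.presheaf.stalk y) (RationalFunctions f))
    {U : Y.Opens} (s : U → RationalFunctions f) (hs : ∀ x y, s x = s y) (h : ∀ x : U, s x ∈ Q x.1) :
    (constPredicate f Q).pred (U := U) s :=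
  fun x => ⟨h x, ⊤, trivial, fun y _ => hs y x⟩

end RationalFunctions

section Opens
variable {Y : Scheme.{u}}

/-- Finitely many germs extend to a common neighbourhood. -/
lemma exists_germ_eq_of_finite {ι : Type*} [Finite ι] (y : Y) (t : ι → Y.presheaf.stalk y)
    (V : Y.Opens) (hV : y ∈ V) :
    ∃ (W : Y.Opens) (_ : W ⟶ V) (hW : y ∈ W) (T : ι → Γ(Y, W)),
      ∀ i, Y.presheaf.germ W y hW (T i) = t i := by
  have := Fintype.ofFinite ι
  choose U hU s hs using fun i => Y.presheaf.exists_germ_eq (t i)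
  let W : Y.Opens := V ⊓ Finset.univ.inf U
  have hWU : ∀ i, W ≤ U i := fun i => inf_le_right.trans (Finset.inf_le (Finset.mem_univ i))
  have hW : y ∈ W := by
    refine ⟨hV, ?_⟩
    change y ∈ (Finset.univ.inf U : Y.Opens)
    rw [← SetLike.mem_coe, Opens.coe_finset_inf, Finset.inf_eq_iInf]
    simpa using hU
  refine ⟨W, homOfLE inf_le_left, hW, fun i => Y.presheaf.map (homOfLE (hWU i)).op (s i), fun i => ?_⟩
  rw [Y.presheaf.germ_res_apply (homOfLE (hWU i)) y hW, hs]

lemma germ_genericPoint_injective [IsIntegral Y] (U : Y.Opens) (hU : genericPoint Y ∈ U) :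
    Function.Injective (Y.presheaf.germ U (genericPoint Y) hU) := by
  have : Nonempty U := ⟨⟨_, hU⟩⟩
  exact Scheme.germToFunctionField_injective Y U

end Opens

/-! ### Frobenius pull-backs and the `p^e`-th power map. -/

section FrobeniusSection
variable {Y : Scheme.{u}} {p : ℕ} (hp : p.Prime) (h : (p : Γ(Y, ⊤)) = 0) (e : ℕ) (N : Y.Modules)

/-- The Frobenius pull-back of a section. -/
def frobSection {U : Y.Opens} :
    Γ(N, U) →+ Γ((Scheme.Modules.pullback (absFrobenius hp h e)).obj N, U) :=
  pullbackSection (absFrobenius hp h e) N U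

lemma frobSection_smul {U : Y.Opens} (r : Γ(Y, U)) (n : Γ(N, U)) :
    frobSection hp h e N (r • n) = r ^ p ^ e • frobSection hp h e N n :=
  pullbackSection_smul (absFrobenius hp h e) N U r n

lemma frobSection_map {U V : Y.Opens} (i : U ⟶ V) (n : Γ(N, V)) :
    frobSection hp h e N (N.presheaf.map i.op n) =
      ((Scheme.Modules.pullback (absFrobenius hp h e)).obj N).presheaf.map i.op
        (frobSection hp h e N n) :=
  pullbackSection_map (absFrobenius hp h e) N i n

/-- Sections of a Frobenius pull-back are locally linear combinations of pull-backs of sections. -/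
lemma exists_eq_sum_frobSection {V : Y.Opens}
    (s : Γ((Scheme.Modules.pullback (absFrobenius hp h e)).obj N, V)) (y : V) :
    ∃ (W : Y.Opens) (i : W ⟶ V) (_ : y.1 ∈ W) (ι : Type) (_ : Fintype ι) (a : ι → Γ(Y, W))
      (n : ι → Γ(N, W)),
      ((Scheme.Modules.pullback (absFrobenius hp h e)).obj N).presheaf.map i.op s =
        ∑ l, a l • frobSection hp h e N (n l) := by
  -- A linear combination of germs involves finitely many sections and coefficients, so it is
  -- realised on one neighbourhood of `y`.
  have key : ∀ t ∈ Submodule.span (Y.presheaf.stalk y.1)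
      {t : modStalk ((Scheme.Modules.pullback (absFrobenius hp h e)).obj N) y.1 |
        ∃ (U : Y.Opens) (hy : y.1 ∈ U) (n : Γ(N, U)),
          modGerm _ ⟨y.1, hy⟩ (frobSection hp h e N n) = t},
      ∃ (W : Y.Opens) (hW : y.1 ∈ W) (ι : Type) (_ : Fintype ι) (a : ι → Γ(Y, W))
        (n : ι → Γ(N, W)), modGerm _ ⟨y.1, hW⟩ (∑ l, a l • frobSection hp h e N (n l)) = t := by
    intro t ht
    have hres : ∀ (W W' : Y.Opens) (i : W' ⟶ W) (hW : y.1 ∈ W') (ι : Type) [Fintype ι]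
        (a : ι → Γ(Y, W)) (n : ι → Γ(N, W)),
        modGerm _ ⟨y.1, hW⟩ (∑ l, Y.presheaf.map i.op (a l) •
          frobSection hp h e N (N.presheaf.map i.op (n l))) =
        modGerm _ ⟨y.1, i.le hW⟩ (∑ l, a l • frobSection hp h e N (n l)) := by
      intro W W' i hW ι _ a n
      refine Eq.trans ?_ (modGerm_map _ i _ ⟨y.1, hW⟩)
      congr 1
      rw [map_sum]
      refine Finset.sum_congr rfl fun l _ => ?_
      rw [Scheme.Modules.map_smul, frobSection_map]
    induction ht using Submodule.span_induction with
    | mem t ht =>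
      obtain ⟨U, hy, n, rfl⟩ := ht
      exact ⟨U, hy, Unit, inferInstance, fun _ => 1, fun _ => n, by simp⟩
    | zero =>
      exact ⟨⊤, trivial, Empty, inferInstance, fun x => x.elim, fun x => x.elim, by simp⟩
    | add t t' _ _ ht ht' =>
      obtain ⟨W, hW, ι, _, a, n, rfl⟩ := ht
      obtain ⟨W', hW', ι', _, a', n', rfl⟩ := ht'
      refine ⟨W ⊓ W', ⟨hW, hW'⟩, ι ⊕ ι', inferInstance,
        Sum.elim (fun l => Y.presheaf.map (homOfLE inf_le_left : W ⊓ W' ⟶ W).op (a l))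
          (fun l => Y.presheaf.map (homOfLE inf_le_right : W ⊓ W' ⟶ W').op (a' l)),
        Sum.elim (fun l => N.presheaf.map (homOfLE inf_le_left : W ⊓ W' ⟶ W).op (n l))
          (fun l => N.presheaf.map (homOfLE inf_le_right : W ⊓ W' ⟶ W').op (n' l)), ?_⟩
      rw [Fintype.sum_sum_type, map_add]
      exact congrArg₂ (· + ·) (hres W _ (homOfLE inf_le_left) _ ι a n)
        (hres W' _ (homOfLE inf_le_right) _ ι' a' n')
    | smul r t _ ht =>
      obtain ⟨W, hW, ι, _, a, n, rfl⟩ := ht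
      obtain ⟨W', i, hW', r', hr'⟩ := exists_germ_eq_of_finite (ι := Unit) y.1 (fun _ => r) W hW
      refine ⟨W', hW', ι, inferInstance, fun l => r' () * Y.presheaf.map i.op (a l),
        fun l => N.presheaf.map i.op (n l), ?_⟩
      simp only [mul_smul]
      rw [← Finset.smul_sum, modGerm_smul, hres, hr']
  obtain ⟨W, hW, ι, _, a, n, hn⟩ := key _
    (modGerm_mem_span_pullbackSection (absFrobenius hp h e) N s y)
  obtain ⟨W', hW', i, j, hij⟩ := exists_map_eq_of_modGerm_eq _ y.2 hW s _ hn.symm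
  refine ⟨W', i, hW', ι, inferInstance, fun l => Y.presheaf.map j.op (a l),
    fun l => N.presheaf.map j.op (n l), ?_⟩
  rw [hij, map_sum]
  refine Finset.sum_congr rfl fun l _ => ?_
  rw [Scheme.Modules.map_smul, frobSection_map]

end FrobeniusSection

lemma Modules.app_injective {Y : Scheme.{u}} {M N : Y.Modules} (i : M ⟶ N) [Mono i] (U : Y.Opens) :
    Function.Injective (i.app U) := by
  have h1 : Mono ((Scheme.Modules.toPresheaf Y).map i) := inferInstance
  have h2 : Mono (((Scheme.Modules.toPresheaf Y).map i).app (op U)) :=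
    (NatTrans.mono_iff_mono_app _).mp h1 (op U)
  exact (AddCommGrpCat.mono_iff_injective _).mp h2

lemma Modules.eq_zero_of_locally {Y : Scheme.{u}} {M : Y.Modules} {U : Y.Opens} (m : Γ(M, U))
    (h : ∀ y ∈ U, ∃ (W : Y.Opens) (i : W ⟶ U), y ∈ W ∧ M.presheaf.map i.op m = 0) : m = 0 := by
  choose! W i hW hm using h
  refine TopCat.Sheaf.eq_of_locally_eq' (X := (Y : TopCat.{u})) ⟨M.presheaf, M.isSheaf⟩ (ι := U)
    (fun y => W y.1) U
    (fun y => homOfLE (leOfHom (i y.1 y.2))) (fun y hy => ?_) m 0 fun y => ?_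
  · exact Opens.mem_iSup.mpr ⟨⟨y, hy⟩, hW y hy⟩
  · rw [map_zero]
    exact hm y.1 y.2

lemma Modules.exists_ne_zero {Y : Scheme.{u}} {M : Y.Modules} (h : ¬ Limits.IsZero M) :
    ∃ (U : Y.Opens) (m : Γ(M, U)), m ≠ 0 := by
  by_contra! hc
  apply h
  rw [Limits.IsZero.iff_id_eq_zero]
  refine Scheme.Modules.hom_ext _ _ fun U => ?_
  ext m
  exact (hc U _).trans (hc U _).symm

lemma natCast_functionField_eq_zero {Y : Scheme.{u}} [IsIntegral Y] {p : ℕ}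
    (h : (p : Γ(Y, ⊤)) = 0) : (p : Y.functionField) = 0 := by
  have := congrArg (Y.presheaf.germ ⊤ (genericPoint Y) trivial) h
  rwa [map_natCast, map_zero] at this

lemma natCast_rationalFunctions_eq_zero {X Y : Scheme.{u}} [IsIntegral X] [IsIntegral Y]
    (f : X ⟶ Y) [IsDominant f] {p : ℕ} (h : (p : Γ(Y, ⊤)) = 0) :
    (p : RationalFunctions f) = 0 := by
  have := congrArg (algebraMap Y.functionField (RationalFunctions f))
    (natCast_functionField_eq_zero h)
  rwa [map_natCast, map_zero] at this

lemma LinearPredicate.value_sum {Y : Scheme.{u}} {B : Y → Type u} [∀ y, AddCommGroup (B y)]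
    [∀ y, Module (Y.presheaf.stalk y) (B y)] (P : LinearPredicate B) {U : Y.Opens}
    {ι : Type*} (t : Finset ι) (s : ι → Γ(P.sheaf, U)) (x : U) :
    P.value (∑ i ∈ t, s i) x = ∑ i ∈ t, P.value (s i) x := by
  let v : Γ(P.sheaf, U) →+ B x :=
    { toFun := fun s => P.value s x, map_zero' := rfl, map_add' := fun _ _ => rfl }
  exact map_sum v s t

section FrobLift
variable {X Y : Scheme.{u}} [IsIntegral X] [IsIntegral Y] {f : X ⟶ Y} [IsDominant f]
  {p : ℕ} (hp : p.Prime) (h : (p : Γ(Y, ⊤)) = 0) (e : ℕ) {M N : Y.Modules}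
  {Q₀ Q : ∀ y : Y, Submodule (Y.presheaf.stalk y) (RationalFunctions f)}

/-- The `p ^ e`-th power of a morphism into a sheaf of rational functions. -/
def frobPower (j : M ⟶ (constPredicate f Q₀).sheaf)
    (hQ : ∀ (U : Y.Opens) (m : Γ(M, U)) (x : U),
      (constPredicate f Q₀).value (j.app U m) x ^ p ^ e ∈ Q x) :
    M ⟶ (Scheme.Modules.pushforward (absFrobenius hp h e)).obj (constPredicate f Q).sheaf :=
  (constPredicate f Q).homPushforward (absFrobenius hp h e) M
    (fun U x =>
      { toFun := fun m => (constPredicate f Q₀).value (j.app U m) (⟨x.1, x.2⟩ : U) ^ p ^ e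
        map_zero' := by
          rw [map_zero]
          exact zero_pow (pow_ne_zero _ hp.ne_zero)
        map_add' := fun m n => by
          rw [map_add]
          exact add_pow_of_natCast_eq_zero hp (natCast_rationalFunctions_eq_zero f h) e _ _ })
    (fun U V i m x => by
      change (constPredicate f Q₀).value (j.app U _) _ ^ p ^ e =
        (constPredicate f Q₀).value (j.app V m) _ ^ p ^ e
      have h1 := congr($(j.mapPresheaf.naturality i.op) m)
      have h2 : j.app U (M.presheaf.map i.op m) =
        (constPredicate f Q₀).sheaf.presheaf.map i.op (j.app V m) := h1
      rw [h2]
      rfl)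
    (fun U r m x => by
      change (constPredicate f Q₀).value (j.app U _) (⟨x.1, x.2⟩ : U) ^ p ^ e =
        Y.presheaf.germ U x.1 x.2 (r ^ p ^ e) •
          (constPredicate f Q₀).value (j.app U m) (⟨x.1, x.2⟩ : U) ^ p ^ e
      rw [Scheme.Modules.Hom.app_smul, LinearPredicate.value_smul, smul_pow, map_pow])
    (fun U m => constPredicate_pred_const _ _
      (fun x y => congrArg (· ^ p ^ e) (constPredicate_value_eq Q₀ _ _ _))
      (fun x => hQ U m ⟨x.1, x.2⟩))

/-- The morphism on the Frobenius pull-back given by `p ^ e`-th powers. -/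
def frobLift (j : M ⟶ (constPredicate f Q₀).sheaf)
    (hQ : ∀ (U : Y.Opens) (m : Γ(M, U)) (x : U),
      (constPredicate f Q₀).value (j.app U m) x ^ p ^ e ∈ Q x) :
    (Scheme.Modules.pullback (absFrobenius hp h e)).obj M ⟶ (constPredicate f Q).sheaf :=
  pullbackLift (frobPower hp h e j hQ)

lemma value_frobLift_app_frobSection (j : M ⟶ (constPredicate f Q₀).sheaf)
    (hQ : ∀ (U : Y.Opens) (m : Γ(M, U)) (x : U),
      (constPredicate f Q₀).value (j.app U m) x ^ p ^ e ∈ Q x) {U : Y.Opens} (m : Γ(M, U)) (x : U) :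
    (constPredicate f Q).value ((frobLift hp h e j hQ).app U (frobSection hp h e M m)) x =
      (constPredicate f Q₀).value (j.app U m) x ^ p ^ e :=
  congrArg (fun t => (constPredicate f Q).value (U := U) t x)
    (pullbackLift_app_pullbackSection (frobPower hp h e j hQ) U m)

lemma value_app_map {P : LinearPredicate (fun _ : Y => RationalFunctions f)} (j : M ⟶ P.sheaf)
    {U V : Y.Opens} (i : U ⟶ V) (m : Γ(M, V)) (x : U) :
    P.value (j.app U (M.presheaf.map i.op m)) x = P.value (j.app V m) (i x) := by
  have h2 : j.app U (M.presheaf.map i.op m) = P.sheaf.presheaf.map i.op (j.app V m) :=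
    congr($(j.mapPresheaf.naturality i.op) m)
  rw [h2]
  rfl

lemma algebraMap_germ_rationalFunctions {U : Y.Opens} (y : U) (r : Γ(Y, U)) :
    algebraMap (Y.presheaf.stalk y.1) (RationalFunctions f) (Y.presheaf.germ U y.1 y.2 r) =
      algebraMap Y.functionField (RationalFunctions f)
        (Y.presheaf.germ U (genericPoint Y) (genericPoint_mem_of_mem y.2) r) := by
  rw [← algebraMap_germ_eq U y.2]
  rfl

/-- For a separable morphism, the kernel of the map given by `p ^ e`-th powers on a Frobenius
pull-back is locally killed by a non-zero function. -/
lemma exists_smul_eq_zero_of_frobLift_eq_zero (hsep : IsSeparableMorphism f)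
    (j : N ⟶ (constPredicate f Q₀).sheaf)
    (hj : ∀ U : Y.Opens, Function.Injective (j.app U))
    (hQ : ∀ (U : Y.Opens) (m : Γ(N, U)) (x : U),
      (constPredicate f Q₀).value (j.app U m) x ^ p ^ e ∈ Q x)
    {V : Y.Opens} (s : Γ((Scheme.Modules.pullback (absFrobenius hp h e)).obj N, V)) (y : V)
    (hs : (frobLift hp h e j hQ).app V s = 0) :
    ∃ (W : Y.Opens) (i : W ⟶ V) (_ : y.1 ∈ W) (r : Γ(Y, W)), r ≠ 0 ∧
      r • ((Scheme.Modules.pullback (absFrobenius hp h e)).obj N).presheaf.map i.op s = 0 := by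
  obtain ⟨W, i, hW, ι, _, a, n, hsum⟩ := exists_eq_sum_frobSection hp h e N s y
  let P₀ := constPredicate f Q₀
  let P := constPredicate f Q
  have hη : genericPoint Y ∈ W := genericPoint_mem_of_mem hW
  let φ : ι → RationalFunctions f := fun l => P₀.value (j.app W (n l)) ⟨y.1, hW⟩
  let α : ι → Y.functionField := fun l => Y.presheaf.germ W (genericPoint Y) hη (a l)
  have hrel : ∑ l, algebraMap Y.functionField (RationalFunctions f) (α l) * φ l ^ p ^ e = 0 := by
    have h1 : P.value ((frobLift hp h e j hQ).app W
        (((Scheme.Modules.pullback (absFrobenius hp h e)).obj N).presheaf.map i.op s)) ⟨y.1, hW⟩ = 0 := by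
      rw [value_app_map, hs]
      rfl
    rw [hsum, map_sum, LinearPredicate.value_sum] at h1
    rw [← h1]
    refine Finset.sum_congr rfl fun l _ => ?_
    rw [Scheme.Modules.Hom.app_smul, LinearPredicate.value_smul, value_frobLift_app_frobSection,
      Algebra.smul_def, algebraMap_germ_rationalFunctions (⟨y.1, hW⟩ : W)]
  have : Algebra.IsGeometricallyReduced Y.functionField (RationalFunctions f) := hsep
  obtain ⟨κ, _, b, c, hc, hac⟩ := exists_coeff_of_sum_mul_pow_eq_zero hp
    (natCast_functionField_eq_zero h) e α φ hrel
  -- The coefficients `c_{lk}` lie only in `K(Y)`. A common denominator `r` in the local ring at `y`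
  -- makes them regular near `y`; it is the source of the non-zero function that kills `s`.
  obtain ⟨r, hr⟩ := IsLocalization.exist_integer_multiples_of_finite
    (nonZeroDivisors (Y.presheaf.stalk y.1)) (fun li : ι × κ => c li.1 li.2)
  choose d hd using hr
  obtain ⟨W', i', hW', T, hT⟩ := exists_germ_eq_of_finite (ι := Option (ι × κ)) y.1
    (fun o => o.elim r.1 d) W hW
  have hη' : genericPoint Y ∈ W' := genericPoint_mem_of_mem hW'
  let G : Γ(Y, W') →+* Y.functionField := (Y.presheaf.germ W' (genericPoint Y) hη').hom
  have hGinj : Function.Injective G := germ_genericPoint_injective W' hη'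
  have hGr : G (T none) = algebraMap (Y.presheaf.stalk y.1) Y.functionField r.1 := by
    refine (algebraMap_germ_eq W' hW' hη' _).symm.trans ?_
    rw [hT]
    rfl
  have hGd : ∀ l k, G (T (some (l, k))) = G (T none) * c l k := fun l k => by
    rw [hGr]
    refine (algebraMap_germ_eq W' hW' hη' _).symm.trans ?_
    rw [hT, ← Algebra.smul_def]
    exact hd (l, k)
  have hGa : ∀ l, G (Y.presheaf.map i'.op (a l)) = α l := fun l =>
    Y.presheaf.germ_res_apply i' (genericPoint Y) hη' (a l)
  have hr0 : T none ≠ 0 := fun h0 => by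
    rw [h0, map_zero] at hGr
    exact nonZeroDivisors.coe_ne_zero r
      ((map_eq_zero_iff _ (IsFractionRing.injective _ Y.functionField)).mp hGr.symm)
  let n' : ι → Γ(N, W') := fun l => N.presheaf.map i'.op (n l)
  have hn' : ∀ l, P₀.value (j.app W' (n' l)) ⟨y.1, hW'⟩ = φ l := fun l => by
    simp only [n', φ, P₀]
    rw [value_app_map]
    rfl
  -- The relation between rational functions is a relation between sections of `N`, since `j` is
  -- injective on sections.
  have hlin : ∀ l, T none • n' l = ∑ k, T (some (l, k)) • n' (b k) := fun l => by
    apply hj W'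
    refine P₀.value_ext fun x => ?_
    rw [constPredicate_value_eq Q₀ _ x ⟨y.1, hW'⟩,
      constPredicate_value_eq Q₀ (j.app W' (∑ k, _)) x ⟨y.1, hW'⟩, map_sum,
      LinearPredicate.value_sum]
    simp only [Scheme.Modules.Hom.app_smul, LinearPredicate.value_smul]
    have e1 : ∀ (t : Γ(Y, W')) (z : RationalFunctions f), Y.presheaf.germ W' y.1 hW' t • z =
        algebraMap Y.functionField (RationalFunctions f) (G t) * z := fun t z => by
      rw [Algebra.smul_def, algebraMap_germ_rationalFunctions (⟨y.1, hW'⟩ : W')]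
    simp only [e1, hGd]
    change _ * P₀.value (j.app W' (n' l)) ⟨y.1, hW'⟩ =
      ∑ k, _ * P₀.value (j.app W' (n' (b k))) ⟨y.1, hW'⟩
    simp only [hn']
    rw [hc l, Finset.mul_sum]
    refine Finset.sum_congr rfl fun k _ => ?_
    rw [map_mul, mul_assoc]
  have hcoef : ∀ k, ∑ l, Y.presheaf.map i'.op (a l) * T (some (l, k)) ^ p ^ e = 0 := fun k => by
    apply hGinj
    rw [map_zero, map_sum]
    simp only [map_mul, map_pow, hGa, hGd, mul_pow]
    have := congrArg (fun z => G (T none) ^ p ^ e * z) (hac k)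
    simp only [mul_zero, Finset.mul_sum] at this
    rw [← this]
    exact Finset.sum_congr rfl fun l _ => by ring
  refine ⟨W', i' ≫ i, hW', T none ^ p ^ e, pow_ne_zero _ hr0, ?_⟩
  rw [op_comp, Functor.map_comp, ConcreteCategory.comp_apply, hsum, map_sum, Finset.smul_sum]
  simp only [Scheme.Modules.map_smul, ← frobSection_map]
  -- Multiplying a pulled back section by `r^{p^e}` is pulling back `r` times the section. After
  -- substituting `hlin`, the coefficient of each remaining section is the sum that vanishes by
  -- `hcoef`.
  have h3 : ∀ l, T none ^ p ^ e • Y.presheaf.map i'.op (a l) • frobSection hp h e N (n' l) =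
      ∑ k, (Y.presheaf.map i'.op (a l) * T (some (l, k)) ^ p ^ e) •
        frobSection hp h e N (n' (b k)) := fun l => by
    rw [smul_comm, ← frobSection_smul, hlin, map_sum, Finset.smul_sum]
    refine Finset.sum_congr rfl fun k _ => ?_
    rw [frobSection_smul, mul_smul]
  refine (Finset.sum_congr rfl fun l _ => h3 l).trans ?_
  rw [Finset.sum_comm]
  refine Finset.sum_eq_zero fun k _ => ?_
  rw [← Finset.sum_smul, hcoef, zero_smul]

/-- A torsion free subsheaf of a Frobenius pull-back of a sheaf of rational functions is embedded
into a sheaf of rational functions by `p ^ e`-th powers. -/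
lemma comp_frobLift_app_injective (hsep : IsSeparableMorphism f)
    (j : N ⟶ (constPredicate f Q₀).sheaf)
    (hj : ∀ U : Y.Opens, Function.Injective (j.app U))
    (hQ : ∀ (U : Y.Opens) (m : Γ(N, U)) (x : U),
      (constPredicate f Q₀).value (j.app U m) x ^ p ^ e ∈ Q x)
    (i : M ⟶ (Scheme.Modules.pullback (absFrobenius hp h e)).obj N) [Mono i]
    (hM : IsTorsionFree M) (U : Y.Opens) :
    Function.Injective ((i ≫ frobLift hp h e j hQ).app U) := by
  refine (injective_iff_map_eq_zero ((i ≫ frobLift hp h e j hQ).app U).hom).mpr fun m hm => ?_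
  refine Modules.eq_zero_of_locally m fun y hy => ?_
  obtain ⟨W, k, hW, r, hr, h1⟩ := exists_smul_eq_zero_of_frobLift_eq_zero hp h e hsep j hj hQ
    (i.app U m) ⟨y, hy⟩ hm
  -- The function `r` kills the image of `m` in the Frobenius pull-back, hence `m` itself because
  -- `i` is injective on sections; torsion freeness then gives `m = 0` near `y`.
  refine ⟨W, k, hW, (hM W r _ ?_).resolve_left hr⟩
  apply Modules.app_injective i W
  rw [map_zero, Scheme.Modules.Hom.app_smul, ← h1]
  congr 1
  exact congr($(i.mapPresheaf.naturality k.op) m)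

end FrobLift

/-! ### From generic global generation to a non-zero section. -/

section GlobalSection
variable {X Y : Scheme.{u}} [IsIntegral X] [IsIntegral Y] {f : X ⟶ Y} [IsDominant f]

/-- The inverse of `𝒪_{Y,y} → K(Y)` on the rational functions with regular image under a linear
functional. -/
def regularPart {v : Y} (ell : RationalFunctions f →ₗ[Y.functionField] Y.functionField)
    (Q : Submodule (Y.presheaf.stalk v) (RationalFunctions f))
    (hQ : ∀ c ∈ Q, ell c ∈ localRing v) : Q →ₗ[Y.presheaf.stalk v] Y.presheaf.stalk v :=
  (LinearEquiv.ofInjective (Algebra.linearMap (Y.presheaf.stalk v) Y.functionField)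
    (IsFractionRing.injective _ Y.functionField)).symm.toLinearMap.comp
    ((ell.restrictScalars (Y.presheaf.stalk v)).restrict (p := Q)
      (q := LinearMap.range (Algebra.linearMap (Y.presheaf.stalk v) Y.functionField)) hQ)

lemma algebraMap_regularPart {v : Y}
    (ell : RationalFunctions f →ₗ[Y.functionField] Y.functionField)
    (Q : Submodule (Y.presheaf.stalk v) (RationalFunctions f))
    (hQ : ∀ c ∈ Q, ell c ∈ localRing v) (c : Q) :
    algebraMap (Y.presheaf.stalk v) Y.functionField (regularPart ell Q hQ c) = ell c := by
  have := (LinearEquiv.ofInjective (Algebra.linearMap (Y.presheaf.stalk v) Y.functionField)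
    (IsFractionRing.injective _ Y.functionField)).apply_symm_apply
    (((ell.restrictScalars (Y.presheaf.stalk v)).restrict (p := Q)
      (q := LinearMap.range (Algebra.linearMap (Y.presheaf.stalk v) Y.functionField)) hQ) c)
  exact congrArg Subtype.val this

lemma fromSpecResidueField_apply_eq {Y : Scheme.{u}} (y : Y) (z : Spec (Y.residueField y)) :
    Y.fromSpecResidueField y z = y := by
  have : Y.fromSpecResidueField y z ∈ Set.range (Y.fromSpecResidueField y) := ⟨z, rfl⟩
  rwa [Scheme.range_fromSpecResidueField] at this

/-- If a section near `y` of a sheaf which is globally generated at `y` has, under a morphism to a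
sheaf of rational functions, non-zero residue at `y`, then some global section has non-zero image. -/
lemma exists_app_top_ne_zero {G : Y.Modules} {y : Y}
    (hG : Function.Surjective (((Scheme.Modules.pullbackPushforwardAdjunction
        (Y.fromSpecResidueField y)).unit.app G).app ⊤))
    {Q : ∀ y : Y, Submodule (Y.presheaf.stalk y) (RationalFunctions f)}
    (ψ : G ⟶ (constPredicate f Q).sheaf)
    (ell : RationalFunctions f →ₗ[Y.functionField] Y.functionField)
    (hQ : ∀ v, v = y → ∀ c ∈ Q v, ell c ∈ localRing v)
    {V : Y.Opens} (hy : y ∈ V) (t : Γ(G, V))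
    (ht : ell ((constPredicate f Q).value (ψ.app V t) ⟨y, hy⟩) = 1) :
    ∃ γ : Γ(G, ⊤), ψ.app ⊤ γ ≠ 0 := by
  let P := constPredicate f Q
  let g := Y.fromSpecResidueField y
  have hg : ∀ z, g z = y := fromSpecResidueField_apply_eq y
  -- No gluing condition is needed on the one-point scheme `Spec κ(y)`. The morphism `χ` below is
  -- the residue at `y` of the value of `ell`.
  let N := truePredicate (fun z : Spec (Y.residueField y) =>
    ((Spec (Y.residueField y)).presheaf.stalk z : Type u))
  have hmem : ∀ (U : Y.Opens) (x : (g ⁻¹ᵁ U : (Spec (Y.residueField y)).Opens))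
      (m : Γ(P.sheaf, U)), P.value m ⟨g x.1, x.2⟩ ∈ Q (g x.1) :=
    fun U x m => (P.value_pred m ⟨g x.1, x.2⟩).1
  let R (z : Spec (Y.residueField y)) : Q (g z) →ₗ[Y.presheaf.stalk (g z)] Y.presheaf.stalk (g z) :=
    regularPart ell (Q (g z)) (hQ _ (hg z))
  let χ : P.sheaf ⟶ (Scheme.Modules.pushforward g).obj N.sheaf :=
    N.homPushforward g P.sheaf
      (fun U x =>
        { toFun := fun m => g.stalkMap x.1 (R x.1 ⟨_, hmem U x m⟩)
          map_zero' := by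
            have : (⟨_, hmem U x 0⟩ : Q (g x.1)) = 0 := rfl
            rw [this, map_zero, map_zero]
          map_add' := fun m n => by
            have : (⟨_, hmem U x (m + n)⟩ : Q (g x.1)) =
              ⟨_, hmem U x m⟩ + ⟨_, hmem U x n⟩ := rfl
            rw [this, map_add, map_add] })
      (fun U V i m x => rfl)
      (fun U r m x => by
        change g.stalkMap x.1 (R x.1 ⟨_, hmem U x (r • m)⟩) =
          _ * g.stalkMap x.1 (R x.1 ⟨_, hmem U x m⟩)
        have : (⟨_, hmem U x (r • m)⟩ : Q (g x.1)) =
          Y.presheaf.germ U (g x.1) x.2 r • ⟨_, hmem U x m⟩ := rfl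
        rw [this, map_smul, smul_eq_mul, map_mul]
        congr 1
        exact Scheme.Hom.germ_stalkMap_apply g U x.1 x.2 r)
      (fun U m => trivial)
  by_contra! hc
  -- If every global section had image zero, surjectivity onto the fibre would make `ω` vanish on
  -- the whole fibre; but it sends the class of `t` to the residue of `1`.
  let ω := pullbackLift (ψ ≫ χ)
  have hω : ∀ s : Γ((Scheme.Modules.pullback g).obj G, g ⁻¹ᵁ ⊤), ω.app (g ⁻¹ᵁ ⊤) s = 0 := fun s => by
    obtain ⟨γ, rfl⟩ := hG s
    refine (pullbackLift_app_pullbackSection (ψ ≫ χ) ⊤ γ).trans ?_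
    change χ.app ⊤ (ψ.app ⊤ γ) = 0
    rw [hc, map_zero]
  -- Every point of `Spec κ(y)` maps to `y`, so the local section `t` already gives a section over
  -- the whole fibre.
  have htop : (g ⁻¹ᵁ ⊤ : (Spec (Y.residueField y)).Opens) ≤ g ⁻¹ᵁ V := fun z _ => by
    change g z ∈ V
    rw [hg z]
    exact hy
  have hω' : ω.app (g ⁻¹ᵁ V) (pullbackSection g G V t) = χ.app V (ψ.app V t) :=
    pullbackLift_app_pullbackSection (ψ ≫ χ) V t
  let z₀ : Spec (Y.residueField y) := Classical.arbitrary _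
  have hz₀ : z₀ ∈ g ⁻¹ᵁ V := htop trivial
  have h1 : N.value (ω.app (g ⁻¹ᵁ V) (pullbackSection g G V t)) ⟨z₀, hz₀⟩ = 0 := by
    have h2 : ω.app (g ⁻¹ᵁ ⊤) (((Scheme.Modules.pullback g).obj G).presheaf.map (homOfLE htop).op
        (pullbackSection g G V t)) = N.sheaf.presheaf.map (homOfLE htop).op
          (ω.app (g ⁻¹ᵁ V) (pullbackSection g G V t)) :=
      congr($(ω.mapPresheaf.naturality (homOfLE htop).op) (pullbackSection g G V t))
    rw [hω] at h2
    exact (congrArg (fun s => N.value (U := g ⁻¹ᵁ ⊤) s ⟨z₀, trivial⟩) h2).symm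
  rw [hω'] at h1
  have h3 : g.stalkMap z₀ (R z₀ ⟨_, hmem V ⟨z₀, hz₀⟩ (ψ.app V t)⟩) = 0 := h1
  have h4 : R z₀ ⟨_, hmem V ⟨z₀, hz₀⟩ (ψ.app V t)⟩ = 1 := by
    apply IsFractionRing.injective (Y.presheaf.stalk (g z₀)) Y.functionField
    rw [map_one]
    refine (algebraMap_regularPart ell _ _ _).trans ?_
    rw [← ht]
    exact congrArg ell (constPredicate_value_eq Q _ _ _)
  rw [h4, map_one] at h3
  exact one_ne_zero h3

end GlobalSection

/-! ### The sheaf `f_* 𝒪_X(D)` inside `K(X)`, and sections from Frobenius weak positivity. -/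

section StalkFamily
variable {X Y : Scheme.{u}} [IsIntegral X] [IsIntegral Y] (f : X ⟶ Y) [IsDominant f]

/-- The rational functions on `X` which are sections of `𝒪_X(Z)` along the fibre over `y`. -/
def stalkFamily (Z : CDiv X) (y : Y) : Submodule (Y.presheaf.stalk y) (RationalFunctions f) where
  carrier := {c | ∀ x : X, f x = y → (show X.functionField from c) ∈ Z.stalk x}
  zero_mem' _ _ := zero_mem _
  add_mem' ha hb x hx := add_mem (ha x hx) (hb x hx)
  smul_mem' r c hc x hx := by
    subst hx
    exact CDiv.localRing_mul_mem_stalk (functionFieldMap_mem_localRing f ⟨r, rfl⟩) (hc x rfl)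

/-- The embedding of `f_* 𝒪_X(D)` into a sheaf of rational functions. -/
def pushforwardHom (D : CDiv X) : (Scheme.Modules.pushforward f).obj D.sheaf ⟶
    (constPredicate f (stalkFamily f D)).sheaf :=
  (constPredicate f (stalkFamily f D)).hom _
    (fun U y => sectionValue (D := D) (V := f ⁻¹ᵁ U) (genericPoint_mem_preimage y.2))
    (fun _ _ _ _ _ => rfl)
    (fun U r m y => by
      refine (sectionValue_smul (D := D) (V := f ⁻¹ᵁ U) (genericPoint_mem_preimage y.2)
        (f.app U r) m).trans ?_
      change _ = functionFieldMap f (algebraMap _ _ _) * _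
      rw [algebraMap_germ_eq U y.2 (genericPoint_mem_of_mem y.2),
        functionFieldMap_germ U _ (genericPoint_mem_preimage y.2)]
      rfl)
    (fun U m => constPredicate_pred_const _ _ (fun _ _ => rfl) fun y x hx =>
      sectionValue_mem_stalk (D := D) (V := f ⁻¹ᵁ U) (genericPoint_mem_preimage y.2) m
        (by change f x ∈ U; rw [hx]; exact y.2))

lemma pushforwardHom_app_injective (D : CDiv X) (U : Y.Opens) :
    Function.Injective ((pushforwardHom f D).app U) := by
  intro s t h
  by_cases hU : ∃ y, y ∈ U
  · obtain ⟨y, hy⟩ := hU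
    exact sectionValue_injective (D := D) (V := f ⁻¹ᵁ U) (genericPoint_mem_preimage hy)
      (congrArg (fun m => (constPredicate f (stalkFamily f D)).value (U := U) m ⟨y, hy⟩) h)
  · exact Subtype.ext (funext fun x => absurd ⟨f x.1, x.2⟩ hU)

end StalkFamily

section
variable {X Y : Scheme.{u}} [IsIntegral X] [IsIntegral Y] {f : X ⟶ Y} [IsDominant f]

/-- A finite relation between germs holds between sections on a smaller neighbourhood, where `j` can
be applied. This replaces the map induced by `j` on stalks. -/
lemma value_mem_span_of_modGerm_mem_span {M : Y.Modules}
    {P : LinearPredicate (fun _ : Y => RationalFunctions f)} (j : M ⟶ P.sheaf) {W : Y.Opens}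
    {ι : Type*} [Finite ι] (m : ι → Γ(M, W)) {V : Y.Opens} (s : Γ(M, V)) {y : Y} (hy : y ∈ V)
    (hW : y ∈ W)
    (h : modGerm M ⟨y, hy⟩ s ∈ Submodule.span (Y.presheaf.stalk y)
      (Set.range fun l => (modGerm M ⟨y, hW⟩ (m l) : modStalk M y))) :
    P.value (j.app V s) ⟨y, hy⟩ ∈ Submodule.span (Y.presheaf.stalk y)
      (Set.range fun l => P.value (j.app W (m l)) ⟨y, hW⟩) := by
  have := Fintype.ofFinite ι
  obtain ⟨c, hc⟩ := (Submodule.mem_span_range_iff_exists_fun _).mp h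
  obtain ⟨W', i, hW', T, hT⟩ := exists_germ_eq_of_finite y c W hW
  have h1 : modGerm M ⟨y, hW'⟩ (∑ l, T l • M.presheaf.map i.op (m l)) = modGerm M ⟨y, hy⟩ s := by
    rw [← hc, map_sum]
    refine Finset.sum_congr rfl fun l _ => ?_
    rw [modGerm_smul, modGerm_map, hT]
    rfl
  obtain ⟨W'', hW'', a, b, hab⟩ := exists_map_eq_of_modGerm_eq M hW' hy _ _ h1
  have h2 : P.value (j.app V s) ⟨y, hy⟩ =
      P.value (j.app W' (∑ l, T l • M.presheaf.map i.op (m l))) ⟨y, hW'⟩ := by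
    have e1 := value_app_map j a (∑ l, T l • M.presheaf.map i.op (m l)) ⟨y, hW''⟩
    have e2 := value_app_map j b s ⟨y, hW''⟩
    rw [← hab] at e2
    exact e2.symm.trans e1
  rw [h2, map_sum, LinearPredicate.value_sum]
  refine Submodule.sum_mem _ fun l _ => ?_
  rw [Scheme.Modules.Hom.app_smul, LinearPredicate.value_smul, value_app_map]
  exact Submodule.smul_mem _ _ (Submodule.subset_span ⟨l, rfl⟩)

/-- Finitely many rational functions are regular on a common non-empty open set. -/
lemma exists_opens_forall_mem_localRing {ι : Type*} [Finite ι] (t : ι → Y.functionField)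
    (V : Y.Opens) (hV : genericPoint Y ∈ V) :
    ∃ W : Y.Opens, W ≤ V ∧ genericPoint Y ∈ W ∧ ∀ y ∈ W, ∀ l, t l ∈ localRing y := by
  obtain ⟨W, i, hW, T, hT⟩ := exists_germ_eq_of_finite (genericPoint Y) t V hV
  exact ⟨W, i.le, hW, fun y hy l => ⟨Y.presheaf.germ W y hy (T l),
    (algebraMap_germ_eq W hy hW (T l)).trans (hT l)⟩⟩

/-- The `p^e`-th power is additive and multiplies scalars by elements `r^{p^e}` of the same ring
`R`. -/
lemma pow_mem_span_pow {R A ι : Type*} [CommRing R] [CommRing A] [Algebra R A] {p : ℕ}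
    (hp : p.Prime) (h : (p : A) = 0) (e : ℕ) (v : ι → A) {a : A}
    (ha : a ∈ Submodule.span R (Set.range v)) :
    a ^ p ^ e ∈ Submodule.span R (Set.range fun i => v i ^ p ^ e) := by
  induction ha using Submodule.span_induction with
  | mem a ha => obtain ⟨i, rfl⟩ := ha; exact Submodule.subset_span ⟨i, rfl⟩
  | zero => rw [zero_pow (pow_ne_zero _ hp.ne_zero)]; exact zero_mem _
  | add a b _ _ ha hb => rw [add_pow_of_natCast_eq_zero hp h]; exact add_mem ha hb
  | smul r a _ ha => rw [smul_pow]; exact Submodule.smul_mem _ _ ha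

/-- A coherent sheaf embedded into a sheaf of rational functions which becomes generically globally
generated after Frobenius pull-back and twist by `E` yields a section of the twisted multiple. -/
theorem exists_mem_stalk_of_isGenericallyGloballyGenerated {p : ℕ} (hp : p.Prime)
    (h : (p : Γ(Y, ⊤)) = 0) [JacobsonSpace Y] {M : Y.Modules} (hM : IsCoherent M)
    (hM0 : ¬ Limits.IsZero M) {Z : CDiv X}
    (j : M ⟶ (constPredicate f (stalkFamily f Z)).sheaf)
    (hj : ∀ U : Y.Opens, Function.Injective (j.app U)) (e : ℕ) (E : CDiv Y)
    (hG : IsGenericallyGloballyGenerated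
      (tensor ((Scheme.Modules.pullback (absFrobenius hp h e)).obj M) E.sheaf)) :
    ∃ c : X.functionField, c ≠ 0 ∧ ∀ x, c ∈ (p ^ e • Z + CDiv.pullback f E).stalk x := by
  let P₀ := constPredicate f (stalkFamily f Z)
  obtain ⟨W, ⟨w, hw⟩, ι, _, m, hm⟩ := IsCoherent.exists_generators M hM
  have hηW : genericPoint Y ∈ W := genericPoint_mem_of_mem hw
  let v : ι → RationalFunctions f := fun l => P₀.value (j.app W (m l)) ⟨_, hηW⟩
  have hv : ∀ l (y : Y) (hy : y ∈ W), P₀.value (j.app W (m l)) ⟨y, hy⟩ = v l := fun l y hy =>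
    constPredicate_value_eq _ _ _ _
  have hspan : ∀ (U : Y.Opens) (s : Γ(M, U)) (y : Y) (hy : y ∈ U), y ∈ W →
      P₀.value (j.app U s) ⟨y, hy⟩ ∈ Submodule.span (Y.presheaf.stalk y) (Set.range v) := by
    intro U s y hy hyW
    have h1 := hm (U ⊓ W) (homOfLE inf_le_right)
      (M.presheaf.map (homOfLE inf_le_left : U ⊓ W ⟶ U).op s) ⟨y, hy, hyW⟩
    have h2 := value_mem_span_of_modGerm_mem_span j m _ (show y ∈ U ⊓ W from ⟨hy, hyW⟩) hyW h1
    rw [value_app_map] at h2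
    have h3 : (fun l => P₀.value (j.app W (m l)) ⟨y, hyW⟩) = v := funext fun l => hv l y hyW
    exact h3 ▸ h2
  -- If all generators of `M` over `W` had value zero, every section would have value zero at the
  -- generic point, and `M` would vanish since `j` is injective.
  obtain ⟨l₀, hl₀⟩ : ∃ l, v l ≠ 0 := by
    by_contra! hc
    obtain ⟨U, s, hs⟩ := Modules.exists_ne_zero hM0
    apply hs
    apply hj U
    rw [map_zero]
    refine P₀.value_ext fun x => ?_
    obtain ⟨y, hy, hyW⟩ : ∃ y, y ∈ U ∧ y ∈ W := ⟨_, genericPoint_mem_of_mem x.2, hηW⟩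
    refine (constPredicate_value_eq _ _ x ⟨y, hy⟩).trans ?_
    have h1 := hspan U s y hy hyW
    have h2 : Set.range v ⊆ {0} := by rintro _ ⟨l, rfl⟩; exact hc l
    rw [Submodule.span_eq_bot.mpr fun x hx => h2 hx] at h1
    exact h1
  obtain ⟨U, ⟨u, hu⟩, hU⟩ := hG
  obtain ⟨V, hηV, g, hg⟩ := E.exists_equation (genericPoint Y)
  obtain ⟨ell', hell'⟩ := Module.Projective.exists_dual_ne_zero Y.functionField
    (pow_ne_zero (p ^ e) hl₀)
  -- The functional is scaled so that `v_{l₀}^{p^e}` goes to the local equation `g` of `E`.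
  -- Multiplication by the local generator `g⁻¹` of `𝒪_Y(E)` then turns this value into `1`.
  let ell : RationalFunctions f →ₗ[Y.functionField] Y.functionField :=
    ((g : Y.functionField) * (ell' (v l₀ ^ p ^ e))⁻¹) • ell'
  have hell : ell (v l₀ ^ p ^ e) = g := by
    change (g : Y.functionField) * (ell' (v l₀ ^ p ^ e))⁻¹ * _ = g
    rw [mul_assoc, inv_mul_cancel₀ hell', mul_one]
  obtain ⟨O, hO, hηO, hreg⟩ := exists_opens_forall_mem_localRing
    (fun l => ell (v l ^ p ^ e) * (g : Y.functionField)⁻¹) (U ⊓ V ⊓ W)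
    ⟨⟨genericPoint_mem_of_mem hu, hηV⟩, hηW⟩
  -- Closed points are dense in open sets of a Jacobson space, so one exists where generic
  -- generation applies, `g` is an equation and the chosen values of `ell` are regular.
  obtain ⟨y, hyO, hyc⟩ : ((O : Set Y) ∩ closedPoints Y).Nonempty :=
    nonempty_inter_closedPoints ⟨_, hηO⟩ O.2.isLocallyClosed
  have hyU : y ∈ U := (hO hyO).1.1
  have hyV : y ∈ V := (hO hyO).1.2
  have hyW : y ∈ W := (hO hyO).2
  have hchar := natCast_rationalFunctions_eq_zero f h
  -- The infimum over `y' = y` is the whole module away from `y`. Thus an extra condition is imposed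
  -- only at `y`: being in the span of the powers of generators for `Q`, having regular image under
  -- `ell` for `Q'`.
  let Q : ∀ y' : Y, Submodule (Y.presheaf.stalk y') (RationalFunctions f) := fun y' =>
    stalkFamily f (p ^ e • Z) y' ⊓ ⨅ _ : y' = y,
      Submodule.span (Y.presheaf.stalk y') (Set.range fun l => v l ^ p ^ e)
  let Q' : ∀ y' : Y, Submodule (Y.presheaf.stalk y') (RationalFunctions f) := fun y' =>
    stalkFamily f (p ^ e • Z + CDiv.pullback f E) y' ⊓ ⨅ _ : y' = y,
      Submodule.comap (ell.restrictScalars (Y.presheaf.stalk y'))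
        (LinearMap.range (Algebra.linearMap (Y.presheaf.stalk y') Y.functionField))
  have hQ : ∀ (U : Y.Opens) (m : Γ(M, U)) (x : U), P₀.value (j.app U m) x ^ p ^ e ∈ Q x := by
    intro U m x
    refine ⟨fun z hz => CDiv.pow_mem_stalk ((P₀.value_pred (j.app U m) x).1 z hz) _, ?_⟩
    rw [SetLike.mem_coe, Submodule.mem_iInf]
    intro hx
    exact pow_mem_span_pow hp hchar e v (hspan U m x.1 x.2 (hx ▸ hyW))
  let P := constPredicate f Q
  let P' := constPredicate f Q'
  let Ψ := frobLift hp h e j hQ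
  have hβ : ∀ (O : Y.Opens) (μ : Γ((Scheme.Modules.pullback (absFrobenius hp h e)).obj M, O))
      (s : Γ(E.sheaf, O)), P'.pred (U := O) (fun x => P.value (Ψ.app O μ) x *
        algebraMap Y.functionField (RationalFunctions f)
          (sectionValue (genericPoint_mem_of_mem x.2) s)) := by
    intro O μ s
    refine constPredicate_pred_const _ _ (fun x x' => ?_) fun x => ⟨fun z hz => ?_, ?_⟩
    · rw [constPredicate_value_eq Q (Ψ.app O μ) x x']
    · refine CDiv.mul_mem_stalk ((P.value_pred (Ψ.app O μ) x).1.1 z hz) ?_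
      refine CDiv.functionFieldMap_mem_stalk f ?_
      rw [hz]
      exact sectionValue_mem_stalk _ s x.2
    · rw [SetLike.mem_coe, Submodule.mem_iInf]
      intro hx
      have h1 := (P.value_pred (Ψ.app O μ) x).1.2
      rw [SetLike.mem_coe, Submodule.mem_iInf] at h1
      have h2 : ∀ a ∈ Submodule.span (Y.presheaf.stalk x.1) (Set.range fun l => v l ^ p ^ e),
          ell a * (g : Y.functionField)⁻¹ ∈ localRing x.1 := by
        intro a ha
        induction ha using Submodule.span_induction with
        | mem a ha => obtain ⟨l, rfl⟩ := ha; rw [hx]; exact hreg y hyO l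
        | zero => rw [map_zero, zero_mul]; exact zero_mem _
        | add a b _ _ ha hb => rw [map_add, add_mul]; exact add_mem ha hb
        | smul r a _ ha =>
          have e1 : ell (r • a) = algebraMap _ Y.functionField r * ell a := by
            rw [← algebraMap_smul Y.functionField r a, map_smul, smul_eq_mul]
          rw [e1, mul_assoc]
          exact mul_mem ⟨r, rfl⟩ ha
      have h3 : sectionValue (genericPoint_mem_of_mem x.2) s * g ∈ localRing x.1 :=
        (CDiv.mem_stalk_iff (hg x.1 (hx ▸ hyV))).mp (sectionValue_mem_stalk _ s x.2)
      have h4 := mul_mem h3 (h2 _ (h1 hx))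
      change ell _ ∈ localRing x.1
      rw [mul_comm, ← Algebra.smul_def, map_smul, smul_eq_mul]
      convert h4 using 1
      field_simp
  -- The pairing multiplies the `p^e`-th power image of a section of `F^{e*} M` by the pull-back of
  -- a section of `𝒪_Y(E)`.
  let β : ∀ O : Y.Opens, Γ((Scheme.Modules.pullback (absFrobenius hp h e)).obj M, O) →
      Γ(E.sheaf, O) → Γ(P'.sheaf, O) := fun O μ s => (⟨_, hβ O μ s⟩ : P'.sections O)
  let χ : tensor ((Scheme.Modules.pullback (absFrobenius hp h e)).obj M) E.sheaf ⟶ P'.sheaf :=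
    tensorLift β
      (fun O μ μ' s => P'.value_ext fun x => by
        change P.value (Ψ.app O (μ + μ')) x * _ =
          P.value (Ψ.app O μ) x * _ + P.value (Ψ.app O μ') x * _
        rw [map_add, ← add_mul]
        rfl)
      (fun O μ s s' => P'.value_ext fun x => by
        change _ * algebraMap _ (RationalFunctions f) (sectionValue _ (s + s')) =
          _ * algebraMap _ (RationalFunctions f) (sectionValue _ s) +
          _ * algebraMap _ (RationalFunctions f) (sectionValue _ s')
        rw [map_add, map_add, mul_add])
      (fun O r μ s => P'.value_ext fun x => by
        change P.value (Ψ.app O (r • μ)) x * _ = _ • (P.value (Ψ.app O μ) x * _)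
        rw [Scheme.Modules.Hom.app_smul, LinearPredicate.value_smul, smul_mul_assoc])
      (fun O r μ s => P'.value_ext fun x => by
        change _ * algebraMap _ (RationalFunctions f) (sectionValue _ (r • s)) =
          Y.presheaf.germ O x.1 x.2 r •
          (_ * algebraMap _ (RationalFunctions f) (sectionValue _ s))
        rw [sectionValue_smul, map_mul, Algebra.smul_def, algebraMap_germ_rationalFunctions,
          mul_left_comm])
      (fun O O' i μ s => P'.value_ext fun x => by
        change P.value (Ψ.app O (_)) x * _ = P.value (Ψ.app O' μ) (i x) * _
        rw [value_app_map]
        rfl)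
  have hχ : ∀ (O : Y.Opens) μ s (x : O), P'.value (χ.app O (tensorSection _ _ μ s)) x =
      P.value (Ψ.app O μ) x * algebraMap Y.functionField (RationalFunctions f)
        (sectionValue (genericPoint_mem_of_mem x.2) s) := fun O μ s x =>
    congrArg (fun t => P'.value (U := O) t x) (tensorLift_app_tensorSection β _ _ _ _ _ μ s)
  let V' : Y.Opens := V ⊓ W
  have hyV' : y ∈ V' := ⟨hyV, hyW⟩
  obtain ⟨s₀, hs₀⟩ := exists_sectionValue_eq (D := E) (V := V') (genericPoint_mem_of_mem hyV')
    (c := (g : Y.functionField)⁻¹) fun x hx => by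
      rw [CDiv.mem_stalk_iff (hg x hx.1), inv_mul_cancel₀ g.ne_zero]
      exact one_mem _
  let t := tensorSection _ _ (frobSection hp h e M
    (M.presheaf.map (homOfLE inf_le_right : V' ⟶ W).op (m l₀))) s₀
  obtain ⟨γ, hγ⟩ := exists_app_top_ne_zero (hU y hyU hyc) χ ell
    (fun y' hy' c hc => (Submodule.mem_iInf _).mp hc.2 hy') hyV' t (by
      refine (congrArg ell (hχ V' _ s₀ ⟨y, hyV'⟩)).trans ?_
      rw [hs₀, value_frobLift_app_frobSection, value_app_map, mul_comm, ← Algebra.smul_def,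
        map_smul, smul_eq_mul]
      refine (congrArg (fun a => (g : Y.functionField)⁻¹ * ell (a ^ p ^ e)) (hv l₀ y hyW)).trans ?_
      rw [hell, inv_mul_cancel₀ g.ne_zero])
  let T : (⊤ : Y.Opens) := ⟨genericPoint Y, trivial⟩
  refine ⟨P'.value (χ.app ⊤ γ) T, fun h0 => hγ (P'.value_ext fun x => ?_), fun x => ?_⟩
  · exact (constPredicate_value_eq _ _ x T).trans h0
  · rw [constPredicate_value_eq _ _ T ⟨f x, trivial⟩]
    exact (P'.value_pred (χ.app ⊤ γ) ⟨f x, trivial⟩).1.1 x rfl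

/-- Sections arising from a Frobenius weakly positive subsheaf. -/
theorem IsFWP.exists_mem_stalk {p : ℕ} (hp : p.Prime) (h : (p : Γ(Y, ⊤)) = 0) [JacobsonSpace Y]
    (hsep : IsSeparableMorphism f) (D : CDiv X) (e : ℕ) {M : Y.Modules}
    (i : M ⟶ (Scheme.Modules.pullback (absFrobenius hp h e)).obj
      ((Scheme.Modules.pushforward f).obj D.sheaf)) [Mono i] (hM0 : ¬ Limits.IsZero M)
    (hM : IsCoherent M) (hM' : IsTorsionFree M) (e' : ℕ) (E : CDiv Y)
    (hG : IsGenericallyGloballyGenerated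
      (tensor ((Scheme.Modules.pullback (absFrobenius hp h e')).obj M) E.sheaf)) :
    ∃ c : X.functionField, c ≠ 0 ∧ ∀ x, c ∈ ((p ^ e' * p ^ e) • D + CDiv.pullback f E).stalk x := by
  have hQ : ∀ (U : Y.Opens) (m : Γ((Scheme.Modules.pushforward f).obj D.sheaf, U)) (x : U),
      (constPredicate f (stalkFamily f D)).value ((pushforwardHom f D).app U m) x ^ p ^ e ∈
        stalkFamily f (p ^ e • D) x := fun U m x z hz =>
    CDiv.pow_mem_stalk (((constPredicate f (stalkFamily f D)).value_pred
      ((pushforwardHom f D).app U m) x).1 z hz) _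
  -- Separability enters only through the inner power map, which must embed `M` into the sections of
  -- `p^e D`. The outer `p^{e'}`-th power need only have non-zero image.
  obtain ⟨c, hc, hc'⟩ := exists_mem_stalk_of_isGenericallyGloballyGenerated hp h hM hM0
    (i ≫ frobLift hp h e (pushforwardHom f D) hQ)
    (comp_frobLift_app_injective hp h e hsep _ (pushforwardHom_app_injective f D) hQ i hM') e' E hG
  exact ⟨c, hc, by rwa [mul_smul]⟩

end

/-! ### Algebraic independence, chains of primes and homogenisation. -/

section PrimeChains
open MvPolynomial

/-- The image of a dominant morphism of finite type contains a non-empty open set. -/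
lemma exists_ne_zero_forall_exists_comap_eq {A R : Type*} [CommRing A] [IsDomain A]
    [IsNoetherianRing A] [CommRing R] [IsDomain R] (φ : A →+* R) (hφ : Function.Injective φ)
    (hfin : φ.FiniteType) :
    ∃ b : A, b ≠ 0 ∧ ∀ q : Ideal A, q.IsPrime → b ∉ q → ∃ P : Ideal R, P.IsPrime ∧ P.comap φ = q := by
  have h1 := PrimeSpectrum.isConstructible_range_comap
    (RingHom.FinitePresentation.of_finiteType.mp hfin)
  obtain ⟨S, hS⟩ := PrimeSpectrum.exists_constructibleSetData_iff.mpr h1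
  have hbot : (⟨⊥, Ideal.isPrime_bot⟩ : PrimeSpectrum A) ∈ S.toSet := by
    rw [hS]
    refine ⟨⟨⊥, Ideal.isPrime_bot⟩, PrimeSpectrum.ext ?_⟩
    exact (RingHom.injective_iff_ker_eq_bot φ).mp hφ
  rw [PrimeSpectrum.ConstructibleSetData.toSet, Set.mem_iUnion₂] at hbot
  obtain ⟨C, hC, hC1, hC2⟩ := hbot
  -- By Chevalley the image is constructible. The piece containing the zero ideal has only the zero
  -- closed condition, so it contains the basic open set of its remaining function.
  refine ⟨C.f, fun h0 => hC2 (by simp [h0]), fun q hq hb => ?_⟩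
  have h2 : (⟨q, hq⟩ : PrimeSpectrum A) ∈ S.toSet := by
    rw [PrimeSpectrum.ConstructibleSetData.toSet, Set.mem_iUnion₂]
    refine ⟨C, hC, ?_, by simpa [PrimeSpectrum.mem_zeroLocus] using hb⟩
    rw [PrimeSpectrum.mem_zeroLocus] at hC1 ⊢
    exact hC1.trans fun x hx => by
      have : x = 0 := hx
      rw [this]
      exact zero_mem _
  rw [hS] at h2
  obtain ⟨P, hP⟩ := h2
  exact ⟨P.asIdeal, P.2, congrArg PrimeSpectrum.asIdeal hP⟩

/-- Viewed as a polynomial in the first variable over a domain, `b` has only finitely many roots,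
whereas `k` supplies infinitely many constants. -/
lemma exists_aeval_cons_ne_zero {k : Type*} [Field k] [Infinite k] {r : ℕ}
    {b : MvPolynomial (Fin (r + 1)) k} (hb : b ≠ 0) :
    ∃ c : k, aeval (Fin.cons (C c) X : Fin (r + 1) → MvPolynomial (Fin r) k) b ≠ 0 := by
  by_contra! hc
  apply hb
  apply (finSuccEquiv k r).injective
  rw [map_zero]
  have key : ∀ c : k, (aeval (Fin.cons (C c) X : Fin (r + 1) → MvPolynomial (Fin r) k)) =
      ((Polynomial.aeval (R := MvPolynomial (Fin r) k) (C c)).restrictScalars k).comp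
        (finSuccEquiv k r).toAlgHom := fun c => by
    refine MvPolynomial.algHom_ext fun i => ?_
    refine Fin.cases ?_ (fun i => ?_) i
    · simp [finSuccEquiv_X_zero]
    · simp [finSuccEquiv_X_succ]
  refine Polynomial.eq_zero_of_infinite_isRoot _ (Set.Infinite.mono (s := Set.range (C : k → _)) ?_ ?_)
  · rintro _ ⟨c, rfl⟩
    have := hc c
    rw [key] at this
    simpa [Polynomial.IsRoot, Polynomial.aeval_def, Polynomial.eval₂_eq_eval_map] using this
  · exact Set.infinite_range_of_injective (C_injective _ _)

/-- In a finitely generated domain over an infinite field, algebraically independent elements have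
translates that vanish one by one along a chain of prime ideals. -/
theorem exists_chain_of_algebraicIndependent {k : Type*} [Field k] [Infinite k] (r : ℕ) :
    ∀ {R : Type u} [CommRing R] [IsDomain R] [Algebra k R] [Algebra.FiniteType k R]
      (x : Fin r → R), AlgebraicIndependent k x →
      ∃ (c : Fin r → k) (P : Fin (r + 1) → Ideal R), (∀ i, (P i).IsPrime) ∧ Monotone P ∧
        ∀ i : Fin r, x i - algebraMap k R (c i) ∈ P i.succ ∧
          x i - algebraMap k R (c i) ∉ P i.castSucc := by
  induction r with
  | zero =>
    intro R _ _ _ _ x _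
    exact ⟨Fin.elim0, fun _ => ⊥, fun _ => Ideal.isPrime_bot, monotone_const, fun i => i.elim0⟩
  | succ r ih =>
    intro R _ _ _ _ x hx
    have hft : (aeval x : MvPolynomial (Fin (r + 1)) k →ₐ[k] R).toRingHom.FiniteType := by
      have h1 : (algebraMap k R).FiniteType := (RingHom.finiteType_algebraMap).mpr inferInstance
      refine RingHom.FiniteType.of_comp_finiteType (f := (C : k →+* MvPolynomial (Fin (r + 1)) k)) ?_
      convert h1
      ext a
      simp
    obtain ⟨b, hb0, hb⟩ := exists_ne_zero_forall_exists_comap_eq _ hx hft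
    obtain ⟨c, hc⟩ := exists_aeval_cons_ne_zero hb0
    let ev := aeval (R := k) (Fin.cons (C c) X : Fin (r + 1) → MvPolynomial (Fin r) k)
    -- The prime `(X_0 - c)` of the polynomial ring avoids `b`, hence lifts to a prime `P₁` of `R`.
    -- Modulo `P₁` the remaining elements stay independent, and the induction applies to `R ⧸ P₁`.
    obtain ⟨P₁, hP₁, hcomap⟩ := hb (RingHom.ker ev.toRingHom) (RingHom.ker_isPrime _) hc
    have hmem : ∀ G, aeval x G ∈ P₁ ↔ ev G = 0 := fun G => by
      change G ∈ P₁.comap (aeval x : MvPolynomial (Fin (r + 1)) k →ₐ[k] R).toRingHom ↔ _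
      rw [hcomap]
      rfl
    have hx' : AlgebraicIndependent k fun i : Fin r => Ideal.Quotient.mk P₁ (x i.succ) := by
      rw [algebraicIndependent_iff]
      intro G hG
      have h1 : aeval (fun i : Fin r => Ideal.Quotient.mk P₁ (x i.succ)) G =
          Ideal.Quotient.mkₐ k P₁ (aeval x (rename Fin.succ G)) := by
        rw [aeval_rename, ← AlgHom.comp_apply, comp_aeval]
        rfl
      rw [h1, Ideal.Quotient.mkₐ_eq_mk, Ideal.Quotient.eq_zero_iff_mem, hmem] at hG
      rw [← hG, aeval_rename]
      change G = aeval X G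
      simp
    obtain ⟨c', P', hP', hmono, h'⟩ := ih _ hx'
    have hx0 : x 0 - algebraMap k R c ≠ 0 := fun h0 => by
      have h1 : aeval x (X 0 - C c : MvPolynomial (Fin (r + 1)) k) = 0 := by simpa using h0
      have h2 := hx (a₁ := X 0 - C c) (a₂ := 0) (by rw [h1, map_zero])
      have h3 := congrArg (fun q => MvPolynomial.eval (fun _ => c + 1) q) h2
      simp at h3
    refine ⟨Fin.cons c c', Fin.cons ⊥ fun i => (P' i).comap (Ideal.Quotient.mk P₁),
      fun i => ?_, ?_, fun i => ?_⟩
    · induction i using Fin.cases with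
      | zero => exact Ideal.isPrime_bot
      | succ i =>
        have := hP' i
        exact Ideal.comap_isPrime (Ideal.Quotient.mk P₁) (P' i)
    · intro i j hij
      induction i using Fin.cases with
      | zero => exact bot_le
      | succ i =>
        induction j using Fin.cases with
        | zero => exact absurd hij (by simp)
        | succ j => exact Ideal.comap_mono (hmono (Fin.succ_le_succ_iff.mp hij))
    · induction i using Fin.cases with
      | zero =>
        refine ⟨?_, hx0⟩
        have h1 : x 0 - algebraMap k R c ∈ P₁ := by
          have := (hmem (X 0 - C c)).mpr (by simp [ev])
          simpa using this
        change Ideal.Quotient.mk P₁ (x 0 - algebraMap k R c) ∈ P' 0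
        rw [Ideal.Quotient.eq_zero_iff_mem.mpr h1]
        exact zero_mem _
      | succ i =>
        refine ⟨(h' i).1, ?_⟩
        rw [← Fin.succ_castSucc]
        exact (h' i).right

/-- Dehomogenisation with respect to `T_a`, uniformly in all field valued points. -/
lemma exists_homogeneous_of_mvPolynomial {F : Type*} [Field F] {σ ι : Type*} (a : σ)
    (f : ι → MvPolynomial σ F) (n : ι → ℕ) (hf : ∀ i, (f i).IsHomogeneous (n i))
    (G : MvPolynomial ι F) :
    ∃ (N : ℕ) (H : MvPolynomial σ F), 0 < N ∧ H.IsHomogeneous N ∧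
      ∀ (L : Type u) [Field L] (ψ : F →+* L) (s : σ → L), s a ≠ 0 →
        eval₂ ψ s H = s a ^ N * eval₂ ψ (fun i => eval₂ ψ s (f i) / s a ^ n i) G := by
  induction G using MvPolynomial.induction_on with
  | C c =>
    -- A constant is homogenised in degree one, because membership in basic open sets of `Proj` is
    -- tested in positive degree.
    refine ⟨1, C c * X a, one_pos, ?_, fun L _ ψ s hs => ?_⟩
    · simpa using (isHomogeneous_C σ c).mul (isHomogeneous_X F a)
    · simp [mul_comm]
  | add G₁ G₂ h₁ h₂ =>
    obtain ⟨N₁, H₁, hN₁, hH₁, e₁⟩ := h₁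
    obtain ⟨N₂, H₂, hN₂, hH₂, e₂⟩ := h₂
    refine ⟨N₁ + N₂, H₁ * X a ^ N₂ + X a ^ N₁ * H₂, by omega, ?_, fun L _ ψ s hs => ?_⟩
    · exact (hH₁.mul (isHomogeneous_X_pow a N₂)).add ((isHomogeneous_X_pow a N₁).mul hH₂)
    · simp only [eval₂_add, eval₂_mul, eval₂_pow, eval₂_X, e₁ L ψ s hs, e₂ L ψ s hs]
      ring
  | mul_X G i h =>
    obtain ⟨N, H, hN, hH, e⟩ := h
    refine ⟨N + n i, H * f i, by omega, hH.mul (hf i), fun L _ ψ s hs => ?_⟩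
    simp only [eval₂_mul, eval₂_X, e L ψ s hs]
    field_simp
    ring

end PrimeChains

section Topology

/-- The dimension of a sober space in terms of chains of specialisations. -/
lemma le_topologicalKrullDim_iff {α : Type*} [TopologicalSpace α] [QuasiSober α] {n : ℕ} :
    (n : WithBot ℕ∞) ≤ topologicalKrullDim α ↔
      ∃ q : Fin (n + 1) → α, ∀ i : Fin n, q i.castSucc ⤳ q i.succ ∧ ¬ q i.succ ⤳ q i.castSucc := by
  rw [topologicalKrullDim, Order.le_krullDim_iff]
  constructor
  · rintro ⟨l, rfl⟩
    -- Irreducible closed sets increase along the chain while points specialise downwards, hence the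
    -- reversed index.
    refine ⟨fun i => (l i.rev).isIrreducible.genericPoint, fun i => ?_⟩
    have hlt : l i.succ.rev < l i.castSucc.rev := l.strictMono (by simp [Fin.rev_lt_rev])
    simp only [specializes_iff_closure_subset,
      IsIrreducible.closure_genericPoint _ (IrreducibleCloseds.isClosed _)]
    exact hlt
  · rintro ⟨q, hq⟩
    refine ⟨LTSeries.mk n (fun i => ⟨closure {q i.rev}, isIrreducible_singleton.closure,
      isClosed_closure⟩) (Fin.strictMono_iff_lt_succ.mpr fun i => ?_), rfl⟩
    have h := hq i.rev
    rw [Fin.rev_castSucc, Fin.rev_succ]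
    rw [specializes_iff_closure_subset, specializes_iff_closure_subset] at h
    exact h

end Topology

section Algebra
open MvPolynomial

/-- A chain of primes of maximal length in a polynomial ring starts at zero. -/
lemma eq_bot_of_chain {F : Type*} [Field F] {n : ℕ} (P : Fin (n + 1) → Ideal (MvPolynomial (Fin n) F))
    (hP : ∀ i, (P i).IsPrime) (h : ∀ i : Fin n, P i.castSucc < P i.succ) : P 0 = ⊥ := by
  by_contra h0
  let Q : Fin (n + 2) → PrimeSpectrum (MvPolynomial (Fin n) F) :=
    Fin.cons ⟨⊥, Ideal.isPrime_bot⟩ fun i => ⟨P i, hP i⟩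
  have hQ : StrictMono Q := Fin.strictMono_iff_lt_succ.mpr fun i => by
    induction i using Fin.cases with
    | zero => exact (bot_lt_iff_ne_bot.mpr h0 : (⊥ : Ideal (MvPolynomial (Fin n) F)) < P 0)
    | succ i => exact h i
  have h1 : ((n + 1 : ℕ) : WithBot ℕ∞) ≤ ringKrullDim (MvPolynomial (Fin n) F) :=
    Order.le_krullDim_iff.mpr ⟨LTSeries.mk (n + 1) Q hQ, rfl⟩
  rw [MvPolynomial.ringKrullDim_of_isNoetherianRing, ringKrullDim_eq_zero_of_field, zero_add,
    Nat.card_eq_fintype_card, Fintype.card_fin] at h1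
  have h2 : n + 1 ≤ n := by exact_mod_cast h1
  omega

end Algebra

/-! ### Algebraically independent ratios from the dimension of the image. -/

section LinearSystem
attribute [local instance] MvPolynomial.gradedAlgebra
variable {X : Scheme.{u}} [IsIntegral X] {F : Type u} [Field F] (π : X ⟶ Spec (.of F))

lemma baseFieldMap_mem_localRing (x : X) (c : F) : baseFieldMap π c ∈ localRing x :=
  ⟨_, (baseFieldMap_eq π x c).symm⟩

lemma H0Basis_mem_stalk (E : CDiv X) (i : H0Index π E) (x : X) : H0Basis π E i ∈ E.stalk x :=
  letI := functionFieldAlgebra π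
  (Module.Basis.ofVectorSpace F (H0 π E) i : H0 π E).2 x

/-- Homogeneous polynomials of degree `n` in sections of `E` are sections of `n E`. -/
lemma eval₂_mem_stalk {σ : Type*} {E : CDiv X} {s : σ → X.functionField} {x : X}
    (hs : ∀ i, s i ∈ E.stalk x) {n : ℕ} {f : MvPolynomial σ F} (hf : f.IsHomogeneous n) :
    MvPolynomial.eval₂ (baseFieldMap π) s f ∈ (n • E).stalk x := by
  rw [MvPolynomial.eval₂_eq]
  refine Submodule.sum_mem _ fun d hd => ?_
  refine CDiv.localRing_mul_mem_stalk (baseFieldMap_mem_localRing π x _) ?_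
  have h1 := CDiv.prod_mem_stalk d.support (D := fun i => d i • E) (φ := fun i => s i ^ d i)
    fun i _ => CDiv.pow_mem_stalk (hs i) _
  rw [← Finset.sum_smul] at h1
  have h2 : ∑ i ∈ d.support, d i = n := by
    have := hf (MvPolynomial.mem_support_iff.mp hd)
    simpa [Finsupp.weight_apply, Finsupp.sum] using this
  rwa [h2] at h1

/-- The point `Φ_{|E|}(η)`. -/
def linearSystemPoint (E : CDiv X) (h : H0 π E ≠ ⊥) :
    Proj (MvPolynomial.homogeneousSubmodule (H0Index π E) F) :=
  linearSystemMap π E h (⊥ : PrimeSpectrum X.functionField)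

lemma range_linearSystemMap (E : CDiv X) (h : H0 π E ≠ ⊥) :
    Set.range (linearSystemMap π E h) = {linearSystemPoint π E h} := by
  have : ∀ z : Spec X.functionField, z = (⊥ : PrimeSpectrum X.functionField) := fun z =>
    PrimeSpectrum.ext (@Ideal.eq_bot_of_prime _ _ z.asIdeal z.2)
  ext y
  constructor
  · rintro ⟨z, rfl⟩
    rw [this z]
    rfl
  · rintro rfl
    exact ⟨_, rfl⟩

/-- The positive degree part of the homogeneous ideal of this point consists of the relations
between the basis sections, so geometry in `Proj` becomes identities in `K(X)`. -/
lemma linearSystemPoint_mem_basicOpen_iff (E : CDiv X) (h : H0 π E ≠ ⊥) {n : ℕ} (hn : 0 < n)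
    {r : MvPolynomial (H0Index π E) F} (hr : r.IsHomogeneous n) :
    linearSystemPoint π E h ∈ Proj.basicOpen (MvPolynomial.homogeneousSubmodule (H0Index π E) F) r ↔
      MvPolynomial.eval₂ (baseFieldMap π) (H0Basis π E) r ≠ 0 := by
  have h1 := Proj.fromOfGlobalSections_preimage_basicOpen
    (MvPolynomial.homogeneousSubmodule (H0Index π E) F) (linearSystemRingHom π E)
    (map_irrelevant_linearSystemRingHom π E h) hn hr
  have h2 : linearSystemPoint π E h ∈
      Proj.basicOpen (MvPolynomial.homogeneousSubmodule (H0Index π E) F) r ↔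
      (⊥ : PrimeSpectrum X.functionField) ∈
        (Spec X.functionField).basicOpen (linearSystemRingHom π E r) := by
    rw [← h1]
    rfl
  rw [h2]
  have h3 : linearSystemRingHom π E r = (Scheme.ΓSpecIso X.functionField).inv
      (MvPolynomial.eval₂ (baseFieldMap π) (H0Basis π E) r) := rfl
  rw [h3, basicOpen_eq_of_affine]
  exact Iff.rfl

/-- A relevant homogeneous prime of a polynomial ring misses a variable. -/
lemma exists_X_notMem {σ : Type*} (q : Proj (MvPolynomial.homogeneousSubmodule σ F)) :
    ∃ a, (MvPolynomial.X a : MvPolynomial σ F) ∉ q.asHomogeneousIdeal.toIdeal := by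
  by_contra! hc
  refine q.not_irrelevant_le fun r hr => ?_
  rw [HomogeneousIdeal.mem_irrelevant_iff] at hr
  change r ∈ q.asHomogeneousIdeal.toIdeal
  rw [MvPolynomial.as_sum r]
  refine Ideal.sum_mem _ fun d hd => ?_
  have hd0 : d ≠ 0 := by
    rintro rfl
    rw [MvPolynomial.mem_support_iff] at hd
    apply hd
    have h1 : MvPolynomial.coeff 0 (GradedRing.proj
        (MvPolynomial.homogeneousSubmodule σ F) 0 r) = MvPolynomial.coeff 0 r := by
      change MvPolynomial.coeff 0 (MvPolynomial.decomposition.decompose' r 0 : MvPolynomial σ F) = _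
      rw [MvPolynomial.decomposition.decompose'_apply, MvPolynomial.coeff_homogeneousComponent]
      simp
    rw [← h1, hr, MvPolynomial.coeff_zero]
  obtain ⟨a, ha⟩ := Finsupp.ne_iff.mp hd0
  have : (MvPolynomial.X a : MvPolynomial σ F) ∣ MvPolynomial.monomial d (MvPolynomial.coeff d r) := by
    rw [MvPolynomial.X_dvd_monomial]
    exact Or.inr ha
  exact Ideal.mem_of_dvd _ this (hc a)

lemma le_iff_specializes {σ : Type*} {q q' : Proj (MvPolynomial.homogeneousSubmodule σ F)} :
    q'.asHomogeneousIdeal.toIdeal ≤ q.asHomogeneousIdeal.toIdeal ↔ q' ⤳ q := by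
  rw [specializes_iff_mem_closure]
  exact ProjectiveSpectrum.le_iff_mem_closure _ _ _

/-- The failure of a specialisation in `Proj` is witnessed by a homogeneous element. -/
lemma exists_homogeneous_of_not_specializes {σ : Type*}
    {q q' : Proj (MvPolynomial.homogeneousSubmodule σ F)} (h : ¬ q' ⤳ q) :
    ∃ (n : ℕ) (r : MvPolynomial σ F), r.IsHomogeneous n ∧
      r ∈ q'.asHomogeneousIdeal.toIdeal ∧ r ∉ q.asHomogeneousIdeal.toIdeal := by
  rw [← le_iff_specializes, SetLike.not_le_iff_exists] at h
  obtain ⟨r, hr', hr⟩ := h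
  by_contra! hc
  apply hr
  rw [← MvPolynomial.sum_homogeneousComponent r]
  refine Ideal.sum_mem _ fun n _ => hc n _ (MvPolynomial.homogeneousComponent_isHomogeneous n r) ?_
  have h1 := q'.asHomogeneousIdeal.isHomogeneous n hr'
  have h2 : (DirectSum.decompose (MvPolynomial.homogeneousSubmodule σ F) r n : MvPolynomial σ F) =
      MvPolynomial.homogeneousComponent n r := MvPolynomial.decomposition.decompose'_apply r n
  rwa [h2] at h1

/-- A linear system with image of dimension at least `n` has `n` algebraically independent ratios of
sections of a multiple. -/
theorem exists_algebraicIndependent_of_le_dim (E : CDiv X) (h : H0 π E ≠ ⊥) (n : ℕ)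
    (hn : (n : WithBot ℕ∞) ≤ dimLinearSystemImage π E h) :
    letI := functionFieldAlgebra π
    ∃ z : Fin n → X.functionField, AlgebraicIndependent F z ∧ ∃ N : ℕ, 0 < N ∧
      ∃ σ : X.functionField, σ ≠ 0 ∧ (∀ x, σ ∈ (N • E).stalk x) ∧
        ∀ i x, z i * σ ∈ (N • E).stalk x := by
  let _ := functionFieldAlgebra π
  let 𝒜 := MvPolynomial.homogeneousSubmodule (H0Index π E) F
  let ξ := linearSystemPoint π E h
  have hC : IsClosed (closure (Set.range (linearSystemMap π E h))) := isClosed_closure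
  have : QuasiSober (closure (Set.range (linearSystemMap π E h))) :=
    hC.isClosedEmbedding_subtypeVal.quasiSober
  obtain ⟨q', hq'⟩ := le_topologicalKrullDim_iff.mp hn
  let q : Fin (n + 1) → Proj 𝒜 := fun i => (q' i).1
  have hq : ∀ i : Fin n, q i.castSucc ⤳ q i.succ ∧ ¬ q i.succ ⤳ q i.castSucc := fun i => by
    rw [← subtype_specializes_iff, ← subtype_specializes_iff]
    exact hq' i
  have hξ : ∀ i, ξ ⤳ q i := fun i => by
    rw [specializes_iff_mem_closure, ← range_linearSystemMap]
    exact (q' i).2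
  have hmono : ∀ i, q i ⤳ q (Fin.last n) := fun i => by
    induction i using Fin.reverseInduction with
    | last => exact specializes_rfl
    | cast i ih => exact (hq i).1.trans ih
  -- A coordinate that does not vanish at the most special point vanishes at no point of the chain,
  -- so the whole chain lies in one affine chart.
  obtain ⟨a, ha⟩ := exists_X_notMem (q (Fin.last n))
  have ha' : ∀ i, (MvPolynomial.X a : MvPolynomial (H0Index π E) F) ∉
      (q i).asHomogeneousIdeal.toIdeal := fun i hi => ha (le_iff_specializes.mpr (hmono i) hi)
  have hφ : ∀ (N : ℕ) (H : MvPolynomial (H0Index π E) F), 0 < N → H.IsHomogeneous N →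
      MvPolynomial.eval₂ (baseFieldMap π) (H0Basis π E) H = 0 →
      ∀ i, H ∈ (q i).asHomogeneousIdeal.toIdeal := by
    intro N H hN hH h0 i
    by_contra hc
    have h1 : q i ∈ Proj.basicOpen 𝒜 H := hc
    have h2 := (hξ i).mem_open (Proj.basicOpen 𝒜 H).2 h1
    exact (linearSystemPoint_mem_basicOpen_iff π E h hN hH).mp h2 h0
  let s := H0Basis π E
  have hsa : s a ≠ 0 := fun h0 => by
    refine ha (hφ 1 (MvPolynomial.X a) one_pos (MvPolynomial.isHomogeneous_X F a) ?_ _)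
    rw [MvPolynomial.eval₂_X]
    exact h0
  choose d f hfd hf hf' using fun i => exists_homogeneous_of_not_specializes (hq i).2
  let z : Fin n → X.functionField := fun i =>
    MvPolynomial.eval₂ (baseFieldMap π) s (f i) / s a ^ d i
  -- The power `s_a^{∑ d_i}` is a common denominator of the ratios; the extra `1` keeps the multiple
  -- positive when `n = 0`.
  refine ⟨z, ?_, 1 + ∑ i, d i, by omega, s a ^ (1 + ∑ i, d i), pow_ne_zero _ hsa, fun x =>
    CDiv.pow_mem_stalk (H0Basis_mem_stalk π E a x) _, fun i x => ?_⟩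
  · rw [algebraicIndependent_iff]
    intro G hG
    obtain ⟨N, H, hN, hH, hHG⟩ := exists_homogeneous_of_mvPolynomial.{u} a f d hfd G
    have h0 : MvPolynomial.eval₂ (baseFieldMap π) s H = 0 := by
      rw [hHG X.functionField (baseFieldMap π) s hsa]
      change _ * MvPolynomial.aeval z G = 0
      rw [hG, mul_zero]
    have hprime : ∀ i, (q i).asHomogeneousIdeal.toIdeal.IsPrime := fun i => (q i).isPrime
    -- Evaluating the dehomogenised `f_j` at each `q_i` gives `n + 1` primes of a polynomial ring in
    -- `n` variables. They increase strictly, since `f_i` vanishes at `q_{i+1}` but not at `q_i`, so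
    -- the first is zero; it contains every relation between the `z_i`.
    let L (i : Fin (n + 1)) := FractionRing (MvPolynomial (H0Index π E) F ⧸
      (q i).asHomogeneousIdeal.toIdeal)
    let ψ (i : Fin (n + 1)) : MvPolynomial (H0Index π E) F →+* L i :=
      (algebraMap (MvPolynomial (H0Index π E) F ⧸ (q i).asHomogeneousIdeal.toIdeal) (L i)).comp
        (Ideal.Quotient.mk _)
    have hψ : ∀ i r, ψ i r = 0 ↔ r ∈ (q i).asHomogeneousIdeal.toIdeal := fun i r => by
      rw [RingHom.comp_apply, map_eq_zero_iff _ (IsFractionRing.injective _ (L i)),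
        Ideal.Quotient.eq_zero_iff_mem]
    have hψ' : ∀ i r, MvPolynomial.eval₂ ((ψ i).comp MvPolynomial.C)
        (fun j => ψ i (MvPolynomial.X j)) r = ψ i r := fun i r =>
      (MvPolynomial.eval₂_comp_left (ψ i) MvPolynomial.C MvPolynomial.X r).symm.trans (by simp)
    let w (i : Fin (n + 1)) (j : Fin n) : L i := ψ i (f j) / ψ i (MvPolynomial.X a) ^ d j
    let χ (i : Fin (n + 1)) : MvPolynomial (Fin n) F →+* L i :=
      MvPolynomial.eval₂Hom ((ψ i).comp MvPolynomial.C) (w i)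
    have hψa : ∀ i, ψ i (MvPolynomial.X a) ≠ 0 := fun i => (hψ i _).not.mpr (ha' i)
    have hχ : ∀ (G' : MvPolynomial (Fin n) F), ∃ H', (∀ i, χ i G' = 0 ↔
        H' ∈ (q i).asHomogeneousIdeal.toIdeal) ∧ (MvPolynomial.aeval z G' = 0 →
          ∀ i, H' ∈ (q i).asHomogeneousIdeal.toIdeal) := by
      intro G'
      obtain ⟨N, H, hN, hH, hHG⟩ := exists_homogeneous_of_mvPolynomial.{u} a f d hfd G'
      refine ⟨H, fun i => ?_, fun h0 => hφ N H hN hH ?_⟩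
      · have h1 := hHG (L i) ((ψ i).comp MvPolynomial.C) (fun j => ψ i (MvPolynomial.X j)) (hψa i)
        simp only [hψ'] at h1
        rw [← hψ, h1]
        change _ ↔ _ * χ i G' = 0
        rw [mul_eq_zero, or_iff_right (pow_ne_zero _ (hψa i))]
      · rw [hHG X.functionField (baseFieldMap π) s hsa]
        change _ * MvPolynomial.aeval z G' = 0
        rw [h0, mul_zero]
    have hbot := eq_bot_of_chain (fun i => RingHom.ker (χ i)) (fun i => RingHom.ker_isPrime _)
      fun i => by
        refine lt_of_le_of_ne (fun G' hG' => ?_) fun heq => ?_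
        · obtain ⟨H', h1, -⟩ := hχ G'
          exact (h1 _).mpr (le_iff_specializes.mpr (hq i).1 ((h1 _).mp hG'))
        · have h1 : (MvPolynomial.X i : MvPolynomial (Fin n) F) ∈ RingHom.ker (χ i.succ) := by
            simp only [RingHom.mem_ker, χ, MvPolynomial.eval₂Hom_X', w]
            rw [(hψ i.succ (f i)).mpr (hf i), zero_div]
          rw [← heq] at h1
          simp only [RingHom.mem_ker, χ, MvPolynomial.eval₂Hom_X', w] at h1
          rcases div_eq_zero_iff.mp h1 with h2 | h2
          · exact hf' i ((hψ _ _).mp h2)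
          · exact pow_ne_zero _ (hψa _) h2
    obtain ⟨H', h1, h2⟩ := hχ G
    have : G ∈ RingHom.ker (χ 0) := (h1 0).mpr (h2 hG 0)
    rw [hbot] at this
    exact this
  · have hle : d i ≤ ∑ i, d i := Finset.single_le_sum (fun _ _ => Nat.zero_le _) (Finset.mem_univ i)
    have h1 : z i * s a ^ (1 + ∑ i, d i) = MvPolynomial.eval₂ (baseFieldMap π) s (f i) *
        s a ^ (1 + ∑ i, d i - d i) := by
      rw [← pow_sub_mul_pow (s a) (show d i ≤ 1 + ∑ i, d i by omega)]
      simp only [z]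
      field_simp
    rw [h1]
    have h2 := CDiv.mul_mem_stalk (eval₂_mem_stalk π (fun j => H0Basis_mem_stalk π E j x) (hfd i))
      (CDiv.pow_mem_stalk (H0Basis_mem_stalk π E a x) (1 + ∑ i, d i - d i))
    rwa [← add_smul, Nat.add_sub_cancel' (by omega)] at h2

end LinearSystem

/-! ### Dimension bounds from algebraically independent functions and ratios. -/

section Gluing
variable {X : Scheme.{u}} [IsIntegral X]

/-- A rational function which is regular at all points of `U` is a section over `U`. -/
lemma exists_germ_eq_of_forall_mem_localRing {U : X.Opens} (hU : genericPoint X ∈ U)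
    {c : X.functionField} (hc : ∀ x ∈ U, c ∈ localRing x) :
    ∃ s : Γ(X, U), X.presheaf.germ U (genericPoint X) hU s = c := by
  have h1 : ∀ x : U, ∃ (W : X.Opens) (_ : W ⟶ U) (_ : x.1 ∈ W) (t : Γ(X, W)),
      ∀ hη, X.presheaf.germ W (genericPoint X) hη t = c := fun x => by
    obtain ⟨a, ha⟩ := hc x.1 x.2
    obtain ⟨W, i, hW, T, hT⟩ := exists_germ_eq_of_finite (ι := Unit) x.1 (fun _ => a) U x.2
    refine ⟨W, i, hW, T (), fun hη => ?_⟩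
    rw [← algebraMap_germ_eq W hW hη, hT, ha]
  choose W i hW t ht using h1
  obtain ⟨s, hs, -⟩ := TopCat.Sheaf.existsUnique_gluing' X.sheaf W U i
    (fun x hx => Opens.mem_iSup.mpr ⟨⟨x, hx⟩, hW _⟩) t (fun x y => by
      have hη : genericPoint X ∈ W x ⊓ W y :=
        ⟨genericPoint_mem_of_mem (hW x), genericPoint_mem_of_mem (hW y)⟩
      apply germ_genericPoint_injective _ hη
      refine (X.presheaf.germ_res_apply (homOfLE inf_le_left) _ hη (t x)).trans ?_
      refine Eq.trans ?_ (X.presheaf.germ_res_apply (homOfLE inf_le_right) _ hη (t y)).symm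
      rw [ht, ht])
  refine ⟨s, ?_⟩
  have hη : genericPoint X ∈ W ⟨_, hU⟩ := hW _
  rw [← ht ⟨_, hU⟩ hη, ← hs ⟨_, hU⟩]
  exact (X.presheaf.germ_res_apply (i ⟨_, hU⟩) _ hη s).symm

lemma germ_mem_localRing {U : X.Opens} {x : X} (hx : x ∈ U) (hU : genericPoint X ∈ U) (s : Γ(X, U)) :
    X.presheaf.germ U (genericPoint X) hU s ∈ localRing x :=
  ⟨_, algebraMap_germ_eq U hx hU s⟩

lemma exists_isAffineOpen_forall_mem_localRing {ι : Type*} [Finite ι] (t : ι → X.functionField)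
    (V : X.Opens) (hV : genericPoint X ∈ V) :
    ∃ W : X.Opens, IsAffineOpen W ∧ W ≤ V ∧ genericPoint X ∈ W ∧
      ∀ x ∈ W, ∀ l, t l ∈ localRing x := by
  obtain ⟨W, hWV, hW, h⟩ := exists_opens_forall_mem_localRing t V hV
  obtain ⟨W', hW', hη, hle⟩ := exists_isAffineOpen_mem_and_subset hW
  exact ⟨W', hW', hle.trans hWV, hη, fun x hx => h x (hle hx)⟩

end Gluing

section FiniteType
variable {X : Scheme.{u}} {k : Type u} [Field k] (π : X ⟶ Spec (.of k))

/-- The structure map `k → Γ(X, U)`. -/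
def baseSectionMap (U : X.Opens) : k →+* Γ(X, U) :=
  ((Scheme.ΓSpecIso (.of k)).inv ≫ π.appLE ⊤ U le_top).hom

lemma germ_baseSectionMap [IsIntegral X] {U : X.Opens} (hU : genericPoint X ∈ U) (c : k) :
    X.presheaf.germ U (genericPoint X) hU (baseSectionMap π U c) = baseFieldMap π c := by
  change X.presheaf.germ U (genericPoint X) hU (π.appLE ⊤ U le_top _) = _
  exact X.presheaf.germ_res_apply (homOfLE le_top) _ hU _

lemma finiteType_baseSectionMap [LocallyOfFiniteType π] {U : X.Opens} (hU : IsAffineOpen U) :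
    (baseSectionMap π U).FiniteType := by
  have h1 := π.finiteType_appLE (isAffineOpen_top (Spec (.of k))) hU le_top
  refine RingHom.FiniteType.comp h1 (RingHom.FiniteType.of_surjective _ ?_)
  exact (ConcreteCategory.bijective_of_isIso (Scheme.ΓSpecIso (.of k)).inv).2

/-- Algebraically independent rational functions which are regular on an affine open set have
translates vanishing along a chain of primes. -/
lemma exists_chain_of_germ [IsIntegral X] [Infinite k] [LocallyOfFiniteType π] {U : X.Opens} (hU : IsAffineOpen U)
    (hη : genericPoint X ∈ U) {r : ℕ} {z : Fin r → X.functionField}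
    (hz : letI := functionFieldAlgebra π; AlgebraicIndependent k z) {y : Fin r → Γ(X, U)}
    (hy : ∀ i, X.presheaf.germ U (genericPoint X) hη (y i) = z i) :
    ∃ (c : Fin r → k) (P : Fin (r + 1) → Ideal Γ(X, U)), (∀ i, (P i).IsPrime) ∧ Monotone P ∧
        ∀ i : Fin r, y i - baseSectionMap π U (c i) ∈ P i.succ ∧
          y i - baseSectionMap π U (c i) ∉ P i.castSucc := by
  let _ := functionFieldAlgebra π
  have : Nonempty U := ⟨⟨_, hη⟩⟩
  let _ : Algebra k Γ(X, U) := (baseSectionMap π U).toAlgebra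
  have : Algebra.FiniteType k Γ(X, U) := finiteType_baseSectionMap π hU
  let φ : Γ(X, U) →ₐ[k] X.functionField :=
    { (X.presheaf.germ U (genericPoint X) hη).hom with
      commutes' := fun c => germ_baseSectionMap π hη c }
  refine exists_chain_of_algebraicIndependent r y (AlgebraicIndependent.of_comp φ ?_)
  have : φ ∘ y = z := funext hy
  rwa [this]

/-- The transcendence degree bounds the dimension from below. -/
theorem le_topologicalKrullDim_of_algebraicIndependent [IsIntegral X] [Infinite k]
    [LocallyOfFiniteType π] {r : ℕ} {z : Fin r → X.functionField}
    (hz : letI := functionFieldAlgebra π; AlgebraicIndependent k z) :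
    (r : WithBot ℕ∞) ≤ topologicalKrullDim X := by
  obtain ⟨U, hU, -, hη, hreg⟩ := exists_isAffineOpen_forall_mem_localRing z ⊤ trivial
  choose y hy using fun i => exists_germ_eq_of_forall_mem_localRing hη fun x hx => hreg x hx i
  obtain ⟨c, P, hP, hmono, h⟩ := exists_chain_of_germ π hU hη hz hy
  refine le_trans ?_ (hU.fromSpec.isOpenEmbedding.isInducing.topologicalKrullDim_le)
  refine le_topologicalKrullDim_iff.mpr ⟨fun i => (⟨P i, hP i⟩ : PrimeSpectrum Γ(X, U)), fun i => ?_⟩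
  constructor
  · exact (PrimeSpectrum.le_iff_specializes _ _).mp (hmono (Fin.castSucc_lt_succ).le)
  · intro hs
    exact (h i).2 ((PrimeSpectrum.le_iff_specializes _ _).mpr hs (h i).1)

attribute [local instance] MvPolynomial.gradedAlgebra
open MvPolynomial

/-- Scaling of homogeneous polynomials. -/
lemma eval₂_mul_of_isHomogeneous {R S σ : Type*} [CommRing R] [CommRing S] (φ : R →+* S)
    (a : S) (s : σ → S) {n : ℕ} {f : MvPolynomial σ R} (hf : f.IsHomogeneous n) :
    eval₂ φ (fun i => a * s i) f = a ^ n * eval₂ φ s f := by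
  rw [eval₂_eq, eval₂_eq, Finset.mul_sum]
  refine Finset.sum_congr rfl fun d hd => ?_
  have h2 : ∑ i ∈ d.support, d i = n := by
    have := hf (mem_support_iff.mp hd)
    simpa [Finsupp.weight_apply, Finsupp.sum] using this
  simp only [mul_pow]
  rw [Finset.prod_mul_distrib, Finset.prod_pow_eq_pow_sum, h2]
  ring

/-- The expansion of a section in the chosen basis, read as a linear form in the homogeneous
coordinates. -/
lemma exists_linear_form_eval₂_eq [IsIntegral X] (E : CDiv X) {v : X.functionField}
    (hv : ∀ x, v ∈ E.stalk x) : ∃ l : MvPolynomial (H0Index π E) k, l.IsHomogeneous 1 ∧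
      eval₂ (baseFieldMap π) (H0Basis π E) l = v := by
  let _ := functionFieldAlgebra π
  let b := Module.Basis.ofVectorSpace k (H0 π E)
  let v' : H0 π E := ⟨v, hv⟩
  refine ⟨(b.repr v').sum fun i c => C c * MvPolynomial.X i, ?_, ?_⟩
  · refine IsHomogeneous.sum _ _ _ fun i _ => ?_
    simpa using (isHomogeneous_C _ _).mul (isHomogeneous_X k i)
  · have h1 := congrArg (Submodule.subtype (H0 π E)) (b.linearCombination_repr v')
    rw [Finsupp.linearCombination_apply, Finsupp.sum, map_sum] at h1
    refine Eq.trans ?_ h1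
    rw [Finsupp.sum, eval₂_sum]
    refine Finset.sum_congr rfl fun i _ => ?_
    rw [eval₂_mul, eval₂_C, eval₂_X, map_smul, Algebra.smul_def]
    rfl

/-- Algebraically independent ratios of sections bound the dimension of the image of the linear
system from below. -/
theorem le_dimLinearSystemImage [IsIntegral X] [Infinite k] [LocallyOfFiniteType π] (E : CDiv X)
    {r : ℕ} {z : Fin r → X.functionField}
    (hz : letI := functionFieldAlgebra π; AlgebraicIndependent k z) {s₀ : X.functionField}
    (hs₀ : s₀ ≠ 0) (hs : ∀ x, s₀ ∈ E.stalk x) (hzs : ∀ i x, z i * s₀ ∈ E.stalk x) :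
    ∃ h : H0 π E ≠ ⊥, (r : WithBot ℕ∞) ≤ dimLinearSystemImage π E h := by
  let _ := functionFieldAlgebra π
  have h : H0 π E ≠ ⊥ := fun h0 => hs₀ (by
    have : s₀ ∈ H0 π E := hs
    rw [h0] at this
    exact this)
  refine ⟨h, ?_⟩
  obtain ⟨V, hηV, g, hg⟩ := E.exists_equation (genericPoint X)
  -- Making `(s₀ g)⁻¹` regular on `U` means that `s₀` generates `𝒪_X(E)` there, so dividing sections
  -- by `s₀` gives regular functions on `U`.
  obtain ⟨U, hU, hUV, hη, hreg⟩ := exists_isAffineOpen_forall_mem_localRing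
    (fun o : Option (Fin r) => o.elim (s₀ * (g : X.functionField))⁻¹ z) V hηV
  have hs₀inv : ∀ x ∈ U, ∀ v ∈ E.stalk x, v * s₀⁻¹ ∈ localRing x := fun x hx v hv => by
    have h1 := mul_mem ((CDiv.mem_stalk_iff (hg x (hUV hx))).mp hv) (hreg x hx none)
    convert h1 using 1
    change _ = v * g * (s₀ * g)⁻¹
    have := g.ne_zero
    field_simp
  choose y hy using fun i => exists_germ_eq_of_forall_mem_localRing hη fun x hx => hreg x hx (some i)
  obtain ⟨c, P, hP, hmono, hchain⟩ := exists_chain_of_germ π hU hη hz hy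
  choose ρ hρ using fun j => exists_germ_eq_of_forall_mem_localRing hη fun x hx =>
    hs₀inv x hx _ (H0Basis_mem_stalk π E j x)
  let ψ : MvPolynomial (H0Index π E) k →+* Γ(X, U) := eval₂Hom (baseSectionMap π U) ρ
  let G : Γ(X, U) →+* X.functionField := (X.presheaf.germ U (genericPoint X) hη).hom
  have hG : Function.Injective G := germ_genericPoint_injective U hη
  have hGψ : ∀ {n : ℕ} {f : MvPolynomial (H0Index π E) k}, f.IsHomogeneous n →
      eval₂ (baseFieldMap π) (H0Basis π E) f = s₀ ^ n * G (ψ f) := by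
    intro n f hf
    have h1 : G (ψ f) = eval₂ (baseFieldMap π) (fun i => G (ρ i)) f := by
      change G (eval₂ _ _ f) = _
      rw [eval₂_comp_left]
      congr 1
      exact RingHom.ext fun a => germ_baseSectionMap π hη a
    rw [h1, ← eval₂_mul_of_isHomogeneous _ _ _ hf]
    congr 1
    funext i
    have : G (ρ i) = H0Basis π E i * s₀⁻¹ := hρ i
    rw [this]
    field_simp
  obtain ⟨l₀, hl₀, hl₀'⟩ := exists_linear_form_eval₂_eq π E hs
  choose l hl hl' using fun i => exists_linear_form_eval₂_eq π E (hzs i)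
  have hψl₀ : ψ l₀ = 1 := hG (by
    have h1 := hGψ hl₀
    rw [hl₀', pow_one] at h1
    rw [map_one]
    exact (mul_left_cancel₀ hs₀ ((mul_one _).trans h1)).symm)
  have hψl : ∀ i, ψ (l i) = y i := fun i => hG (by
    have h1 := hGψ (hl i)
    rw [hl', pow_one, mul_comm] at h1
    exact (mul_left_cancel₀ hs₀ h1).symm.trans (hy i).symm)
  let 𝒜 := homogeneousSubmodule (H0Index π E) k
  have hirr : (HomogeneousIdeal.irrelevant 𝒜).toIdeal.map
      ((Scheme.ΓSpecIso Γ(X, U)).inv.hom.comp ψ) = ⊤ := by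
    have hmem : l₀ ∈ (HomogeneousIdeal.irrelevant 𝒜).toIdeal := by
      change _ ∈ HomogeneousIdeal.irrelevant _
      rw [HomogeneousIdeal.mem_irrelevant_iff]
      exact DirectSum.decompose_of_mem_ne 𝒜 (show l₀ ∈ 𝒜 1 from hl₀) one_ne_zero
    refine Ideal.eq_top_of_isUnit_mem _ (Ideal.mem_map_of_mem _ hmem) ?_
    rw [RingHom.comp_apply, hψl₀, map_one]
    exact isUnit_one
  -- This is `Φ_{|E|}` on `U`, with homogeneous coordinates `s_j / s₀`. The chain of primes in `Γ(X,
  -- U)` is transported along it.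
  let θ : Spec Γ(X, U) ⟶ Proj 𝒜 := Proj.fromOfGlobalSections 𝒜 _ hirr
  let p (i : Fin (r + 1)) : Spec Γ(X, U) := (⟨P i, hP i⟩ : PrimeSpectrum Γ(X, U))
  have hθ : ∀ {n : ℕ} (_ : 0 < n) {f : MvPolynomial (H0Index π E) k} (_ : f.IsHomogeneous n) i,
      θ (p i) ∈ Proj.basicOpen 𝒜 f ↔ ψ f ∉ P i := by
    intro n hn f hf i
    have h1 := Proj.fromOfGlobalSections_preimage_basicOpen 𝒜 _ hirr hn hf
    have h2 : θ (p i) ∈ Proj.basicOpen 𝒜 f ↔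
        p i ∈ (Spec Γ(X, U)).basicOpen ((Scheme.ΓSpecIso Γ(X, U)).inv (ψ f)) := by
      change p i ∈ θ ⁻¹ᵁ Proj.basicOpen 𝒜 f ↔ _
      rw [h1]
      rfl
    rw [h2, basicOpen_eq_of_affine]
    exact Iff.rfl
  have hξ : ∀ i, linearSystemPoint π E h ⤳ θ (p i) := by
    intro i
    by_contra hc
    obtain ⟨n, f, hf, h1, h2⟩ := exists_homogeneous_of_not_specializes hc
    -- Multiplying by `l₀`, which goes to `1`, ensures positive degree without changing where `f`
    -- vanishes on the image of `θ`.
    have h3 : ψ (f * l₀) = 0 := by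
      have h4 : eval₂ (baseFieldMap π) (H0Basis π E) (f * l₀) = 0 := by
        by_contra h5
        refine (linearSystemPoint_mem_basicOpen_iff π E h (Nat.succ_pos n) (hf.mul hl₀)).mpr h5 ?_
        exact Ideal.mul_mem_right _ _ h1
      rw [hGψ (hf.mul hl₀)] at h4
      exact hG (((mul_eq_zero.mp h4).resolve_left (pow_ne_zero _ hs₀)).trans (map_zero G).symm)
    have h4 : f * l₀ ∈ (θ (p i)).asHomogeneousIdeal.toIdeal := by
      by_contra h5
      exact (hθ (Nat.succ_pos n) (hf.mul hl₀) i).mp h5 (by rw [h3]; exact zero_mem _)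
    rcases (θ (p i)).isPrime.mem_or_mem h4 with h5 | h5
    · exact h2 h5
    · refine (hθ one_pos hl₀ i).mpr ?_ h5
      rw [hψl₀]
      exact (Ideal.ne_top_iff_one _).mp (hP i).ne_top
  have hC : IsClosed (closure (Set.range (linearSystemMap π E h))) := isClosed_closure
  have : QuasiSober (closure (Set.range (linearSystemMap π E h))) :=
    hC.isClosedEmbedding_subtypeVal.quasiSober
  refine le_topologicalKrullDim_iff.mpr ⟨fun i => ⟨θ (p i), ?_⟩, fun i => ?_⟩
  · rw [range_linearSystemMap, ← specializes_iff_mem_closure]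
    exact hξ i
  · rw [subtype_specializes_iff, subtype_specializes_iff]
    constructor
    · exact ((PrimeSpectrum.le_iff_specializes _ _).mp (hmono (Fin.castSucc_lt_succ).le)).map
        θ.continuous
    · intro hs'
      -- This linear form pulls back to `y_i - c_i`, which lies in the later prime but not in the
      -- earlier one, so it separates consecutive image points.
      have hlin : (l i - C (c i) * l₀).IsHomogeneous 1 := by
        refine (hl i).sub ?_
        simpa using (isHomogeneous_C _ _).mul hl₀
      have hψlin : ψ (l i - C (c i) * l₀) = y i - baseSectionMap π U (c i) := by
        rw [map_sub, map_mul, hψl, hψl₀, mul_one]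
        congr 1
        exact eval₂_C _ _ _
      have h1 : θ (p i.castSucc) ∈ Proj.basicOpen 𝒜 (l i - C (c i) * l₀) :=
        (hθ one_pos hlin _).mpr (by rw [hψlin]; exact (hchain i).2)
      have h2 := hs'.mem_open (Proj.basicOpen 𝒜 _).2 h1
      exact (hθ one_pos hlin _).mp h2 (by rw [hψlin]; exact (hchain i).1)

end FiniteType

/-! ### Calculus of ratios of sections of `ℚ`-divisors. -/

section HasRatios
variable {X Y : Scheme.{u}} [IsIntegral X] [IsIntegral Y]

/-- Tensoring with `ℚ` is localisation at the non-zero integers, so its kernel is torsion. -/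
lemma exists_nsmul_eq_of_tmul_eq {M : Type*} [AddCommGroup M] {a b : M}
    (h : (1 : ℚ) ⊗ₜ[ℤ] a = (1 : ℚ) ⊗ₜ[ℤ] b) : ∃ N : ℕ, 0 < N ∧ N • a = N • b := by
  have : IsLocalizedModule (nonZeroDivisors ℤ) (TensorProduct.mk ℤ ℚ M 1) :=
    (isLocalizedModule_iff_isBaseChange (nonZeroDivisors ℤ) ℚ _).mpr (TensorProduct.isBaseChange ℤ M ℚ)
  obtain ⟨c, hc⟩ := (IsLocalizedModule.eq_iff_exists (nonZeroDivisors ℤ)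
    (TensorProduct.mk ℤ ℚ M 1)).mp h
  have hc0 : (c : ℤ) ≠ 0 := nonZeroDivisors.coe_ne_zero c
  refine ⟨(c : ℤ).natAbs, Int.natAbs_pos.mpr hc0, ?_⟩
  have hc' : (c : ℤ) • a = (c : ℤ) • b := hc
  rcases Int.natAbs_eq (c : ℤ) with h1 | h1
  · rw [h1, natCast_zsmul, natCast_zsmul] at hc'
    exact hc'
  · rw [h1, neg_smul, neg_smul, natCast_zsmul, natCast_zsmul] at hc'
    exact (neg_injective hc')

/-- The rational functions in `S` are ratios, with a common denominator, of sections of a multiple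
of the `ℚ`-Cartier divisor `Δ`. -/
def HasRatios (Δ : QCDiv X) (S : Set X.functionField) : Prop :=
  ∃ N : ℕ, 0 < N ∧ ∃ E : CDiv X, N • Δ = (1 : ℚ) ⊗ₜ[ℤ] E ∧
    ∃ s : X.functionField, s ≠ 0 ∧ (∀ x, s ∈ E.stalk x) ∧ ∀ z ∈ S, ∀ x, z * s ∈ E.stalk x

variable {Δ Δ' : QCDiv X} {S S' : Set X.functionField}

/-- Taking `N · den(q)` copies of `q Δ` gives `num(q)` copies of `N Δ`; multiplying by the remaining
powers of `s` leaves the ratios unchanged. -/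
lemma HasRatios.smul (h : HasRatios Δ S) {q : ℚ} (hq : 0 < q) : HasRatios (q • Δ) S := by
  obtain ⟨N, hN, E, hE, s, hs0, hs, hz⟩ := h
  have hnum : 0 < q.num := Rat.num_pos.mpr hq
  obtain ⟨a, ha⟩ := Int.eq_ofNat_of_zero_le hnum.le
  have ha0 : a ≠ 0 := by rintro rfl; simp [ha] at hnum
  obtain ⟨b, rfl⟩ := Nat.exists_eq_succ_of_ne_zero ha0
  refine ⟨N * q.den, Nat.mul_pos hN q.den_pos, (b + 1) • E, ?_, s ^ (b + 1), pow_ne_zero _ hs0,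
    fun x => CDiv.pow_mem_stalk (hs x) _, fun z hzS x => ?_⟩
  · have h1 : (N * q.den) • q • Δ = (b + 1) • N • Δ := by
      simp only [← Nat.cast_smul_eq_nsmul ℚ, smul_smul]
      congr 1
      have h2 : (q.den : ℚ) * q = q.num := Rat.den_mul_eq_num q
      push_cast
      rw [mul_assoc, h2, ha]
      push_cast
      ring
    rw [h1, hE, ← tmul_smul]
  · have h1 := CDiv.mul_mem_stalk (CDiv.pow_mem_stalk (hs x) b) (hz z hzS x)
    rw [← succ_nsmul] at h1
    convert h1 using 1
    ring

/-- Products of powers of the two denominators form a common denominator, so the ratios of each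
summand survive in the sum. -/
lemma HasRatios.add (h : HasRatios Δ S) (h' : HasRatios Δ' S') :
    HasRatios (Δ + Δ') (S ∪ S') := by
  obtain ⟨N, hN, E, hE, s, hs0, hs, hz⟩ := h
  obtain ⟨N', hN', E', hE', s', hs0', hs', hz'⟩ := h'
  obtain ⟨n, rfl⟩ := Nat.exists_eq_succ_of_ne_zero hN.ne'
  obtain ⟨n', rfl⟩ := Nat.exists_eq_succ_of_ne_zero hN'.ne'
  refine ⟨(n + 1) * (n' + 1), by positivity, (n' + 1) • E + (n + 1) • E', ?_,
    s ^ (n' + 1) * s' ^ (n + 1), mul_ne_zero (pow_ne_zero _ hs0) (pow_ne_zero _ hs0'),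
    fun x => CDiv.mul_mem_stalk (CDiv.pow_mem_stalk (hs x) _) (CDiv.pow_mem_stalk (hs' x) _),
    fun z hzS x => ?_⟩
  · rw [tmul_add, tmul_smul, tmul_smul, ← hE, ← hE', smul_add, smul_smul, smul_smul,
      mul_comm (n + 1)]
  · rcases hzS with hzS | hzS
    · have h1 := CDiv.mul_mem_stalk (CDiv.mul_mem_stalk (CDiv.pow_mem_stalk (hs x) n') (hz z hzS x))
        (CDiv.pow_mem_stalk (hs' x) (n + 1))
      rw [← succ_nsmul] at h1
      convert h1 using 1
      ring
    · have h1 := CDiv.mul_mem_stalk (CDiv.pow_mem_stalk (hs x) (n' + 1))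
        (CDiv.mul_mem_stalk (CDiv.pow_mem_stalk (hs' x) n) (hz' z hzS x))
      rw [← succ_nsmul _ n] at h1
      convert h1 using 1
      ring

lemma QCDiv.pullback_tmul (f : X ⟶ Y) [IsDominant f] (q : ℚ) (E : CDiv Y) :
    QCDiv.pullback f (q ⊗ₜ[ℤ] E) = q ⊗ₜ[ℤ] CDiv.pullback f E := rfl

lemma QCDiv.pullback_smul (f : X ⟶ Y) [IsDominant f] (q : ℚ) (Θ : QCDiv Y) :
    QCDiv.pullback f (q • Θ) = q • QCDiv.pullback f Θ := by
  induction Θ using TensorProduct.induction_on with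
  | zero => simp
  | add a b ha hb => rw [smul_add, map_add, map_add, smul_add, ha, hb]
  | tmul r E => rfl

lemma HasRatios.pullback (f : X ⟶ Y) [IsDominant f] {Θ : QCDiv Y} {T : Set Y.functionField}
    (h : HasRatios Θ T) : HasRatios (QCDiv.pullback f Θ) (functionFieldMap f '' T) := by
  obtain ⟨N, hN, E, hE, s, hs0, hs, hz⟩ := h
  refine ⟨N, hN, CDiv.pullback f E, ?_, functionFieldMap f s,
    (map_ne_zero_iff _ (functionFieldMap f).injective).mpr hs0,
    fun x => CDiv.functionFieldMap_mem_stalk f (hs _), ?_⟩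
  · rw [← QCDiv.pullback_tmul, ← hE, map_nsmul]
  · rintro _ ⟨z, hzT, rfl⟩ x
    rw [← map_mul]
    exact CDiv.functionFieldMap_mem_stalk f (hz z hzT _)

/-- Ratios for an integral divisor. -/
lemma HasRatios.exists_nsmul {D : CDiv X} (h : HasRatios ((1 : ℚ) ⊗ₜ[ℤ] D) S) :
    ∃ N : ℕ, 0 < N ∧ ∃ s : X.functionField, s ≠ 0 ∧ (∀ x, s ∈ (N • D).stalk x) ∧
      ∀ z ∈ S, ∀ x, z * s ∈ (N • D).stalk x := by
  obtain ⟨N, hN, E, hE, s, hs0, hs, hz⟩ := h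
  rw [← tmul_smul] at hE
  obtain ⟨M, hM, hME⟩ := exists_nsmul_eq_of_tmul_eq hE
  obtain ⟨m, rfl⟩ := Nat.exists_eq_succ_of_ne_zero hM.ne'
  refine ⟨(m + 1) * N, Nat.mul_pos hM hN, s ^ (m + 1), pow_ne_zero _ hs0, fun x => ?_,
    fun z hzS x => ?_⟩
  · rw [mul_smul, hME]
    exact CDiv.pow_mem_stalk (hs x) _
  · rw [mul_smul, hME, succ_nsmul]
    convert CDiv.mul_mem_stalk (CDiv.pow_mem_stalk (hs x) m) (hz z hzS x) using 1
    ring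

end HasRatios

/-! ### Iitaka dimension in terms of ratios. -/

section Kappa
variable {X : Scheme.{u}} [IsIntegral X] {F : Type u} [Field F] (π : X ⟶ Spec (.of F)) {Δ : QCDiv X}

lemma le_of_lt_natCast_succ {x : WithBot ℕ∞} {n : ℕ} (h : x < ((n + 1 : ℕ) : WithBot ℕ∞)) :
    x ≤ n := by
  induction x using WithBot.recBotCoe with
  | bot => exact bot_le
  | coe x =>
    have h1 : x < ((n + 1 : ℕ) : ℕ∞) := WithBot.coe_lt_coe.mp h
    rw [Nat.cast_succ] at h1
    exact WithBot.coe_le_coe.mpr (Order.le_of_lt_add_one h1)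

/-- A supremum that reaches a natural number `n` has a term reaching it: otherwise all terms are at
most `n - 1`, or equal to `⊥` when `n = 0`. -/
lemma exists_algebraicIndependent_of_le_kappa {n : ℕ} (h : (n : WithBot ℕ∞) ≤ kappa π Δ) :
    letI := functionFieldAlgebra π
    ∃ z : Fin n → X.functionField, AlgebraicIndependent F z ∧ HasRatios Δ (Set.range z) := by
  let _ := functionFieldAlgebra π
  obtain ⟨m, E, ⟨hm, hE⟩, h0, hn⟩ : ∃ (m : ℕ) (E : CDiv X) (_ : 0 < m ∧ m • Δ = (1 : ℚ) ⊗ₜ[ℤ] E)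
      (h0 : H0 π E ≠ ⊥), (n : WithBot ℕ∞) ≤ dimLinearSystemImage π E h0 := by
    by_contra! hc
    rcases n with _ | n
    · have h1 : kappa π Δ ≤ ⊥ := iSup_le fun m => iSup_le fun E => iSup_le fun hE => iSup_le fun h0 => by
        have := hc m E hE h0
        rw [Nat.cast_zero] at this
        exact (WithBot.lt_coe_bot.mp this).le
      rw [le_bot_iff.mp h1] at h
      exact absurd (le_bot_iff.mp h) (WithBot.coe_ne_bot)
    · have h1 : kappa π Δ ≤ n := iSup_le fun m => iSup_le fun E => iSup_le fun hE => iSup_le fun h0 => by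
        exact le_of_lt_natCast_succ (hc m E hE h0)
      have h2 : n + 1 ≤ n := by exact_mod_cast h.trans h1
      omega
  obtain ⟨z, hz, N, hN, s, hs0, hs, hzs⟩ := exists_algebraicIndependent_of_le_dim π E h0 n hn
  refine ⟨z, hz, N * m, Nat.mul_pos hN hm, N • E, ?_, s, hs0, hs, ?_⟩
  · rw [mul_smul, hE, tmul_smul]
  · rintro _ ⟨i, rfl⟩
    exact hzs i

lemma HasRatios.le_kappa [Infinite F] [LocallyOfFiniteType π] {n : ℕ} {z : Fin n → X.functionField}
    (hz : letI := functionFieldAlgebra π; AlgebraicIndependent F z)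
    (h : HasRatios Δ (Set.range z)) : (n : WithBot ℕ∞) ≤ kappa π Δ := by
  obtain ⟨N, hN, E, hE, s, hs0, hs, hzs⟩ := h
  obtain ⟨h0, hle⟩ := le_dimLinearSystemImage π E hz hs0 hs fun i => hzs _ ⟨i, rfl⟩
  exact hle.trans (le_iSup_of_le N (le_iSup_of_le E (le_iSup_of_le ⟨hN, hE⟩
    (le_iSup_of_le h0 le_rfl))))

end Kappa

/-! ### Extending sections across the zeros of a section. -/

section Extension
variable {X : Scheme.{u}} [IsIntegral X]

lemma exists_isAffineOpen_equations (L B : CDiv X) (x : X) :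
    ∃ (V : X.Opens) (g h : (X.functionField)ˣ), IsAffineOpen V ∧ x ∈ V ∧
      (∀ y ∈ V, L.germ y = QuotientGroup.mk g) ∧ ∀ y ∈ V, B.germ y = QuotientGroup.mk h := by
  obtain ⟨U, hU, g, hg⟩ := L.exists_equation x
  obtain ⟨U', hU', h, hh⟩ := B.exists_equation x
  obtain ⟨V, hV, hx, hle⟩ := exists_isAffineOpen_mem_and_subset (show x ∈ U ⊓ U' from ⟨hU, hU'⟩)
  exact ⟨V, g, h, hV, hx, fun y hy => hg y (hle hy).1, fun y hy => hh y (hle hy).2⟩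

/-- A section of `L` over the locus where the section `a` of `B` does not vanish extends after
multiplication by a power of `a`. -/
theorem exists_pow_mul_mem_stalk [CompactSpace X] (L B : CDiv X) {a c : X.functionField}
    (ha : ∀ x, a ∈ B.stalk x) (hc : ∀ x, B.Generates a x → c ∈ L.stalk x) :
    ∃ N : ℕ, ∀ M, N ≤ M → ∀ x, a ^ M * c ∈ (L + M • B).stalk x := by
  rcases eq_or_ne a 0 with rfl | ha0
  · refine ⟨1, fun M hM x => ?_⟩
    rw [zero_pow (by omega), zero_mul]
    exact zero_mem _
  choose V g h hV hxV hg hh using exists_isAffineOpen_equations L B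
  have key : ∀ x, ∃ N : ℕ, ∀ M, N ≤ M → ∀ y ∈ V x, a ^ M * c ∈ (L + M • B).stalk y := by
    intro x
    have hη : genericPoint X ∈ V x := genericPoint_mem_of_mem (hxV x)
    obtain ⟨b, hb⟩ := exists_germ_eq_of_forall_mem_localRing hη (c := a * h x) fun y hy =>
      (CDiv.mem_stalk_iff (hh x y hy)).mp (ha y)
    have hb0 : b ≠ 0 := by
      rintro rfl
      rw [map_zero] at hb
      exact mul_ne_zero ha0 (h x).ne_zero hb.symm
    have hηD : genericPoint X ∈ X.basicOpen b := by
      rw [Scheme.mem_basicOpen _ _ _ hη, hb]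
      exact (IsUnit.mk0 _ (mul_ne_zero ha0 (h x).ne_zero))
    -- On the chart, `a` generates `B` exactly on the basic open set of `b = a h`. There `c g` is
    -- regular, so on the whole chart it has only a power of `b` in its denominator.
    obtain ⟨t, ht⟩ := exists_germ_eq_of_forall_mem_localRing hηD (c := c * g x) fun y hy => by
      have hyV : y ∈ V x := X.basicOpen_le b hy
      refine (CDiv.mem_stalk_iff (hg x y hyV)).mp (hc y ?_)
      rw [CDiv.generates_iff (hh x y hyV)]
      refine ⟨((Scheme.mem_basicOpen _ _ _ hyV).mp hy).unit, ?_⟩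
      rw [IsUnit.unit_spec, algebraMap_germ_eq _ hyV hη, hb]
    have := (hV x).isLocalization_basicOpen b
    obtain ⟨N, t', ht'⟩ := IsLocalization.Away.surj b t
    have hreg : ∀ y ∈ V x, (a * h x) ^ N * (c * g x) ∈ localRing y := fun y hy => by
      have h1 := congrArg (X.presheaf.germ (X.basicOpen b) (genericPoint X) hηD) ht'
      rw [map_mul, map_pow, ht] at h1
      have h2 : ∀ r : Γ(X, V x), X.presheaf.germ (X.basicOpen b) (genericPoint X) hηD
          (algebraMap Γ(X, V x) Γ(X, X.basicOpen b) r) =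
          X.presheaf.germ (V x) (genericPoint X) hη r := fun r =>
        X.presheaf.germ_res_apply (homOfLE (X.basicOpen_le b)) _ hηD r
      rw [h2, h2, hb, mul_comm] at h1
      rw [h1]
      exact germ_mem_localRing hy hη t'
    refine ⟨N, fun M hM y hy => ?_⟩
    have hger : (L + M • B).germ y = QuotientGroup.mk (g x * h x ^ M) := by
      rw [CDiv.germ_add, CDiv.germ_nsmul, hg x y hy, hh x y hy]
      rfl
    rw [CDiv.mem_stalk_iff hger]
    have h3 : a * h x ∈ localRing y := (CDiv.mem_stalk_iff (hh x y hy)).mp (ha y)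
    convert mul_mem (pow_mem h3 (M - N)) (hreg y hy) using 1
    rw [← mul_assoc, ← pow_add, Nat.sub_add_cancel hM]
    push_cast
    ring
  choose N hN using key
  obtain ⟨t, ht⟩ := CompactSpace.elim_nhds_subcover (fun x => (V x : Set X))
    fun x => (V x).2.mem_nhds (hxV x)
  refine ⟨t.sup N, fun M hM y => ?_⟩
  have : y ∈ ⋃ x ∈ t, (V x : Set X) := by rw [ht]; trivial
  obtain ⟨x, hx, hy⟩ := Set.mem_iUnion₂.mp this
  exact hN x M ((Finset.le_sup hx).trans hM) y hy

end Extension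

/-! ### Ample divisors and Kodaira's lemma. -/

section Ample
variable {Y : Scheme.{u}} [IsIntegral Y]

/-- A positive multiple of an ample divisor has finitely many sections without common zeros. -/
lemma CDiv.IsAmple.exists_sections {A : CDiv Y} (hA : A.IsAmple) :
    ∃ b : ℕ, 0 < b ∧ ∃ t : Finset Y.functionField, (∀ a ∈ t, ∀ y, a ∈ (b • A).stalk y) ∧
      ∀ y, ∃ a ∈ t, (b • A).Generates a y := by
  classical
  obtain ⟨_, h⟩ := hA
  choose n hn s hs U hU _ hgen using h
  obtain ⟨t, ht⟩ := CompactSpace.elim_nhds_subcover (fun x => (U x : Set Y))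
    fun x => (U x).2.mem_nhds (hU x)
  have hdvd : ∀ x ∈ t, n x ∣ ∏ x ∈ t, n x := fun x hx => Finset.dvd_prod_of_mem n hx
  have hmul : ∀ x ∈ t, ((∏ x ∈ t, n x) / n x) • n x • A = (∏ x ∈ t, n x) • A := fun x hx => by
    rw [smul_smul, Nat.div_mul_cancel (hdvd x hx)]
  refine ⟨∏ x ∈ t, n x, Finset.prod_pos fun x _ => hn x,
    t.image fun x => s x ^ ((∏ x ∈ t, n x) / n x), fun a ha y => ?_, fun y => ?_⟩
  · obtain ⟨x, hx, rfl⟩ := Finset.mem_image.mp ha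
    rw [← hmul x hx]
    exact CDiv.pow_mem_stalk (hs x y) _
  · have : y ∈ ⋃ x ∈ t, (U x : Set Y) := by rw [ht]; trivial
    obtain ⟨x, hx, hy⟩ := Set.mem_iUnion₂.mp this
    refine ⟨_, Finset.mem_image_of_mem _ hx, ?_⟩
    rw [← hmul x hx]
    exact ((hgen x y).mp hy).pow _

lemma QCDiv.IsAmple.hasRatios {A : QCDiv Y} (hA : A.IsAmple) : HasRatios A ∅ := by
  obtain ⟨m, hm, E, hE, hE'⟩ := hA
  obtain ⟨b, hb, t, ht, ht'⟩ := hE'.exists_sections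
  obtain ⟨a, ha, hgen⟩ := ht' (genericPoint Y)
  exact ⟨b * m, Nat.mul_pos hb hm, b • E, by rw [mul_smul, hE, tmul_smul], a, hgen.ne_zero, ht a ha,
    fun z hz => hz.elim⟩

end Ample

section Kodaira
variable {Y : Scheme.{u}} [IsIntegral Y] {k : Type u} [Field k] (π : Y ⟶ Spec (.of k))

/-- A polynomial of degree at most `m` in ratios with denominator `s` becomes a section of `m E`
after multiplication by `s^m`. -/
lemma exists_mul_pow_mem_stalk_of_mem_adjoin {E : CDiv Y} {T : Set Y.functionField}
    {s : Y.functionField} (hs : ∀ y, s ∈ E.stalk y) (hT : ∀ z ∈ T, ∀ y, z * s ∈ E.stalk y)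
    {c : Y.functionField} (hc : letI := functionFieldAlgebra π; c ∈ Algebra.adjoin k T) :
    ∃ l : ℕ, ∀ m, l ≤ m → ∀ y, c * s ^ m ∈ (m • E).stalk y := by
  let _ := functionFieldAlgebra π
  induction hc using Algebra.adjoin_induction with
  | mem z hz =>
    refine ⟨1, fun m hm y => ?_⟩
    obtain ⟨m, rfl⟩ := Nat.exists_eq_add_of_le' hm
    rw [succ_nsmul]
    convert CDiv.mul_mem_stalk (CDiv.pow_mem_stalk (hs y) m) (hT z hz y) using 1
    ring
  | algebraMap r =>
    exact ⟨0, fun m _ y => CDiv.localRing_mul_mem_stalk (baseFieldMap_mem_localRing π y r)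
      (CDiv.pow_mem_stalk (hs y) m)⟩
  | add a b _ _ ha hb =>
    obtain ⟨l, hl⟩ := ha
    obtain ⟨l', hl'⟩ := hb
    refine ⟨max l l', fun m hm y => ?_⟩
    rw [add_mul]
    exact add_mem (hl m (le_of_max_le_left hm) y) (hl' m (le_of_max_le_right hm) y)
  | mul a b _ _ ha hb =>
    obtain ⟨l, hl⟩ := ha
    obtain ⟨l', hl'⟩ := hb
    refine ⟨l + l', fun m hm y => ?_⟩
    obtain ⟨n, rfl⟩ := Nat.exists_eq_add_of_le hm
    convert CDiv.mul_mem_stalk (hl l le_rfl y) (hl' (l' + n) (by omega) y) using 1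
    · rw [← add_smul, add_assoc]
    · ring

/-- An algebraic element of a field satisfies an equation with non-zero constant term. -/
lemma exists_aeval_eq_zero_coeff_zero_ne_zero {R K : Type*} [CommRing R] [IsDomain R] [Field K]
    [Algebra R K] {y : K} (hy0 : y ≠ 0) (hy : IsAlgebraic R y) :
    ∃ q : Polynomial R, q.coeff 0 ≠ 0 ∧ Polynomial.aeval y q = 0 := by
  obtain ⟨q, hq0, hq⟩ := hy
  obtain ⟨q', hq', hX⟩ := Polynomial.exists_eq_pow_rootMultiplicity_mul_and_not_dvd q hq0 0
  rw [Polynomial.C_0, sub_zero] at hq' hX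
  refine ⟨q', fun h => hX (Polynomial.X_dvd_iff.mpr h), ?_⟩
  rw [hq', map_mul, map_pow, Polynomial.aeval_X] at hq
  exact (mul_eq_zero.mp hq).resolve_left (pow_ne_zero _ hy0)

/-- If `a` and `a'` are sections of `B` and `a' / a` is algebraic over the algebra generated by
ratios of sections of `E`, then some section of a multiple of `E` is divisible by `a'` at all points
where `a` does not vanish. -/
lemma exists_section_div_mem_stalk {E B : CDiv Y} {T : Set Y.functionField}
    {s : Y.functionField} (hs0 : s ≠ 0) (hs : ∀ y, s ∈ E.stalk y)
    (hT : ∀ z ∈ T, ∀ y, z * s ∈ E.stalk y)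
    (halg : letI := functionFieldAlgebra π; Algebra.IsAlgebraic (Algebra.adjoin k T) Y.functionField)
    {a a' : Y.functionField} (ha0 : a ≠ 0) (ha0' : a' ≠ 0)
    (ha' : ∀ y, a' ∈ B.stalk y) :
    ∃ (l : ℕ) (Q : Y.functionField), Q ≠ 0 ∧ (∀ y, Q ∈ (l • E).stalk y) ∧
      ∀ y, B.Generates a y → Q * a'⁻¹ ∈ (l • E - B).stalk y := by
  let _ := functionFieldAlgebra π
  obtain ⟨q, hq0, hq⟩ := exists_aeval_eq_zero_coeff_zero_ne_zero (y := a' * a⁻¹)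
    (mul_ne_zero ha0' (inv_ne_zero ha0)) (halg.isAlgebraic (a' * a⁻¹))
  choose l hl using fun i => exists_mul_pow_mem_stalk_of_mem_adjoin π hs hT (q.coeff i).2
  let m := (Finset.range (q.natDegree + 1)).sup l
  have hm : ∀ i ∈ Finset.range (q.natDegree + 1), ∀ y,
      (q.coeff i : Y.functionField) * s ^ m ∈ (m • E).stalk y :=
    fun i hi y => hl i m (Finset.le_sup hi) y
  refine ⟨m, q.coeff 0 * s ^ m, mul_ne_zero ?_ (pow_ne_zero _ hs0), hm 0 (by simp), fun y hy => ?_⟩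
  · exact fun h0 => hq0 (Subtype.ext h0)
  have hr : a' * a⁻¹ ∈ localRing y := hy.mem_stalk_iff.mp (ha' y)
  rw [Polynomial.aeval_eq_sum_range, Finset.sum_range_succ'] at hq
  -- The equation `q(a'/a) = 0` is solved for its constant term and divided by `a'`: each term is
  -- then a power of the regular function `a'/a` times a section of `m E` divided by the generator
  -- `a`.
  have h1 : (q.coeff 0 : Y.functionField) * s ^ m * a'⁻¹ =
      -∑ i ∈ Finset.range q.natDegree,
        (a' * a⁻¹) ^ i * ((q.coeff (i + 1) : Y.functionField) * s ^ m * a⁻¹) := by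
    have h2 : (q.coeff 0 : Y.functionField) = -∑ i ∈ Finset.range q.natDegree,
        (q.coeff (i + 1) : Y.functionField) * (a' * a⁻¹) ^ (i + 1) := by
      rw [eq_neg_iff_add_eq_zero, add_comm, ← hq, pow_zero]
      simp only [Algebra.smul_def, mul_one]
      rfl
    rw [h2, neg_mul, neg_mul, Finset.sum_mul, Finset.sum_mul]
    congr 1
    refine Finset.sum_congr rfl fun i _ => ?_
    rw [pow_succ]
    field_simp
  rw [h1, sub_eq_add_neg]
  refine neg_mem (Submodule.sum_mem _ fun i hi => ?_)
  refine CDiv.localRing_mul_mem_stalk (pow_mem hr i) (CDiv.mul_mem_stalk (hm (i + 1) ?_ y)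
    hy.inv_mem_stalk)
  simpa using hi

/-- **Kodaira's lemma**: if the sections of multiples of `H` generate the function field up to
algebraic extension, then `H` minus a small multiple of an ample divisor is effective. -/
theorem exists_hasRatios_sub_smul {A H : QCDiv Y} (hA : A.IsAmple) {T : Set Y.functionField}
    (hH : HasRatios H T)
    (halg : letI := functionFieldAlgebra π; Algebra.IsAlgebraic (Algebra.adjoin k T) Y.functionField) :
    ∃ ε : ℚ, 0 < ε ∧ HasRatios (H - ε • A) ∅ := by
  classical
  obtain ⟨m, hm, A', hA', hamp⟩ := hA
  obtain ⟨b, hb, t, ht, ht'⟩ := hamp.exists_sections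
  obtain ⟨N, hN, E, hE, s, hs0, hs, hT⟩ := hH
  obtain ⟨a', ha't, hgen'⟩ := ht' (genericPoint Y)
  have ha0' := hgen'.ne_zero
  have key : ∀ a : Y.functionField, ∃ (l : ℕ) (Q : Y.functionField), Q ≠ 0 ∧
      (∀ y, Q ∈ (l • E).stalk y) ∧
      ∀ y, (b • A').Generates a y → Q * a'⁻¹ ∈ (l • E - b • A').stalk y := fun a => by
    rcases eq_or_ne a 0 with rfl | ha0
    · exact ⟨1, s, hs0, fun y => by rw [one_smul]; exact hs y, fun y hy => absurd rfl hy.ne_zero⟩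
    · exact exists_section_div_mem_stalk π hs0 hs hT halg ha0 ha0' (ht a' ha't)
  choose l Q hQ0 hQ hdiv using key
  let M := ∑ a ∈ t, l a + 1
  -- At each point some `a` in `t` generates, so the factor `Q_a` absorbs `a'⁻¹` while the other
  -- factors are regular. The factor `s` accounts for the `1` in `M`, which keeps `M` positive.
  have hsec : ∀ y, s * (∏ a ∈ t, Q a) * a'⁻¹ ∈ (M • E - b • A').stalk y := by
    intro y
    obtain ⟨a, ha, hgen⟩ := ht' y
    have h1 := CDiv.prod_mem_stalk (t.erase a) (D := fun a => l a • E) fun a _ => hQ a y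
    have h2 := CDiv.mul_mem_stalk (CDiv.mul_mem_stalk (hs y) h1) (hdiv a y hgen)
    convert h2 using 1
    · rw [← Finset.sum_smul]
      simp only [M, ← Finset.add_sum_erase t l ha, add_smul, one_smul]
      congr 1
      abel
    · rw [← Finset.mul_prod_erase t Q ha]
      ring
  have hMN : (0 : ℚ) < (M * N : ℕ) := by
    have : 0 < M * N := Nat.mul_pos (Nat.succ_pos _) hN
    exact_mod_cast this
  have h1 : HasRatios (((M * N : ℕ) : ℚ) • H - ((b * m : ℕ) : ℚ) • A) ∅ := by
    refine ⟨1, one_pos, M • E - b • A', ?_, s * (∏ a ∈ t, Q a) * a'⁻¹,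
      mul_ne_zero (mul_ne_zero hs0 (Finset.prod_ne_zero_iff.mpr fun a _ => hQ0 a))
        (inv_ne_zero ha0'), hsec, fun z hz => hz.elim⟩
    rw [one_smul, tmul_sub, tmul_smul, tmul_smul, ← hE, ← hA', Nat.cast_smul_eq_nsmul,
      Nat.cast_smul_eq_nsmul, mul_smul, mul_smul]
  refine ⟨((M * N : ℕ) : ℚ)⁻¹ * ((b * m : ℕ) : ℚ), ?_, ?_⟩
  · have : 0 < b * m := Nat.mul_pos hb hm
    have : (0 : ℚ) < (b * m : ℕ) := by exact_mod_cast this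
    positivity
  · have h2 := h1.smul (inv_pos.mpr hMN)
    rwa [smul_sub, inv_smul_smul₀ hMN.ne', smul_smul] at h2

end Kodaira

/-! ### From sections on the generic fibre to sections on `X`. -/

section Denominators
variable {X Y : Scheme.{u}} [IsIntegral X] [IsIntegral Y] (f : X ⟶ Y) [IsDominant f]

lemma functionFieldMap_germ_appLE {V : Y.Opens} {W : X.Opens} (e : W ≤ f ⁻¹ᵁ V)
    (hV : genericPoint Y ∈ V) (hW : genericPoint X ∈ W) (t : Γ(Y, V)) :
    functionFieldMap f (Y.presheaf.germ V (genericPoint Y) hV t) =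
      X.presheaf.germ W (genericPoint X) hW (f.appLE V W e t) := by
  rw [functionFieldMap_germ V hV (e hW)]
  exact (X.presheaf.germ_res_apply (homOfLE e) _ hW (f.app V t)).symm

/-- A rational function which is regular at `x` is a fraction of sections on an affine neighbourhood
with denominator not vanishing at `x`. -/
lemma exists_mul_germ_eq_of_mem_localRing {W : X.Opens} (hW : IsAffineOpen W)
    (hη : genericPoint X ∈ W) {x : X} (hx : x ∈ W) {u : X.functionField} (hu : u ∈ localRing x) :
    ∃ r r' : Γ(X, W), x ∈ X.basicOpen r ∧ X.presheaf.germ W (genericPoint X) hη r * u =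
      X.presheaf.germ W (genericPoint X) hη r' := by
  obtain ⟨a, rfl⟩ := hu
  obtain ⟨O, hO, t, rfl⟩ := X.presheaf.exists_germ_eq a
  obtain ⟨b, hbO, hxb⟩ := hW.exists_basicOpen_le ⟨x, hO⟩ hx
  have hηb := genericPoint_mem_of_mem hxb
  have hηO := genericPoint_mem_of_mem hO
  have := hW.isLocalization_basicOpen b
  obtain ⟨N, t', ht'⟩ := IsLocalization.Away.surj b (X.presheaf.map (homOfLE hbO).op t)
  have h1 := congrArg (X.presheaf.germ (X.basicOpen b) (genericPoint X) hηb) ht'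
  have h2 : ∀ r : Γ(X, W), X.presheaf.germ (X.basicOpen b) (genericPoint X) hηb
      (algebraMap Γ(X, W) Γ(X, X.basicOpen b) r) =
      X.presheaf.germ W (genericPoint X) hη r := fun r =>
    X.presheaf.germ_res_apply (homOfLE (X.basicOpen_le b)) _ hηb r
  rw [map_mul, map_pow, h2, h2, X.presheaf.germ_res_apply (homOfLE hbO) _ hηb] at h1
  refine ⟨b ^ N, t', ?_, ?_⟩
  · rw [Scheme.mem_basicOpen _ _ _ hx, map_pow]
    exact ((Scheme.mem_basicOpen _ _ _ hx).mp hxb).pow N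
  · rw [algebraMap_germ_eq O hO hηO, map_pow, mul_comm]
    exact h1

/-- A rational function on an affine open set which is regular along the generic fibre becomes
regular after multiplication by a function on the base. -/
lemma exists_functionFieldMap_mul_mem_localRing {V : Y.Opens} (hV : IsAffineOpen V)
    {W : X.Opens} (hW : IsAffineOpen W) (e : W ≤ f ⁻¹ᵁ V) (hη : genericPoint X ∈ W)
    {u : X.functionField} (hu : ∀ x ∈ W, f x = genericPoint Y → u ∈ localRing x) :
    ∃ t : Y.functionField, t ≠ 0 ∧ (∀ y ∈ V, t ∈ localRing y) ∧
      ∀ x ∈ W, functionFieldMap f t * u ∈ localRing x := by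
  have hηV : genericPoint Y ∈ V := by
    rw [← map_genericPoint f]
    exact e hη
  let G : Γ(X, W) →+* X.functionField := (X.presheaf.germ W (genericPoint X) hη).hom
  let I : Ideal Γ(X, W) :=
    { carrier := {r | ∃ r', G r * u = G r'}
      zero_mem' := ⟨0, by rw [map_zero, zero_mul]⟩
      add_mem' := by
        rintro a b ⟨a', ha⟩ ⟨b', hb⟩
        exact ⟨a' + b', by rw [map_add, add_mul, ha, hb, map_add]⟩
      smul_mem' := by
        rintro c a ⟨a', ha⟩
        exact ⟨c * a', by rw [smul_eq_mul, map_mul, mul_assoc, ha, map_mul]⟩ }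
  have : Nonempty V := ⟨⟨_, hηV⟩⟩
  -- The ideal `I` consists of the denominators of `u`. If it contained no non-zero function from
  -- the base, a prime above it avoiding these functions would be a point of the generic fibre at
  -- which `u` is not regular.
  obtain ⟨t, ht0, r', hr'⟩ : ∃ t : Γ(Y, V), t ≠ 0 ∧ f.appLE V W e t ∈ I := by
    by_contra! hc
    obtain ⟨P, hP, hIP, hdisj⟩ := Ideal.exists_le_prime_disjoint I
      (Submonoid.map (f.appLE V W e).hom (nonZeroDivisors Γ(Y, V))) (by
        rw [Set.disjoint_left]
        rintro _ hI ⟨t, ht, rfl⟩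
        exact hc t (nonZeroDivisors.ne_zero ht) hI)
    let x : X := hW.fromSpec (⟨P, hP⟩ : PrimeSpectrum Γ(X, W))
    have hxb : ∀ r : Γ(X, W), x ∈ X.basicOpen r ↔ r ∉ P := fun r => by
      change (⟨P, hP⟩ : PrimeSpectrum Γ(X, W)) ∈ hW.fromSpec ⁻¹ᵁ X.basicOpen r ↔ _
      rw [hW.fromSpec_preimage_basicOpen]
      exact Iff.rfl
    have hxW : x ∈ W := by
      have : x ∈ Set.range hW.fromSpec := ⟨_, rfl⟩
      rwa [hW.range_fromSpec] at this
    have hfx : f x = genericPoint Y := by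
      refine (Specializes.antisymm (genericPoint_specializes (f x)) ?_).eq.symm
      refine specializes_iff_forall_open.mpr fun O hO hηO => ?_
      obtain ⟨b, hbO, hηb⟩ := hV.exists_basicOpen_le (V := ⟨O, hO⟩) ⟨_, hηO⟩ hηV
      have hb0 : b ≠ 0 := by
        rintro rfl
        rw [Scheme.basicOpen_zero] at hηb
        exact hηb
      have h1 : x ∈ X.basicOpen (f.appLE V W e b) := (hxb _).mpr fun hbP =>
        Set.disjoint_left.mp hdisj hbP ⟨b, mem_nonZeroDivisors_of_ne_zero hb0, rfl⟩
      rw [Scheme.basicOpen_appLE] at h1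
      exact hbO h1.2
    obtain ⟨r, r', hr, hrr'⟩ := exists_mul_germ_eq_of_mem_localRing hW hη hxW (hu x hxW hfx)
    exact (hxb r).mp hr (hIP ⟨r', hrr'⟩)
  refine ⟨Y.presheaf.germ V (genericPoint Y) hηV t, fun h0 => ht0 ?_, fun y hy =>
    germ_mem_localRing hy hηV t, fun x hx => ?_⟩
  · exact germ_genericPoint_injective V hηV (h0.trans (map_zero _).symm)
  · rw [functionFieldMap_germ_appLE f e hηV hη]
    change G _ * u ∈ _
    rw [hr']
    exact germ_mem_localRing hx hη _

/-- A rational section of `L` which is regular along the generic fibre becomes regular over an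
affine open subset of the base after multiplication by a function on the base. -/
lemma exists_functionFieldMap_mul_mem_stalk [QuasiCompact f] {V : Y.Opens} (hV : IsAffineOpen V)
    (L : CDiv X) {v : X.functionField}
    (hv : ∀ x, f x = genericPoint Y → v ∈ L.stalk x) :
    ∃ t : Y.functionField, t ≠ 0 ∧ (∀ y ∈ V, t ∈ localRing y) ∧
      ∀ x, f x ∈ V → functionFieldMap f t * v ∈ L.stalk x := by
  classical
  have key : ∀ x : X, ∃ W : X.Opens, x ∈ W ∧ (f x ∈ V → ∃ t : Y.functionField, t ≠ 0 ∧
      (∀ y ∈ V, t ∈ localRing y) ∧ ∀ x ∈ W, functionFieldMap f t * v ∈ L.stalk x) := by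
    intro x
    by_cases hx : f x ∈ V
    · obtain ⟨O, hO, g, hg⟩ := L.exists_equation x
      obtain ⟨W, hW, hxW, hle⟩ := exists_isAffineOpen_mem_and_subset
        (show x ∈ O ⊓ f ⁻¹ᵁ V from ⟨hO, hx⟩)
      obtain ⟨t, ht0, ht, htv⟩ := exists_functionFieldMap_mul_mem_localRing f hV hW
        (fun y hy => (hle hy).2) (genericPoint_mem_of_mem hxW) (u := v * g)
        fun y hy hfy => (CDiv.mem_stalk_iff (hg y (hle hy).1)).mp (hv y hfy)
      refine ⟨W, hxW, fun _ => ⟨t, ht0, ht, fun y hy => ?_⟩⟩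
      rw [CDiv.mem_stalk_iff (hg y (hle hy).1), mul_assoc]
      exact htv y hy
    · exact ⟨⊤, trivial, fun h => absurd h hx⟩
  choose W hxW hW using key
  have hcomp : IsCompact (f ⁻¹ᵁ V : Set X) := f.isCompact_preimage hV.isCompact
  obtain ⟨T, hTV, hT⟩ := hcomp.elim_nhds_subcover (fun x => (W x : Set X))
    fun x _ => (W x).2.mem_nhds (hxW x)
  have hT' : ∀ x ∈ T, f x ∈ V := hTV
  choose t ht0 ht htv using hW
  let t' : X → Y.functionField := fun x => if hx : f x ∈ V then t x hx else 1
  have ht' : ∀ x, ∀ y ∈ V, t' x ∈ localRing y := fun x y hy => by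
    simp only [t']
    split_ifs with hx
    · exact ht x hx y hy
    · exact one_mem _
  refine ⟨∏ x ∈ T, t' x, Finset.prod_ne_zero_iff.mpr fun x hx => ?_, fun y hy =>
    prod_mem fun x _ => ht' x y hy, fun x hx => ?_⟩
  · simp only [t', dif_pos (hT' x hx)]
    exact ht0 x _
  · obtain ⟨x', hx', hxx'⟩ := Set.mem_iUnion₂.mp (hT hx)
    rw [← Finset.prod_erase_mul T t' hx', map_mul, mul_assoc]
    refine CDiv.localRing_mul_mem_stalk (functionFieldMap_mem_localRing f
      (prod_mem fun x'' _ => ht' x'' _ hx)) ?_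
    simp only [t', dif_pos (hT' x' hx')]
    exact htv x' _ x hxx'

/-- The homomorphism of local rings at `x` is local, hence reflects units. -/
lemma CDiv.Generates.of_pullback {B : CDiv Y} {x : X} {a : Y.functionField}
    (ha : a ∈ B.stalk (f x)) (h : (CDiv.pullback f B).Generates (functionFieldMap f a) x) :
    B.Generates a (f x) := by
  obtain ⟨g, hg⟩ := B.exists_germ_eq (f x)
  obtain ⟨r, hr⟩ := (CDiv.mem_stalk_iff hg).mp ha
  obtain ⟨u, hu⟩ := (CDiv.generates_iff (CDiv.germ_pullback f hg)).mp h
  rw [CDiv.generates_iff hg]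
  have h1 : f.stalkMap x r = u := by
    apply IsFractionRing.injective (X.presheaf.stalk x) X.functionField
    rw [← functionFieldMap_algebraMap, hr, map_mul, hu]
    rfl
  have h2 : IsUnit r := by
    refine isUnit_of_map_unit (f.stalkMap x).hom r ?_
    change IsUnit (f.stalkMap x r)
    rw [h1]
    exact u.isUnit
  exact ⟨h2.unit, hr⟩

/-- Rational sections of `L` which are regular along the generic fibre become global sections after
multiplication by one section of a multiple of an ample divisor on the base. -/
theorem exists_mul_mem_stalk_of_ample [QuasiCompact f] [CompactSpace X] {A : CDiv Y}
    (hA : A.IsAmple) (L : CDiv X) {ι : Type*} [Finite ι] {v : ι → X.functionField}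
    (hv : ∀ i x, f x = genericPoint Y → v i ∈ L.stalk x) :
    ∃ (M : ℕ) (w : X.functionField), 0 < M ∧ w ≠ 0 ∧
      ∀ i x, w * v i ∈ (L + M • CDiv.pullback f A).stalk x := by
  classical
  have := Fintype.ofFinite ι
  obtain ⟨-, h⟩ := hA
  obtain ⟨n, hn, a, ha, V, hηV, hV, hgen⟩ := h (genericPoint Y)
  have ha0 : a ≠ 0 := ((hgen _).mp hηV).ne_zero
  choose t ht0 ht htv using fun i => exists_functionFieldMap_mul_mem_stalk f hV L (hv i)
  let B := CDiv.pullback f (n • A)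
  -- The product of the `t_i` clears denominators over the affine set where `a` generates; a power
  -- of `a` then removes the poles over its complement.
  have hext : ∀ i, ∃ N : ℕ, ∀ M, N ≤ M → ∀ x, functionFieldMap f a ^ M *
      (functionFieldMap f (∏ i, t i) * v i) ∈ (L + M • B).stalk x := fun i =>
    exists_pow_mul_mem_stalk L B (fun x => CDiv.functionFieldMap_mem_stalk f (ha (f x)))
      fun x hx => by
        have hfx : f x ∈ V := (hgen _).mpr (CDiv.Generates.of_pullback f (ha _) hx)
        rw [← Finset.prod_erase_mul Finset.univ t (Finset.mem_univ i), map_mul, mul_assoc]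
        exact CDiv.localRing_mul_mem_stalk (functionFieldMap_mem_localRing f
          (prod_mem fun j _ => ht j _ hfx)) (htv i x hfx)
  choose N hN using hext
  let M := Finset.univ.sup N + 1
  have hinj := (functionFieldMap f).injective
  refine ⟨M * n, functionFieldMap f a ^ M * functionFieldMap f (∏ i, t i),
    Nat.mul_pos (Nat.succ_pos _) hn, mul_ne_zero (pow_ne_zero _ ?_) ?_, fun i x => ?_⟩
  · exact (map_ne_zero_iff _ hinj).mpr ha0
  · exact (map_ne_zero_iff _ hinj).mpr (Finset.prod_ne_zero_iff.mpr fun i _ => ht0 i)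
  · have h1 := hN i M ((Finset.le_sup (Finset.mem_univ i)).trans (Nat.le_succ _)) x
    rw [mul_assoc, mul_smul, ← map_nsmul (CDiv.pullback f) n A]
    exact h1

end Denominators

section GenericFiber
variable {X Y : Scheme.{u}} [IsIntegral X] [IsIntegral Y] (f : X ⟶ Y) [IsDominant f]

/-- The generic fibre has the same local rings as `X` at its points, in particular at the generic
point. -/
lemma functionFieldMap_fiberι_surjective :
    Function.Surjective (functionFieldMap (f.fiberι (genericPoint Y))) := by
  intro z
  obtain ⟨w, hw⟩ := (bijective_stalkMap_fiberι f (genericPoint (f.fiber (genericPoint Y)))).2 z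
  obtain ⟨w', rfl⟩ : ∃ w', X.presheaf.stalkSpecializes
      (specializes_of_eq (map_genericPoint (f.fiberι (genericPoint Y)))) w' = w := by
    have : IsIso (X.presheaf.stalkSpecializes
      (specializes_of_eq (map_genericPoint (f.fiberι (genericPoint Y))))) := by
      exact (TopCat.Presheaf.stalkCongr X.presheaf
        (.of_eq (map_genericPoint (f.fiberι (genericPoint Y))).symm)).isIso_hom
    exact (ConcreteCategory.bijective_of_isIso (X.presheaf.stalkSpecializes
      (specializes_of_eq (map_genericPoint (f.fiberι (genericPoint Y)))))).2 w
  exact ⟨w', hw⟩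

lemma mem_stalk_of_functionFieldMap_fiberι (L : CDiv X) {v : X.functionField}
    (w : f.fiber (genericPoint Y))
    (hv : functionFieldMap (f.fiberι (genericPoint Y)) v ∈
      (CDiv.pullback (f.fiberι (genericPoint Y)) L).stalk w) :
    v ∈ L.stalk (f.fiberι (genericPoint Y) w) := by
  obtain ⟨g, hg⟩ := L.exists_germ_eq (f.fiberι (genericPoint Y) w)
  rw [CDiv.mem_stalk_iff (CDiv.germ_pullback _ hg)] at hv
  rw [CDiv.mem_stalk_iff hg]
  obtain ⟨a, ha⟩ := hv
  obtain ⟨b, rfl⟩ := (bijective_stalkMap_fiberι f w).2 a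
  refine ⟨b, (functionFieldMap (f.fiberι (genericPoint Y))).injective ?_⟩
  rw [map_mul]
  exact (functionFieldMap_algebraMap _ w b).trans ha

/-- Ratios of sections on the generic fibre are ratios of sections on the total space, after adding
a multiple of an ample divisor on the base. -/
theorem HasRatios.of_fiber [QuasiCompact f] [CompactSpace X] {A : QCDiv Y} (hA : A.IsAmple)
    (D : CDiv X) {n : ℕ} {z : Fin n → (f.fiber (genericPoint Y)).functionField}
    (h : HasRatios ((1 : ℚ) ⊗ₜ[ℤ] CDiv.pullback (f.fiberι (genericPoint Y)) D) (Set.range z)) :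
    ∃ z' : Fin n → X.functionField,
      (∀ i, functionFieldMap (f.fiberι (genericPoint Y)) (z' i) = z i) ∧
      ∃ c : ℚ, 0 < c ∧
        HasRatios ((1 : ℚ) ⊗ₜ[ℤ] D + c • QCDiv.pullback f A) (Set.range z') := by
  obtain ⟨N, hN, s, hs0, hs, hzs⟩ := h.exists_nsmul
  obtain ⟨m, hm, A', hA', hamp⟩ := hA
  obtain ⟨s', rfl⟩ := functionFieldMap_fiberι_surjective f s
  choose z' hz' using fun i => functionFieldMap_fiberι_surjective f (z i)
  have hgen : ∀ v : X.functionField, (∀ w, functionFieldMap (f.fiberι (genericPoint Y)) v ∈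
      (N • CDiv.pullback (f.fiberι (genericPoint Y)) D).stalk w) →
      ∀ x, f x = genericPoint Y → v ∈ (N • D).stalk x := by
    intro v hv x hx
    have : x ∈ Set.range (f.fiberι (genericPoint Y)) := by
      rw [Scheme.Hom.range_fiberι]
      exact hx
    obtain ⟨w, rfl⟩ := this
    refine mem_stalk_of_functionFieldMap_fiberι f _ w ?_
    rw [map_nsmul]
    exact hv w
  -- The index `none` stands for the denominator `s'`. One multiplier `w` serves denominator and
  -- numerators, so the ratios do not change.
  obtain ⟨M, w, hM, hw0, hw⟩ := exists_mul_mem_stalk_of_ample f hamp (N • D)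
    (v := fun o : Option (Fin n) => o.elim s' fun i => z' i * s') (by
      rintro (_ | i) x hx
      · exact hgen s' hs x hx
      · refine hgen (z' i * s') (fun y => ?_) x hx
        rw [map_mul, hz']
        exact hzs _ ⟨i, rfl⟩ y)
  have hN' : (0 : ℚ) < N := by exact_mod_cast hN
  have hMm : (0 : ℚ) < (M * m : ℕ) := by exact_mod_cast Nat.mul_pos hM hm
  have h1 : HasRatios ((N : ℚ) • ((1 : ℚ) ⊗ₜ[ℤ] D) + ((M * m : ℕ) : ℚ) • QCDiv.pullback f A)
      (Set.range z') := by
    refine ⟨1, one_pos, N • D + M • CDiv.pullback f A', ?_, w * s', mul_ne_zero hw0 ?_,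
      fun x => hw none x, ?_⟩
    · rw [one_smul, tmul_add, tmul_smul, tmul_smul, ← QCDiv.pullback_tmul, ← hA',
        Nat.cast_smul_eq_nsmul, Nat.cast_smul_eq_nsmul, map_nsmul, mul_smul]
    · rintro rfl
      exact hs0 (map_zero _)
    · rintro _ ⟨i, rfl⟩ x
      convert hw (some i) x using 1
      change _ = w * (z' i * s')
      ring
  refine ⟨z', hz', (N : ℚ)⁻¹ * ((M * m : ℕ) : ℚ), by positivity, ?_⟩
  have h2 := h1.smul (inv_pos.mpr hN')
  rwa [smul_add, inv_smul_smul₀ hN'.ne', smul_smul] at h2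

end GenericFiber

/-! ### Properness of projective schemes. -/

section Projective
attribute [local instance] MvPolynomial.gradedAlgebra
variable {k : Type u} [Field k]

lemma surjective_algebraMap_homogeneousSubmodule_zero (n : ℕ) : Function.Surjective
    (algebraMap k (MvPolynomial.homogeneousSubmodule (Fin (n + 1)) k 0)) := by
  rintro ⟨q, hq⟩
  refine ⟨q.coeff 0, Subtype.ext ?_⟩
  have h := MvPolynomial.totalDegree_eq_zero_iff_eq_C.mp
    (Nat.le_zero.mp (MvPolynomial.IsHomogeneous.totalDegree_le hq))
  exact h.symm

instance finiteType_homogeneousSubmodule_zero (n : ℕ) :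
    Algebra.FiniteType (MvPolynomial.homogeneousSubmodule (Fin (n + 1)) k 0)
      (MvPolynomial (Fin (n + 1)) k) :=
  have : IsScalarTower k (MvPolynomial.homogeneousSubmodule (Fin (n + 1)) k 0)
      (MvPolynomial (Fin (n + 1)) k) := ⟨fun a b c => smul_mul_assoc a b.1 c⟩
  Algebra.FiniteType.of_restrictScalars_finiteType k _ _

instance isProper_projectiveSpaceStructure (n : ℕ) : IsProper (projectiveSpaceStructure k n) := by
  have : IsClosedImmersion (Spec.map (CommRingCat.ofHom
      (algebraMap k (MvPolynomial.homogeneousSubmodule (Fin (n + 1)) k 0)))) :=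
    IsClosedImmersion.spec_of_surjective _ (surjective_algebraMap_homogeneousSubmodule_zero n)
  have h1 : IsProper (Proj.toSpecZero (MvPolynomial.homogeneousSubmodule (Fin (n + 1)) k)) :=
    inferInstance
  exact MorphismProperty.comp_mem @IsProper _ _ h1 (inferInstance : IsProper _)

lemma IsProjectiveOver.isProper {X : Scheme.{u}} {π : X ⟶ Spec (.of k)} (h : IsProjectiveOver π) :
    IsProper π := by
  obtain ⟨n, i, hi, rfl⟩ := h
  infer_instance

end Projective

/-! ### Transcendence degree and big divisors. -/

section TranscendenceDegree
variable {k : Type u} [Field k] {Y : Scheme.{u}} [IsIntegral Y] (π : Y ⟶ Spec (.of k))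

lemma trdeg_functionField_lt_aleph0 [LocallyOfFiniteType π] :
    letI := functionFieldAlgebra π
    Algebra.trdeg k Y.functionField < Cardinal.aleph0 := by
  let _ := functionFieldAlgebra π
  obtain ⟨U, hU, hη, -⟩ := exists_isAffineOpen_mem_and_subset
    (show genericPoint Y ∈ (⊤ : Y.Opens) from trivial)
  have : Nonempty U := ⟨⟨_, hη⟩⟩
  have := functionField_isFractionRing_of_isAffineOpen Y U hU
  let _ : Algebra k Γ(Y, U) := (baseSectionMap π U).toAlgebra
  have : Algebra.FiniteType k Γ(Y, U) := finiteType_baseSectionMap π hU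
  have : IsScalarTower k Γ(Y, U) Y.functionField :=
    .of_algebraMap_eq fun c => (germ_baseSectionMap π hη c).symm
  have : FaithfulSMul k Γ(Y, U) :=
    (faithfulSMul_iff_algebraMap_injective _ _).mpr (baseSectionMap π U).injective
  have : Algebra.IsAlgebraic Γ(Y, U) Y.functionField :=
    IsLocalization.isAlgebraic _ (nonZeroDivisors Γ(Y, U))
  rw [← _root_.trdeg_add_eq k Γ(Y, U), trdeg_eq_zero (R := Γ(Y, U)), add_zero]
  exact trdeg_lt_aleph0_of_finiteType

/-- A big divisor has ratios of sections forming a transcendence basis of the function field. -/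
lemma IsBig.exists_hasRatios [Infinite k] [LocallyOfFiniteType π] {H : QCDiv Y} (hH : IsBig π H) :
    letI := functionFieldAlgebra π
    ∃ (n : ℕ) (z : Fin n → Y.functionField), topologicalKrullDim Y ≤ n ∧
      IsTranscendenceBasis k z ∧ HasRatios H (Set.range z) := by
  let _ := functionFieldAlgebra π
  obtain ⟨n, hn⟩ := Cardinal.lt_aleph0.mp (trdeg_functionField_lt_aleph0 π)
  have hle : ∀ {r : ℕ} {z : Fin r → Y.functionField}, AlgebraicIndependent k z → r ≤ n := by
    intro r z hz
    have := hz.lift_cardinalMk_le_trdeg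
    rw [hn] at this
    simpa using this
  obtain ⟨s, hs⟩ := exists_isTranscendenceBasis k Y.functionField
  obtain ⟨z, hz⟩ : ∃ z : Fin n → Y.functionField, AlgebraicIndependent k z := by
    have h1 := hs.cardinalMk_eq_trdeg
    rw [hn] at h1
    obtain ⟨e⟩ : Nonempty (Fin n ≃ s) := by
      rw [← Cardinal.lift_mk_eq']
      simp [h1]
    exact ⟨_, hs.1.comp e e.injective⟩
  -- With `n` the transcendence degree, `n ≤ dim Y = κ(H)` yields `n` independent ratios,
  -- necessarily a transcendence basis. If `dim Y` exceeded `n`, bigness would give `n + 1`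
  -- independent functions.
  have hdim := le_topologicalKrullDim_of_algebraicIndependent π hz
  rw [← hH] at hdim
  obtain ⟨w, hw, hw'⟩ := exists_algebraicIndependent_of_le_kappa π hdim
  refine ⟨n, w, ?_, hw.isTranscendenceBasis_of_lift_trdeg_le_of_finite (by simp [hn]), hw'⟩
  refine le_of_lt_natCast_succ (lt_of_not_ge fun hc => ?_)
  rw [← hH] at hc
  obtain ⟨v, hv, -⟩ := exists_algebraicIndependent_of_le_kappa π hc
  exact absurd (hle hv) (by omega)

end TranscendenceDegree

/-! ### Compatibility of function fields and base fields. -/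

section Compatibility
variable {X Y : Scheme.{u}} [IsIntegral X] [IsIntegral Y]

lemma SpecMap_functionFieldMap_fromSpecStalk (f : X ⟶ Y) [IsDominant f] :
    Spec.map (CommRingCat.ofHom (functionFieldMap f)) ≫ Y.fromSpecStalk (genericPoint Y) =
      X.fromSpecStalk (genericPoint X) ≫ f := by
  rw [← Scheme.SpecMap_stalkMap_fromSpecStalk,
    ← Scheme.SpecMap_stalkSpecializes_fromSpecStalk (specializes_of_eq (map_genericPoint f)),
    ← Category.assoc, ← Spec.map_comp]
  rfl

lemma SpecMap_baseFieldMap {k : Type u} [Field k] (π : X ⟶ Spec (.of k)) :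
    Spec.map (CommRingCat.ofHom (baseFieldMap π)) = X.fromSpecStalk (genericPoint X) ≫ π := by
  have h : X.fromSpecStalk (genericPoint X) ≫ π ≫ (Spec (.of k)).toSpecΓ =
      Spec.map (π.appTop ≫ X.presheaf.germ ⊤ (genericPoint X) trivial) := by
    rw [Scheme.toSpecΓ_naturality, Scheme.fromSpecStalk_toSpecΓ_assoc, ← Spec.map_comp]
  change Spec.map ((Scheme.ΓSpecIso (.of k)).inv ≫ π.appTop ≫ _) = _
  rw [Spec.map_comp, ← h, Category.assoc, Category.assoc, toSpecΓ_SpecMap_ΓSpecIso_inv,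
    Category.comp_id]

lemma functionFieldMap_comp_baseFieldMap {k : Type u} [Field k] (f : X ⟶ Y) [IsDominant f]
    (π : Y ⟶ Spec (.of k)) :
    (functionFieldMap f).comp (baseFieldMap π) = baseFieldMap (f ≫ π) := by
  have h : CommRingCat.ofHom (baseFieldMap π) ≫ CommRingCat.ofHom (functionFieldMap f) =
      CommRingCat.ofHom (baseFieldMap (f ≫ π)) := by
    apply Spec.map_injective
    rw [Spec.map_comp, SpecMap_baseFieldMap, SpecMap_baseFieldMap,
      ← Category.assoc, SpecMap_functionFieldMap_fromSpecStalk, Category.assoc]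
  exact congrArg CommRingCat.Hom.hom h

/-- The two ring maps are compared after `Spec`. Composed with the monomorphism `Spec K(Y) ⟶ Y`,
both are the generic point of `Z` followed by `g ≫ f`. -/
lemma functionFieldMap_comp_of_fac {Z : Scheme.{u}} [IsIntegral Z] {F : Type u} [Field F]
    (g : Z ⟶ X) [IsDominant g] (f : X ⟶ Y) [IsDominant f] (π : Z ⟶ Spec (.of F))
    (ρ : Y.functionField →+* F)
    (h : g ≫ f = π ≫ Spec.map (CommRingCat.ofHom ρ) ≫ Y.fromSpecStalk (genericPoint Y)) :
    (functionFieldMap g).comp (functionFieldMap f) = (baseFieldMap π).comp ρ := by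
  have h : CommRingCat.ofHom (functionFieldMap f) ≫ CommRingCat.ofHom (functionFieldMap g) =
      CommRingCat.ofHom ρ ≫ CommRingCat.ofHom (baseFieldMap π) := by
    apply Spec.map_injective
    rw [← cancel_mono (Y.fromSpecStalk (genericPoint Y)), Spec.map_comp, Spec.map_comp,
      Category.assoc, Category.assoc, SpecMap_functionFieldMap_fromSpecStalk,
      SpecMap_baseFieldMap, Category.assoc, ← h, ← Category.assoc,
      SpecMap_functionFieldMap_fromSpecStalk, Category.assoc]
  exact congrArg CommRingCat.Hom.hom h

lemma functionFieldMap_fiberι_comp (f : X ⟶ Y) [IsDominant f] :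
    (functionFieldMap (f.fiberι (genericPoint Y))).comp (functionFieldMap f) =
      (baseFieldMap (F := Y.residueField (genericPoint Y))
        (f.fiberToSpecResidueField (genericPoint Y))).comp
        (Y.residue (genericPoint Y)).hom :=
  functionFieldMap_comp_of_fac (F := Y.residueField (genericPoint Y))
    (f.fiberι (genericPoint Y)) f (f.fiberToSpecResidueField (genericPoint Y)) _
    (f.fiber_fac (genericPoint Y))

end Compatibility

/-! ### Decomposition of `D + f^*H`. -/

section Assembly
variable {X Y : Scheme.{u}} [IsIntegral X] [IsIntegral Y] (f : X ⟶ Y) [IsDominant f]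

/-- A relation over `K(Y)` maps to one over `κ(η)` on the generic fibre, and injectivity of `K(Y) →
κ(η)` detects its coefficients. -/
lemma algebraicIndependent_of_fiber {m : ℕ} {z : Fin m → X.functionField}
    (hz : letI : Algebra (Y.residueField (genericPoint Y)) (f.fiber (genericPoint Y)).functionField :=
        functionFieldAlgebra (f.fiberToSpecResidueField (genericPoint Y))
      AlgebraicIndependent (Y.residueField (genericPoint Y))
        (functionFieldMap (f.fiberι (genericPoint Y)) ∘ z)) :
    letI := (functionFieldMap f).toAlgebra
    AlgebraicIndependent Y.functionField z := by
  let _ := functionFieldAlgebra (F := Y.residueField (genericPoint Y))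
    (f.fiberToSpecResidueField (genericPoint Y))
  let _ := (functionFieldMap f).toAlgebra
  have hinj : Function.Injective ((Y.residue (genericPoint Y)).hom :
      Y.functionField →+* Y.residueField (genericPoint Y)) :=
    RingHom.injective (R := Y.functionField) _
  exact AlgebraicIndependent.of_ringHom_of_comp_eq (R := Y.functionField)
    (S := Y.residueField (genericPoint Y))
    ((Y.residue (genericPoint Y)).hom :
      Y.functionField →+* Y.residueField (genericPoint Y))
    (functionFieldMap (f.fiberι (genericPoint Y))) hz hinj (functionFieldMap_fiberι_comp f).symm

/-- Independence is additive in the tower `k ⊆ K(Y) ⊆ K(X)`; this is where fibre dimension and base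
dimension add up. -/
lemma exists_algebraicIndependent_range_eq {k : Type u} [Field k] (π : Y ⟶ Spec (.of k)) {m n : ℕ}
    {y : Fin n → Y.functionField} {z : Fin m → X.functionField}
    (hy : letI := functionFieldAlgebra π; AlgebraicIndependent k y)
    (hz : letI := (functionFieldMap f).toAlgebra; AlgebraicIndependent Y.functionField z) :
    letI := functionFieldAlgebra (f ≫ π)
    ∃ w : Fin (m + n) → X.functionField, AlgebraicIndependent k w ∧
      Set.range w = Set.range z ∪ functionFieldMap f '' Set.range y := by
  let _ := functionFieldAlgebra (f ≫ π)
  let _ := functionFieldAlgebra π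
  let _ := (functionFieldMap f).toAlgebra
  have : IsScalarTower k Y.functionField X.functionField :=
    .of_algebraMap_eq' (functionFieldMap_comp_baseFieldMap f π).symm
  refine ⟨_, (hy.sumElim_comp hz).comp finSumFinEquiv.symm finSumFinEquiv.symm.injective, ?_⟩
  rw [finSumFinEquiv.symm.surjective.range_comp, Set.Sum.elim_range, Set.range_comp]
  rfl

variable {f}

/-- Ratios of sections of `D + c f^*A`, of `H`, a section of `H - ε A` and sections of `D + δ f^*A`
for arbitrarily small `δ` combine to ratios of sections of `D + f^*H`. -/
lemma HasRatios.combine {Δ : QCDiv X} {A H : QCDiv Y} {S : Set X.functionField}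
    {T : Set Y.functionField} (hA : HasRatios A ∅) {c : ℚ} (hc : 0 < c)
    (hS : HasRatios (Δ + c • QCDiv.pullback f A) S) (hT : HasRatios H T) {ε : ℚ} (hε : 0 < ε)
    (hH : HasRatios (H - ε • A) ∅) {δ : ℚ} (hδ : 0 < δ) (hδε : δ < ε / 4)
    (hΔ : HasRatios (Δ + δ • QCDiv.pullback f A) ∅) :
    HasRatios (Δ + QCDiv.pullback f H) (S ∪ functionFieldMap f '' T) := by
  -- The cost `α c` is at most `ε/8` and `(1 - α) δ` is less than `ε/4`. The gain `ε/2` from `½ (H -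
  -- ε A)` therefore leaves a positive multiple `θ` of `A`.
  obtain ⟨α, hα, hα1, hαc⟩ : ∃ α : ℚ, 0 < α ∧ α < 1 ∧ α * c ≤ ε / 8 := by
    refine ⟨ε / (8 * c + 8 * ε), by positivity, ?_, ?_⟩
    · rw [div_lt_one (by positivity)]
      linarith
    · rw [div_mul_eq_mul_div, div_le_div_iff₀ (by positivity) (by norm_num)]
      nlinarith [mul_pos hε hε]
  have hθ : 0 < ε / 2 - α * c - (1 - α) * δ := by nlinarith [mul_pos hα hδ]
  have h := ((((hS.smul hα).add ((hT.pullback f).smul (one_half_pos (α := ℚ)))).add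
    ((hH.pullback f).smul (one_half_pos (α := ℚ)))).add (hΔ.smul (sub_pos.mpr hα1))).add
    ((hA.pullback f).smul hθ)
  rw [map_sub, QCDiv.pullback_smul] at h
  simp only [Set.image_empty, Set.union_empty] at h
  convert h using 1
  module

lemma hasRatios_add_smul_pullback {D : CDiv X} {A : QCDiv Y} {N n : ℕ} (hN : 0 < N) {E : CDiv Y}
    (hE : n • A = (1 : ℚ) ⊗ₜ[ℤ] E) {c : X.functionField} (hc0 : c ≠ 0)
    (hc : ∀ x, c ∈ (N • D + CDiv.pullback f E).stalk x) :
    HasRatios ((1 : ℚ) ⊗ₜ[ℤ] D + ((n : ℚ) / N) • QCDiv.pullback f A) ∅ := by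
  refine ⟨N, hN, _, ?_, c, hc0, hc, fun z hz => hz.elim⟩
  have hN' : (N : ℚ) ≠ 0 := by exact_mod_cast hN.ne'
  rw [tmul_add, tmul_smul, ← QCDiv.pullback_tmul, ← hE, map_nsmul, smul_add,
    ← Nat.cast_smul_eq_nsmul ℚ N (_ • _), smul_smul, mul_div_cancel₀ _ hN',
    Nat.cast_smul_eq_nsmul]

/-- A Frobenius weakly positive subsheaf of `F^{e*} f_* 𝒪_X(D)` yields sections of multiples of
`D + δ f^*A` for arbitrarily small `δ > 0`. -/
lemma IsFWP.exists_hasRatios {p : ℕ} (hp : p.Prime) (h : (p : Γ(Y, ⊤)) = 0) [JacobsonSpace Y]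
    (hsep : IsSeparableMorphism f) (D : CDiv X) (e : ℕ) {M : Y.Modules}
    (i : M ⟶ (Scheme.Modules.pullback (absFrobenius hp h e)).obj
      ((Scheme.Modules.pushforward f).obj D.sheaf)) [Mono i] (hM0 : ¬ Limits.IsZero M)
    (hM : IsFWP hp h M) :
    ∃ A : QCDiv Y, A.IsAmple ∧ ∀ ε : ℚ, 0 < ε → ∃ δ : ℚ, 0 < δ ∧ δ < ε ∧
      HasRatios ((1 : ℚ) ⊗ₜ[ℤ] D + δ • QCDiv.pullback f A) ∅ := by
  obtain ⟨hcoh, htf, A, hA, n, hn, hlim⟩ := hM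
  refine ⟨A, hA, fun ε hε => ?_⟩
  obtain ⟨e', he', hlt⟩ := ((Filter.eventually_gt_atTop 0).and
    (hlim.eventually_lt_const (show (0 : ℝ) < (ε : ℝ) by exact_mod_cast hε))).exists
  obtain ⟨hn0, E, hE, hG⟩ := hn e' he'
  obtain ⟨c, hc0, hc⟩ := IsFWP.exists_mem_stalk hp h hsep D e i hM0 hcoh htf e' E hG
  have hN : 0 < p ^ e' * p ^ e := Nat.mul_pos (pow_pos hp.pos _) (pow_pos hp.pos _)
  -- The section found belongs to `p^{e'+e} D + f^*E` with `E = n_{e'} A`, whence this `δ`. It is at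
  -- most `n_{e'}/p^{e'}`, which tends to zero.
  refine ⟨(n e' : ℚ) / ((p ^ e' * p ^ e : ℕ) : ℚ), by positivity, ?_,
    hasRatios_add_smul_pullback hN hE hc0 hc⟩
  have hlt' : (n e' : ℚ) / (p : ℚ) ^ e' < ε := by
    rw [← Rat.cast_lt (K := ℝ)]
    push_cast
    exact hlt
  refine lt_of_le_of_lt ?_ hlt'
  have hp0 : (0 : ℚ) < (p : ℚ) ^ e' := pow_pos (by exact_mod_cast hp.pos) _
  have hp1 : (1 : ℚ) ≤ (p : ℚ) ^ e := one_le_pow₀ (by exact_mod_cast hp.one_le)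
  push_cast
  gcongr
  exact le_mul_of_one_le_right hp0.le hp1

/-- Testing against natural numbers covers the degenerate values as well: nothing is required when
`a = ⊥`, and `a = ⊤` forces `b = ⊤`. -/
lemma add_natCast_le_of_forall {a b : WithBot ℕ∞} {n : ℕ}
    (h : ∀ m : ℕ, (m : WithBot ℕ∞) ≤ a → ((m + n : ℕ) : WithBot ℕ∞) ≤ b) : a + n ≤ b := by
  induction a using WithBot.recBotCoe with
  | bot => simp
  | coe a =>
    induction a using ENat.recTopCoe with
    | top =>
      have hb : ∀ m : ℕ, (m : WithBot ℕ∞) ≤ b := fun m =>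
        (show (m : WithBot ℕ∞) ≤ ((m + n : ℕ) : WithBot ℕ∞) by exact_mod_cast Nat.le_add_right m n).trans
          (h m (WithBot.coe_le_coe.mpr le_top))
      induction b using WithBot.recBotCoe with
      | bot => simpa using hb 0
      | coe b =>
        have : b = ⊤ := ENat.eq_top_iff_forall_ge.mpr fun m => WithBot.coe_le_coe.mp (hb m)
        rw [this]
        exact le_top
    | coe a => exact_mod_cast h a le_rfl

end Assembly
end
end FWPKod

theorem mainTheorem5 {k : Type u} [Field k] [IsAlgClosed k] {p : ℕ} (hp : p.Prime) [CharP k p]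
    {X Y : Scheme.{u}} [IsIntegral X] [IsIntegral Y]
    (πX : X ⟶ Spec (.of k)) (πY : Y ⟶ Spec (.of k))
    (hXn : IsNormalScheme X) (hYn : IsNormalScheme Y)
    (hXp : IsProjectiveOver πX) (hYp : IsProjectiveOver πY)
    (f : X ⟶ Y) (hf : f ≫ πY = πX) [IsFibration f] (hsep : IsSeparableMorphism f)
    (D : CDiv X) (e : ℕ) (he : 0 < e)
    (hFWP : ∃ (M : Y.Modules)
      (i : M ⟶ (Scheme.Modules.pullback (absFrobenius hp (natCast_eq_zero_of_charP p πY) e)).obj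
        ((Scheme.Modules.pushforward f).obj D.sheaf)),
      Mono i ∧ ¬ Limits.IsZero M ∧ IsFWP hp (natCast_eq_zero_of_charP p πY) M)
    (H : QCDiv Y) (hH : IsBig πY H) :
    kappa (F := Y.residueField (genericPoint Y)) (f.fiberToSpecResidueField (genericPoint Y))
        ((1 : ℚ) ⊗ₜ[ℤ] CDiv.pullback (f.fiberι (genericPoint Y)) D) + topologicalKrullDim Y
      ≤ kappa πX ((1 : ℚ) ⊗ₜ[ℤ] D + QCDiv.pullback f H) := by
  subst hf
  have := hYp.isProper
  have := hXp.isProper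
  have : JacobsonSpace Y := LocallyOfFiniteType.jacobsonSpace πY
  have : QuasiCompact f := .of_comp f πY
  have : CompactSpace X := (quasiCompact_iff_compactSpace (f := f ≫ πY)).mp inferInstance
  obtain ⟨M, i, hi, hM0, hM⟩ := hFWP
  obtain ⟨A, hA, hsmall⟩ := hM.exists_hasRatios hp _ hsep D e i hM0
  obtain ⟨n, y, hdim, hy, hyH⟩ := hH.exists_hasRatios πY
  obtain ⟨ε, hε, hHA⟩ := exists_hasRatios_sub_smul πY hA hyH
    (letI := functionFieldAlgebra πY; hy.isAlgebraic)
  obtain ⟨δ, hδ, hδε, hδD⟩ := hsmall (ε / 4) (by positivity)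
  -- The dimension of `Y` is replaced by the length `n` of the transcendence basis `y`, and the
  -- generic fibre contributes any `m` not exceeding its Iitaka dimension.
  refine (add_le_add_right hdim _).trans (add_natCast_le_of_forall fun m hm => ?_)
  obtain ⟨z, hz, hzD⟩ := exists_algebraicIndependent_of_le_kappa
    (F := Y.residueField (genericPoint Y)) (f.fiberToSpecResidueField (genericPoint Y)) hm
  obtain ⟨z', hz', c, hc, hcD⟩ := HasRatios.of_fiber f hA D hzD
  obtain rfl : functionFieldMap (f.fiberι (genericPoint Y)) ∘ z' = z := funext hz'
  obtain ⟨w, hw, hrange⟩ := exists_algebraicIndependent_range_eq f πY hy.1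
    (algebraicIndependent_of_fiber f hz)
  refine HasRatios.le_kappa (f ≫ πY) hw ?_
  rw [hrange]
  exact hA.hasRatios.combine hc hcD hyH hε hHA hδ hδε hδD
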